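/- Let $q\in\mathbb{C}$ with $0<|q|<1$; fix square roots $q^{1/2}$ of $q$ and $(-q)^{1/2}$ of $-q$, and put $(-q^3)^{1/2}=q(-q)^{1/2}$. Put $[n]=(q^n-q^{-n})/(q-q^{-1})$ and $[A,B]_p=AB-pBA$. **Fock space.** For $i=0,1$ let $V(\Lambda_i)=\mathbb{C}[a_{-1},a_{-2},\dots]\otimes\bigoplus_{n\in\mathbb{Z}}\mathbb{C}e^{\Lambda_i+n\alpha}$, where $\Lambda_1=\Lambda_0+\alpha/2$, $(\alpha,\alpha)=2$, $(\alpha,\Lambda_0)=0$. For $n\ge 1$ the operator $a_{-n}$ is multiplication by the variable and $a_n=\frac{[2n][n]}{n}\frac{\partial}{\partial a_{-n}}$, so that $[a_k,a_l]=\delta_{k+l,0}\frac{[2k]}{k}\frac{q^k-q^{-k}}{q-q^{-1}}$. Further $e^{\gamma}(f\otimes e^{\beta})=f\otimes e^{\beta+\gamma}$ for $\gamma\in\frac12\mathbb{Z}\alpha$ and $\partial(f\otimes e^\beta)=(\alpha,\beta)f\otimes e^\beta$. **Vertex operators.** Define $$X^-(z)=\sum_{k\in\mathbb{Z}}x_k^-z^{-k-1}=\exp\Big(-\sum_{n\ge1}\frac{a_{-n}}{[n]}q^{n/2}z^n\Big)\exp\Big(\sum_{n\ge1}\frac{a_n}{[n]}q^{n/2}z^{-n}\Big)e^{-\alpha}z^{-\partial},$$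 $$\Phi_-(z)=\exp\Big(\sum_{n\ge1}\frac{a_{-n}}{[2n]}q^{7n/2}z^n\Big)\exp\Big(-\sum_{n\ge1}\frac{a_n}{[2n]}q^{-5n/2}z^{-n}\Big)e^{\alpha/2}(-q^3z)^{\partial/2},\qquad \Phi_+(z)=[\Phi_-(z),x_0^-]_q .$$ These are formal series in $z^{1/2},z^{-1/2}$ whose coefficients in $\Phi_\pm(z)$ map $V(\Lambda_i)$ to $V(\Lambda_{1-i})$. Let $v_+,v_-$ be the basis of $\mathbb{C}^2$ and put $\Phi(z)=\Phi_+(z)\otimes v_++\Phi_-(z)\otimes v_-$, $$\Phi^{(1)}(z)\Phi^{(2)}(w)=\sum_{\epsilon_1,\epsilon_2=\pm}\Phi_{\epsilon_1}(z)\Phi_{\epsilon_2}(w)\otimes v_{\epsilon_1}\otimes v_{\epsilon_2},\qquad \Phi^{(2)}(w)\Phi^{(1)}(z)=\sum_{\epsilon_1,\epsilon_2=\pm}\Phi_{\epsilon_2}(w)\Phi_{\epsilon_1}(z)\otimes v_{\epsilon_1}\otimes v_{\epsilon_2}.$$ **Scalar function, R-matrix, delta function.** Let $\alpha_\phi(x)=\frac{(q^4x;q^4)_\infty}{(q^2x;q^4)_\infty}$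 with $(ax;p)_\infty=\prod_{j\ge0}(1-ap^jx)$, and in the basis $v_+\otimes v_+,\ v_+\otimes v_-,\ v_-\otimes v_+,\ v_-\otimes v_-$ let $$R(x)=\begin{pmatrix}1&0&0&0\\0&\frac{(1-x)q}{1-q^2x}&\frac{1-q^2}{1-q^2x}&0\\0&\frac{(1-q^2)x}{1-q^2x}&\frac{(1-x)q}{1-q^2x}&0\\0&0&0&1\end{pmatrix}.$$ Both $\alpha_\phi(x)$ and $R^{-1}(x)$ are expanded in nonnegative powers of $x$. For $i=0,1$ put $$\delta_i(z,q^2w)=\sum_{\substack{k+l=-1\\ k,l\in\frac i2+\mathbb{Z}}}z^k\,q^{2l}w^l ,$$ so $\delta_0(z,q^2w)=\delta(z,q^2w)$ is the usual formal delta function, and $\delta_1(z,q^2w)=q^{-1}z^{1/2}w^{-1/2}\,\delta(z,q^2w)$. **Theorem.** For $i=0,1$ the following identity of formal series in $z^{\pm1/2},w^{\pm1/2}$ with coefficients in linear maps from $V(\Lambda_i)$ to $V(\Lambda_i)\otimes\mathbb{C}^2\otimes\mathbb{C}^2$ holds: $$z^{-1/2}\alpha_\phi(w/z)\,\Phi^{(1)}(z)\Phi^{(2)}(w)=w^{-1/2}\alpha_\phi(z/w)\,R^{-1}(z/w)\,\Phi^{(2)}(w)\Phi^{(1)}(z)+(-1)^{\partial}(-q)^{1/2}\big(q^{-1}v_-\otimes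 v_+-q^{-2}v_+\otimes v_-\big)\,\delta_i(z,q^2w).$$ -/

import Mathlib

noncomputable section

namespace VertexOp

open PowerSeries

/-! ## Fock space -/

/-- `ℂ[a_{-1}, a_{-2}, …]`; the variable `X n` stands for `a_{-n}`, `n ≥ 1`. -/
abbrev Pol : Type := MvPolynomial ℕ+ ℂ

/-- `V(Λ₀) ⊕ V(Λ₁) = ℂ[a_{-1}, a_{-2}, …] ⊗ ⨁_m ℂ e_m`, where `e_m = e^{Λ₀ + m α / 2}`.
Since `Λ₁ = Λ₀ + α / 2`, the vector `e^{Λ_i + n α}` is `e_{i + 2 n}`, and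
`(α, Λ₀ + m α / 2) = m`. The element `f ⊗ e_m` is `Finsupp.single m f`. -/
abbrev Fock : Type := ℤ →₀ Pol

/-- The submodule `V(Λ_i)`, `i = 0, 1`: the span of all `f ⊗ e_m` with `m ≡ i` modulo `2`. -/
def V (i : ZMod 2) : Submodule ℂ Fock :=
  Finsupp.supported Pol ℂ {m : ℤ | (m : ZMod 2) = i}

/-- `q`-integer `[n] = (q^n - q^{-n}) / (q - q⁻¹)`. -/
def qInt (q : ℂ) (n : ℕ) : ℂ := (q ^ n - (q ^ n)⁻¹) / (q - q⁻¹)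

/-- `a_{-n}` for `n ≥ 1`: multiplication by the variable. -/
def aNeg (n : ℕ+) : Module.End ℂ Pol := LinearMap.mulLeft ℂ (MvPolynomial.X n)

/-- `a_n` for `n ≥ 1`: the derivation `([2n][n] / n) ∂/∂a_{-n}`, so that `a_n 1 = 0` and
`[a_n, a_{-n}] = ([2n] / n) (q^n - q^{-n}) / (q - q⁻¹)` (level one, `γ = q`). -/
def aPos (q : ℂ) (n : ℕ+) : Module.End ℂ Pol :=
  (qInt q (2 * n) * qInt q n / (n : ℂ)) • (MvPolynomial.pderiv n).toLinearMap

/-- The operator `∂ : f ⊗ e_m ↦ m f ⊗ e_m` enters through `(-1)^∂ : f ⊗ e_m ↦ (-1)^m f ⊗ e_m`. -/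
def negOnePowDel : Module.End ℂ Fock :=
  Finsupp.lsum ℂ fun m : ℤ => ((-1 : ℂ) ^ m) • Finsupp.lsingle m

/-! ## Exponentials and normally ordered exponentials -/

/-- The operator-valued series `∑_{n ≥ 1} c n • a n xⁿ`. -/
def opSeries (c : ℕ+ → ℂ) (a : ℕ+ → Module.End ℂ Pol) : PowerSeries (Module.End ℂ Pol) :=
  PowerSeries.mk fun n => if h : 0 < n then c ⟨n, h⟩ • a ⟨n, h⟩ else 0

/-- `exp f = ∑_j f^j / j!` for an operator-valued power series `f` without constant term;
`f^j` does not contribute to the coefficient of `xⁿ` when `j > n`. -/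
def expSeries (f : PowerSeries (Module.End ℂ Pol)) : PowerSeries (Module.End ℂ Pol) :=
  PowerSeries.mk fun n =>
    ∑ j ∈ Finset.range (n + 1), ((j.factorial : ℂ)⁻¹) • PowerSeries.coeff n (f ^ j)

/-- Polynomials all of whose monomials have degree less than `d`, where `a_{-n}` has degree `n`. -/
def degLT (d : ℕ) : Submodule ℂ Pol :=
  MvPolynomial.restrictSupport ℂ {s : ℕ+ →₀ ℕ | s.weight (fun n : ℕ+ => (n : ℕ)) < d}

theorem aPos_mem_degLT (q : ℂ) (n : ℕ+) (d : ℕ) (v : Pol) (hv : v ∈ degLT d) :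
    aPos q n v ∈ degLT (d - n) := by
  rw [degLT, MvPolynomial.restrictSupport_eq_span] at hv
  induction hv using Submodule.span_induction with
  | zero => simp
  | add x y _ _ hx hy => rw [map_add]; exact Submodule.add_mem _ hx hy
  | smul t x _ hx => rw [map_smul]; exact Submodule.smul_mem _ _ hx
  | mem x hx =>
    obtain ⟨m, hm, rfl⟩ := hx
    simp only [Set.mem_ofPred_eq] at hm
    refine Submodule.smul_mem _ _ ?_
    rw [Derivation.coeFn_coe, MvPolynomial.pderiv_monomial, degLT,
      MvPolynomial.monomial_mem_restrictSupport]
    by_cases h : m n = 0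
    · right; simp [h]
    · left
      have h1 : m - Finsupp.single n 1 + Finsupp.single n 1 = m :=
        Finsupp.sub_add_single_one_cancel h
      have h2 : (m - Finsupp.single n 1).weight (fun n : ℕ+ => (n : ℕ)) + n
          = m.weight (fun n : ℕ+ => (n : ℕ)) := by
        conv_rhs => rw [← h1]
        simp [map_add, Finsupp.weight_single]
      simp only [Set.mem_ofPred_eq]
      omega

theorem degLT_zero : degLT 0 = ⊥ := by
  simp [degLT, MvPolynomial.restrictSupport_eq_span]

theorem coeff_pow_mem_degLT (q : ℂ) (d : ℕ+ → ℂ) (j n N : ℕ) (v : Pol) (hv : v ∈ degLT N) :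
    PowerSeries.coeff n (opSeries d (aPos q) ^ j) v ∈ degLT (N - n) := by
  induction j generalizing n N v with
  | zero =>
    rw [pow_zero, PowerSeries.coeff_one]
    split_ifs with h
    · simpa [h] using hv
    · simp
  | succ j ih =>
    rw [pow_succ, PowerSeries.coeff_mul, LinearMap.sum_apply]
    refine Submodule.sum_mem _ fun p hp => ?_
    rw [Finset.HasAntidiagonal.mem_antidiagonal] at hp
    rw [Module.End.mul_apply]
    have h1 : PowerSeries.coeff p.2 (opSeries d (aPos q)) v ∈ degLT (N - p.2) := by
      rw [opSeries, PowerSeries.coeff_mk]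
      split_ifs with h
      · exact Submodule.smul_mem _ _ (aPos_mem_degLT q ⟨p.2, h⟩ N v hv)
      · simp
    have h2 := ih p.1 (N - p.2) _ h1
    rwa [Nat.sub_sub, Nat.add_comm, hp] at h2

/-- The coefficients of `exp (∑_{n ≥ 1} d n a_n x^n)` are locally finite. -/
theorem expPos_locallyFinite (q : ℂ) (d : ℕ+ → ℂ) (v : Pol) :
    ∃ N : ℕ, ∀ n, N ≤ n → PowerSeries.coeff n (expSeries (opSeries d (aPos q))) v = 0 := by
  obtain ⟨N, hN⟩ : ∃ N : ℕ, v ∈ degLT N := by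
    refine ⟨v.support.sup (fun s => s.weight (fun n : ℕ+ => (n : ℕ))) + 1, ?_⟩
    rw [degLT, MvPolynomial.mem_restrictSupport_iff]
    intro s hs
    exact Nat.lt_succ_of_le
      (Finset.le_sup (f := fun s : ℕ+ →₀ ℕ => s.weight (fun n : ℕ+ => (n : ℕ))) hs)
  refine ⟨N, fun n hn => ?_⟩
  have key := fun j => coeff_pow_mem_degLT q d j n N v hN
  simp only [Nat.sub_eq_zero_of_le hn, degLT_zero, Submodule.mem_bot] at key
  simp [expSeries, LinearMap.sum_apply, key]

/-- The coefficient of `x^k`, `k ∈ ℤ`, of a power series (zero for `k < 0`). -/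
def coeffZ (f : PowerSeries (Module.End ℂ Pol)) (k : ℤ) : Module.End ℂ Pol :=
  if 0 ≤ k then PowerSeries.coeff k.toNat f else 0

theorem normalExp_support_finite (q : ℂ) (c d : ℕ+ → ℂ) (k : ℤ) (v : Pol) :
    (Function.support fun n : ℕ =>
      coeffZ (expSeries (opSeries c aNeg)) (k + n)
        (PowerSeries.coeff n (expSeries (opSeries d (aPos q))) v)).Finite := by
  obtain ⟨N, hN⟩ := expPos_locallyFinite q d v
  refine (Set.finite_lt_nat N).subset fun n hn => ?_
  by_contra h
  exact hn (by simp [hN n (not_lt.mp h)])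

/-- The coefficient of `z^k` in
`exp (∑_{n ≥ 1} c n a_{-n} z^n) exp (∑_{n ≥ 1} d n a_n z^{-n})`, an operator on
`ℂ[a_{-1}, a_{-2}, …]`. The sum is finite on every vector. -/
def normalExp (q : ℂ) (c d : ℕ+ → ℂ) (k : ℤ) : Module.End ℂ Pol where
  toFun v := ∑ᶠ n : ℕ, coeffZ (expSeries (opSeries c aNeg)) (k + n)
    (PowerSeries.coeff n (expSeries (opSeries d (aPos q))) v)
  map_add' v w := by
    rw [← finsum_add_distrib (normalExp_support_finite q c d k v)
      (normalExp_support_finite q c d k w)]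
    simp
  map_smul' t v := by
    rw [RingHom.id_apply, smul_finsum]
    simp

/-! ## Currents and vertex operators

Throughout `r` is a square root of `q` and `s` is a square root of `-q`: `q^{k/2} = r^k`,
`(-q)^{1/2} = s` and `(-q^3)^{1/2} = q s`. -/

/-- `x_k^-`, the coefficient of `z^{-k-1}` in
`X^-(z) = exp (-∑ a_{-n}/[n] q^{n/2} z^n) exp (∑ a_n/[n] q^{n/2} z^{-n}) e^{-α} z^{-∂}`. -/
def xMinus (q r : ℂ) (k : ℤ) : Module.End ℂ Fock :=
  Finsupp.lsum ℂ fun m : ℤ => Finsupp.lsingle (m - 2) ∘ₗ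
    normalExp q (fun n => -(r ^ (n : ℕ) / qInt q n)) (fun n => r ^ (n : ℕ) / qInt q n)
      (-k - 1 + m)

/-- The coefficient of `z^{k/2}`, `k ∈ ℤ`, in
`Φ_-(z) = exp (∑ a_{-n}/[2n] q^{7n/2} z^n) exp (-∑ a_n/[2n] q^{-5n/2} z^{-n})
  e^{α/2} (-q^3 z)^{∂/2}`. -/
def phiMinus (q r s : ℂ) (k : ℤ) : Module.End ℂ Fock :=
  Finsupp.lsum ℂ fun m : ℤ =>
    if Even (k - m) then
      ((q * s) ^ m) • (Finsupp.lsingle (m + 1) ∘ₗ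
        normalExp q (fun n => r ^ (7 * (n : ℕ)) / qInt q (2 * n))
          (fun n => -((r ^ (5 * (n : ℕ)))⁻¹ / qInt q (2 * n))) ((k - m) / 2))
    else 0

/-- The coefficient of `z^{k/2}` in `Φ_+(z) = [Φ_-(z), x_0^-]_q = Φ_-(z) x_0^- - q x_0^- Φ_-(z)`. -/
def phiPlus (q r s : ℂ) (k : ℤ) : Module.End ℂ Fock :=
  phiMinus q r s k * xMinus q r 0 - q • (xMinus q r 0 * phiMinus q r s k)

/-- The labels `±` of the basis `v_+, v_-` of `ℂ²`. -/
inductive Sgn : Type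
  | plus : Sgn
  | minus : Sgn
  deriving DecidableEq

instance : Fintype Sgn := ⟨{Sgn.plus, Sgn.minus}, fun x => by cases x <;> simp⟩

/-- The component `Φ_ε(z)` of `Φ(z) = Φ_+(z) ⊗ v_+ + Φ_-(z) ⊗ v_-`; coefficient of `z^{k/2}`. -/
def phi (q r s : ℂ) : Sgn → ℤ → Module.End ℂ Fock
  | Sgn.plus => phiPlus q r s
  | Sgn.minus => phiMinus q r s

/-! ## Formal series in two variables -/

/-- Formal series `∑_{k,l ∈ ℤ} S k l z^{k/2} w^{l/2}` with coefficients in the Fock space. -/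
abbrev Series : Type := ℤ → ℤ → Fock

/-- Formal series with values in `Fock ⊗ ℂ² ⊗ ℂ²`; the component with index `(ε₁, ε₂)` is the
coefficient of `v_{ε₁} ⊗ v_{ε₂}`. -/
abbrev TSeries : Type := Sgn × Sgn → Series

/-- `Φ^{(1)}(z) Φ^{(2)}(w) v = ∑ Φ_{ε₁}(z) Φ_{ε₂}(w) v ⊗ v_{ε₁} ⊗ v_{ε₂}`. -/
def phiZphiW (q r s : ℂ) (v : Fock) : TSeries :=
  fun ε k l => phi q r s ε.1 k (phi q r s ε.2 l v)

/-- `Φ^{(2)}(w) Φ^{(1)}(z) v = ∑ Φ_{ε₂}(w) Φ_{ε₁}(z) v ⊗ v_{ε₁} ⊗ v_{ε₂}`. -/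
def phiWphiZ (q r s : ℂ) (v : Fock) : TSeries :=
  fun ε k l => phi q r s ε.2 l (phi q r s ε.1 k v)

/-- Multiplication by the monomial `z^{a/2} w^{b/2}`. -/
def mulMonomial (a b : ℤ) (S : Series) : Series := fun k l => S (k - a) (l - b)

/-- Multiplication by `f(w/z)`, `f` a power series. -/
def mulWZ (f : ℂ⟦X⟧) (S : Series) : Series :=
  fun k l => ∑ᶠ n : ℕ, PowerSeries.coeff n f • S (k + 2 * n) (l - 2 * n)

/-- Multiplication by `f(z/w)`, `f` a power series. -/
def mulZW (f : ℂ⟦X⟧) (S : Series) : Series :=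
  fun k l => ∑ᶠ n : ℕ, PowerSeries.coeff n f • S (k - 2 * n) (l + 2 * n)

/-- The action of a matrix `M(z/w)` on the factor `ℂ² ⊗ ℂ²`, its entries being power series. -/
def matZW (M : Matrix (Sgn × Sgn) (Sgn × Sgn) ℂ⟦X⟧) (S : TSeries) : TSeries :=
  fun ε => ∑ ε' : Sgn × Sgn, mulZW (M ε ε') (S ε')

/-- The delta function `δ(z, q² w) = ∑_{k + l = -1} z^k (q² w)^l`, where the exponents run over
`k, l ∈ i/2 + ℤ`; here indexed by the doubled exponents. For `i = 0` this is the usual formal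
delta function, for `i = 1` it is the latter times `(z / (q² w))^{1/2} = q⁻¹ z^{1/2} w^{-1/2}`. -/
def delta (q : ℂ) (i : ZMod 2) (k l : ℤ) : ℂ :=
  if k + l = -2 ∧ (k : ZMod 2) = i then q ^ l else 0

/-- `v_{ε₁} ⊗ v_{ε₂}` in coordinates. -/
def basisVec (ε₁ ε₂ : Sgn) : Sgn × Sgn → ℂ := Pi.single (ε₁, ε₂) 1

/-! ## The function `α_φ` and the R-matrix -/

open scoped PowerSeries.WithPiTopology in
/-- `(a x; p)_∞ = ∏_{j ≥ 0} (1 - a p^j x)` as a formal power series in `x`, with coefficientwise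
convergence. -/
def qPoch (a p : ℂ) : ℂ⟦X⟧ := ∏' j : ℕ, (1 - C (a * p ^ j) * X)

open scoped PowerSeries.WithPiTopology in
/-- The product converges for `‖p‖ < 1`. -/
theorem qPoch_multipliable (a p : ℂ) (hp : ‖p‖ < 1) :
    Multipliable fun j : ℕ => (1 - C (a * p ^ j) * X : ℂ⟦X⟧) := by
  have h : Summable fun t : Finset ℕ => ∏ j ∈ t, (-(C (a * p ^ j) * X) : ℂ⟦X⟧) := by
    rw [PowerSeries.WithPiTopology.summable_iff_summable_coeff]
    intro k
    have hs : Summable fun j : ℕ => ‖-(a * p ^ j)‖ := by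
      simpa [norm_mul, norm_pow] using
        (summable_geometric_of_lt_one (norm_nonneg p) hp).mul_left ‖a‖
    have h1 := (summable_finsetProd_of_summable_nonneg (fun _ => norm_nonneg _) hs)
    refine h1.of_norm_bounded fun t => ?_
    have h2 : ∏ j ∈ t, (-(C (a * p ^ j) * X) : ℂ⟦X⟧)
        = C (∏ j ∈ t, -(a * p ^ j)) * X ^ t.card := by
      rw [map_prod, ← Finset.prod_const, ← Finset.prod_mul_distrib]
      refine Finset.prod_congr rfl fun j _ => ?_
      rw [map_neg, neg_mul]
    rw [h2, PowerSeries.coeff_C_mul, PowerSeries.coeff_X_pow]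
    split_ifs
    · simp
    · simpa using Finset.prod_nonneg fun i _ => by positivity
  simpa [sub_eq_add_neg] using multipliable_one_add_of_summable_prod h

/-- `α_φ(x) = (q⁴ x; q⁴)_∞ / (q² x; q⁴)_∞`. -/
def alphaPhi (q : ℂ) : ℂ⟦X⟧ := qPoch (q ^ 4) (q ^ 4) * (qPoch (q ^ 2) (q ^ 4))⁻¹

/-- The matrix `R(x)` in the basis `v_+ ⊗ v_+, v_+ ⊗ v_-, v_- ⊗ v_+, v_- ⊗ v_-`, its entries
expanded in nonnegative powers of `x`. -/
def Rmat (q : ℂ) : Matrix (Sgn × Sgn) (Sgn × Sgn) ℂ⟦X⟧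
  | (.plus, .plus), (.plus, .plus) => 1
  | (.plus, .minus), (.plus, .minus) => (1 - X) * C q * (1 - C (q ^ 2) * X)⁻¹
  | (.plus, .minus), (.minus, .plus) => C (1 - q ^ 2) * (1 - C (q ^ 2) * X)⁻¹
  | (.minus, .plus), (.plus, .minus) => C (1 - q ^ 2) * X * (1 - C (q ^ 2) * X)⁻¹
  | (.minus, .plus), (.minus, .plus) => (1 - X) * C q * (1 - C (q ^ 2) * X)⁻¹
  | (.minus, .minus), (.minus, .minus) => 1
  | _, _ => 0

/-- `R(x)` is invertible over `ℂ⟦x⟧`, so that `(Rmat q)⁻¹` is its inverse. -/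
theorem Rmat_isUnit_det (q : ℂ) (hq : q ≠ 0) : IsUnit (Rmat q).det := by
  let N : Matrix (Sgn × Sgn) (Sgn × Sgn) ℂ := Matrix.of fun a b => match a, b with
    | (.plus, .plus), (.plus, .plus) => 1
    | (.plus, .minus), (.plus, .minus) => q⁻¹
    | (.plus, .minus), (.minus, .plus) => -(1 - q ^ 2) / q ^ 2
    | (.minus, .plus), (.minus, .plus) => q⁻¹
    | (.minus, .minus), (.minus, .minus) => 1
    | _, _ => 0
  have hu : (Finset.univ : Finset Sgn) = {Sgn.plus, Sgn.minus} := rfl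
  have hN : (Rmat q).map (constantCoeff (R := ℂ)) * N = 1 := by
    ext ⟨a, b⟩ ⟨c, d⟩
    rw [Matrix.mul_apply, Fintype.sum_prod_type]
    simp only [hu]
    cases a <;> cases b <;> cases c <;> cases d <;> simp [Rmat, N] <;>
      field_simp <;> ring
  have := Matrix.isUnit_det_of_right_inverse hN
  rw [PowerSeries.isUnit_iff_constantCoeff]
  rwa [RingHom.map_det]

/-! ## Well-definedness -/

theorem lsum_mem_V (T : ℤ → Pol →ₗ[ℂ] Fock) (i j : ZMod 2)
    (hT : ∀ m : ℤ, (m : ZMod 2) = i → ∀ p, T m p ∈ V j) (v : Fock) (hv : v ∈ V i) :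
    Finsupp.lsum ℂ T v ∈ V j := by
  rw [Finsupp.lsum_apply]
  exact Submodule.sum_mem _ fun m hm => hT m (hv hm) _

theorem xMinus_mem_V (q r : ℂ) (k : ℤ) (i : ZMod 2) (v : Fock) (hv : v ∈ V i) :
    xMinus q r k v ∈ V i := by
  refine lsum_mem_V _ i i (fun m hm p => ?_) v hv
  refine Finsupp.single_mem_supported ℂ _ ?_
  have h2 : (2 : ZMod 2) = 0 := rfl
  simp [hm, h2]

theorem phiMinus_mem_V (q r s : ℂ) (k : ℤ) (i : ZMod 2) (v : Fock) (hv : v ∈ V i) :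
    phiMinus q r s k v ∈ V (1 - i) := by
  refine lsum_mem_V _ i (1 - i) (fun m hm p => ?_) v hv
  split_ifs
  · refine Submodule.smul_mem _ _ (Finsupp.single_mem_supported ℂ _ ?_)
    have h2 : ∀ i : ZMod 2, i + 1 = 1 - i := by decide
    simp [hm, h2]
  · exact Submodule.zero_mem _

theorem phi_mem_V (q r s : ℂ) (ε : Sgn) (k : ℤ) (i : ZMod 2) (v : Fock) (hv : v ∈ V i) :
    phi q r s ε k v ∈ V (1 - i) := by
  cases ε with
  | minus => exact phiMinus_mem_V q r s k i v hv
  | plus =>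
    refine Submodule.sub_mem _ (phiMinus_mem_V q r s k i _ (xMinus_mem_V q r 0 i v hv)) ?_
    exact Submodule.smul_mem _ _ (xMinus_mem_V q r 0 _ _ (phiMinus_mem_V q r s k i v hv))

theorem normalExp_bounded_below (q : ℂ) (c d : ℕ+ → ℂ) (v : Pol) :
    ∃ N : ℤ, ∀ k < N, normalExp q c d k v = 0 := by
  obtain ⟨N, hN⟩ := expPos_locallyFinite q d v
  refine ⟨-N, fun k hk => ?_⟩
  refine (finsum_congr fun n => ?_).trans finsum_zero
  rcases lt_or_ge n N with h | h
  · rw [coeffZ, if_neg (by omega), LinearMap.zero_apply]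
  · rw [hN n h, map_zero]

theorem phiMinus_bounded_below (q r s : ℂ) (v : Fock) :
    ∃ N : ℤ, ∀ k < N, phiMinus q r s k v = 0 := by
  induction v using Finsupp.induction_linear with
  | zero => exact ⟨0, fun k _ => map_zero _⟩
  | add f g hf hg =>
    obtain ⟨N, hN⟩ := hf
    obtain ⟨M, hM⟩ := hg
    refine ⟨min N M, fun k hk => ?_⟩
    rw [lt_min_iff] at hk
    rw [map_add, hN k hk.1, hM k hk.2, add_zero]
  | single m p =>
    obtain ⟨N, hN⟩ := normalExp_bounded_below q
      (fun n => r ^ (7 * (n : ℕ)) / qInt q (2 * n))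
      (fun n => -((r ^ (5 * (n : ℕ)))⁻¹ / qInt q (2 * n))) p
    refine ⟨m + 2 * N, fun k hk => ?_⟩
    rw [phiMinus, Finsupp.lsum_single]
    split_ifs with h
    · rw [LinearMap.smul_apply, LinearMap.comp_apply, hN _ (by omega), map_zero, smul_zero]
    · rfl

/-- On every vector, the powers of `z` in `Φ_±(z)` are bounded below; hence the sums in `mulWZ`
and `mulZW` are finite for the products of vertex operators above. -/
theorem phi_bounded_below (q r s : ℂ) (ε : Sgn) (v : Fock) :
    ∃ N : ℤ, ∀ k < N, phi q r s ε k v = 0 := by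
  have h1 := phiMinus_bounded_below q r s
  cases ε with
  | minus => exact h1 v
  | plus =>
    obtain ⟨N, hN⟩ := h1 v
    obtain ⟨M, hM⟩ := h1 (xMinus q r 0 v)
    refine ⟨min N M, fun k hk => ?_⟩
    rw [lt_min_iff] at hk
    simp [phi, phiPlus, hN k hk.1, hM k hk.2]

end VertexOp

end

/-!
# Exchange relations of the level one vertex operators with a delta function

On `f ⊗ e_m` the operators `Φ_-(z)` and `X^-(z)` act by normally ordered exponentials on
`ℂ[a_{-1}, a_{-2}, …]`, up to a shift of `m`, a scalar and a shift of the exponent of `z`. A product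
of such exponentials is determined by its value on the vacuum `1`, because inserting a polynomial on
the right amounts to acting by a Laurent polynomial that does not depend on the order of the factors
(`opProduct_eq_dressing_smul`). On the vacuum, a product of three exponentials is the product of the
three creation exponentials, multiplied by the contraction of each pair of factors
(`opProduct_triple`). The contractions are `α_φ(w/z)⁻¹` for `Φ_-(z) Φ_-(w)`, `1 / (1 - q⁻² ζ/z)` for
`Φ_-(z) X^-(ζ)`, `1 / (1 - q⁴ z/ζ)` for `X^-(ζ) Φ_-(z)`, and `(1 - x)(1 - q² x)` with `x = ζ'/ζ` for
two currents. All relations thus reduce to partial fraction identities between expansions of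
`1 / (z - q⁻² ζ)` and `1 / (ζ - q⁴ z)` in opposite directions.

* After multiplication by `α_φ`, `Φ_-(z) Φ_-(w)` is symmetric in `z` and `w`. This is the component
  along `v_- ⊗ v_-`. The same symmetry with a current on the left or on the right gives
  `exchange_sum`, a relation between the components along `v_+ ⊗ v_-` and `v_- ⊗ v_+`.
* The identity `exchange_kernel` gives a second relation between these components, multiplied by
  `q² w - z`. To cancel this factor one needs that both sides have finitely many terms in the
  direction `w / z`. The only obstruction is `Φ_-(z) X^-(ζ) Φ_-(w)`, whose two contractions are
  expanded in `ζ / z` and `w / ζ`. As the creation parts of `Φ_-(q² w)`, `Φ_-(w)` and `X^-(q⁴ w)`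
  cancel, its coefficients far out in this direction are those of a multiple of
  `δ(z, q² w) δ(ζ, q⁴ w)` (`phi_cur_phi_one_apply`). Since `q² w - z` annihilates the latter, this
  multiple can be subtracted, and it is the source of the delta function in the theorem. It is a
  scalar multiple of the identity operator because the annihilation parts cancel as well
  (`dressing_smul_doubleDelta`). The result is `exchange_delta`.
* The Serre relation `Φ_- x_0² - (q + q⁻¹) x_0 Φ_- x_0 + x_0² Φ_- = 0` for `x_0 = x_0^-` follows from
  `serre_kernel` by symmetrisation in the two currents. It says that `Φ_+ x_0 = q⁻¹ x_0 Φ_+`. Hence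
  the component along `v_+ ⊗ v_+` is the commutator with `x_0` of the one along `v_+ ⊗ v_-`, and
  the delta function drops out, as `x_0` commutes with `(-1)^∂`.

Coefficients on the Fock space are the coefficients of the distributions above at a fixed power
`ζ^m` of the variable of the current (`slice`), because `x_0^-` acts on `f ⊗ e_m` by a single mode.
-/


noncomputable section

namespace VertexOp

open PowerSeries

/-! ### Multiplication of formal distributions by one-directional power series -/

section Distributions

variable {Λ M : Type*} [AddCommGroup Λ] [AddCommGroup M]

/-- The exponents occurring in `S` are bounded below along the linear functional `ℓ`. -/
def BoundedAlong (ℓ : Λ →+ ℤ) (S : Λ → M) : Prop :=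
  ∃ N : ℤ, ∀ κ, ℓ κ < N → S κ = 0

/-- Almost all `S (κ - n a)`, `n ≥ 0`, vanish, so that multiplication by `f(t^a)` is meaningful. -/
def LocFinite (a : Λ) (S : Λ → M) : Prop :=
  ∀ κ, ∃ N : ℕ, ∀ n, N ≤ n → S (κ - n • a) = 0

theorem BoundedAlong.locFinite {ℓ : Λ →+ ℤ} {S : Λ → M} (h : BoundedAlong ℓ S) {a : Λ}
    (ha : 0 < ℓ a) : LocFinite a S := by
  intro κ
  obtain ⟨B, hB⟩ := h
  refine ⟨(ℓ κ - B).toNat + 1, fun n hn => hB _ ?_⟩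
  rw [map_sub, map_nsmul, nsmul_eq_mul]
  have h1 : ℓ κ - B < n := by omega
  nlinarith

theorem LocFinite.add {a : Λ} {S T : Λ → M} (hS : LocFinite a S) (hT : LocFinite a T) :
    LocFinite a (S + T) := by
  intro κ
  obtain ⟨N, hN⟩ := hS κ
  obtain ⟨K, hK⟩ := hT κ
  refine ⟨max N K, fun n hn => ?_⟩
  rw [max_le_iff] at hn
  simp [hN n hn.1, hK n hn.2]

variable [Module ℂ M]

/-- Multiplication of the formal distribution `∑_κ S κ t^κ` by `f(t^a)`. It is meaningful when, for
each `κ`, almost all `S (κ - n a)`, `n ≥ 0`, vanish. -/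
def mulDir (f : ℂ⟦X⟧) (a : Λ) (S : Λ → M) : Λ → M :=
  fun κ => ∑ᶠ n : ℕ, coeff n f • S (κ - n • a)

theorem LocFinite.support_finite {a : Λ} {S : Λ → M} (h : LocFinite a S) (c : ℕ → ℂ) (κ : Λ) :
    (Function.support fun n : ℕ => c n • S (κ - n • a)).Finite := by
  obtain ⟨N, hN⟩ := h κ
  refine (Set.finite_lt_nat N).subset fun n hn => ?_
  by_contra h'
  exact hn (by simp [hN n (not_lt.mp h')])

theorem LocFinite.smul {a : Λ} {S : Λ → M} (hS : LocFinite a S) (c : ℂ) : LocFinite a (c • S) := by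
  intro κ
  obtain ⟨N, hN⟩ := hS κ
  exact ⟨N, fun n hn => by simp [hN n hn]⟩

theorem BoundedAlong.mulDir {ℓ : Λ →+ ℤ} {S : Λ → M} (h : BoundedAlong ℓ S) {a : Λ}
    (ha : 0 ≤ ℓ a) (f : ℂ⟦X⟧) : BoundedAlong ℓ (mulDir f a S) := by
  obtain ⟨B, hB⟩ := h
  refine ⟨B, fun κ hκ => finsum_eq_zero_of_forall_eq_zero fun n => ?_⟩
  rw [hB, smul_zero]
  rw [map_sub, map_nsmul, nsmul_eq_mul]
  have : 0 ≤ (n : ℤ) * ℓ a := by positivity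
  omega

theorem mulDir_add {a : Λ} {S T : Λ → M} (hS : LocFinite a S) (hT : LocFinite a T)
    (f : ℂ⟦X⟧) : mulDir f a (S + T) = mulDir f a S + mulDir f a T := by
  ext κ
  simp only [mulDir, Pi.add_apply, smul_add]
  exact finsum_add_distrib (hS.support_finite _ κ) (hT.support_finite _ κ)

theorem mulDir_smul (c : ℂ) (f : ℂ⟦X⟧) (a : Λ) (S : Λ → M) :
    mulDir f a (c • S) = c • mulDir f a S := by
  ext κ
  simp only [mulDir, Pi.smul_apply, smul_finsum]
  exact finsum_congr fun n => smul_comm _ _ _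

theorem mulDir_add_left {a : Λ} {S : Λ → M} (hS : LocFinite a S) (f g : ℂ⟦X⟧) :
    mulDir (f + g) a S = mulDir f a S + mulDir g a S := by
  ext κ
  simp only [mulDir, Pi.add_apply, map_add, add_smul]
  exact finsum_add_distrib (hS.support_finite _ κ) (hS.support_finite _ κ)

theorem mulDir_C (c : ℂ) (a : Λ) (S : Λ → M) : mulDir (C c) a S = c • S := by
  ext κ
  rw [mulDir, finsum_eq_single _ 0 fun n hn => by simp [coeff_C, hn]]
  simp

theorem mulDir_one (a : Λ) (S : Λ → M) : mulDir 1 a S = S := by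
  simpa using mulDir_C 1 a S

theorem mulDir_X (a : Λ) (S : Λ → M) : mulDir X a S = fun κ => S (κ - a) := by
  ext κ
  rw [mulDir, finsum_eq_single _ 1 fun n hn => by simp [coeff_X, hn]]
  simp

theorem mulDir_shift (f : ℂ⟦X⟧) (a b : Λ) (S : Λ → M) :
    mulDir f a (fun κ => S (κ - b)) = fun κ => mulDir f a S (κ - b) := by
  ext κ
  simp only [mulDir]
  exact finsum_congr fun n => by rw [sub_right_comm]

/-- Multiplications along two directions commute when the double sums involved are finite. -/
theorem mulDir_comm {ℓ ℓ' : Λ →+ ℤ} {S : Λ → M} (h : BoundedAlong ℓ S) (h' : BoundedAlong ℓ' S)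
    {a b : Λ} (ha : 0 < ℓ a) (hb : 0 ≤ ℓ b) (hb' : 0 < ℓ' b) (f g : ℂ⟦X⟧) :
    mulDir f a (mulDir g b S) = mulDir g b (mulDir f a S) := by
  ext κ
  obtain ⟨B, hB⟩ := h
  obtain ⟨B', hB'⟩ := h'
  -- The terms with `n > N` vanish; for each `n ≤ N` only finitely many `m` contribute.
  have hfin : (Function.support fun p : ℕ × ℕ =>
      coeff p.1 f • coeff p.2 g • S (κ - p.1 • a - p.2 • b)).Finite := by
    have hsub : (Function.support fun p : ℕ × ℕ =>
        coeff p.1 f • coeff p.2 g • S (κ - p.1 • a - p.2 • b)) ⊆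
        ⋃ n ∈ Set.Iio ((ℓ κ - B).toNat + 1),
          (fun m => (n, m)) '' Set.Iio ((ℓ' κ - n * ℓ' a - B').toNat + 1) := by
      rintro ⟨n, m⟩ hnm
      have hS : S (κ - n • a - m • b) ≠ 0 := fun h0 => hnm (by simp [h0])
      have h1 : B ≤ ℓ (κ - n • a - m • b) := by
        by_contra hc
        exact hS (hB _ (not_le.mp hc))
      have h2 : B' ≤ ℓ' (κ - n • a - m • b) := by
        by_contra hc
        exact hS (hB' _ (not_le.mp hc))
      simp only [map_sub, map_nsmul, nsmul_eq_mul] at h1 h2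
      have h3 : (n : ℤ) ≤ n * ℓ a := by nlinarith
      have h4 : 0 ≤ (m : ℤ) * ℓ b := by positivity
      have h5 : (m : ℤ) ≤ m * ℓ' b := by nlinarith
      simp only [Set.mem_iUnion, Set.mem_image, Set.mem_Iio]
      exact ⟨n, by omega, m, by omega, rfl⟩
    exact Set.Finite.subset
      (Set.Finite.biUnion (Set.finite_Iio _) fun n _ => (Set.finite_Iio _).image _) hsub
  have h1 := finsum_curry _ hfin
  have hfin' := hfin.preimage (Equiv.prodComm ℕ ℕ).injective.injOn
  have h2 := finsum_curry (fun p : ℕ × ℕ =>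
      coeff p.2 f • coeff p.1 g • S (κ - p.2 • a - p.1 • b)) hfin'
  have h3 := finsum_comp_equiv (Equiv.prodComm ℕ ℕ) (f := fun p : ℕ × ℕ =>
      coeff p.1 f • coeff p.2 g • S (κ - p.1 • a - p.2 • b))
  simp only [mulDir, smul_finsum]
  refine h1.symm.trans (h3.symm.trans (Eq.trans ?_ (h2.trans ?_)))
  · rfl
  · refine finsum_congr fun m => finsum_congr fun n => ?_
    rw [smul_comm, sub_right_comm]

theorem finsum_eq_finsum_antidiagonal {N : Type*} [AddCommMonoid N] (F : ℕ × ℕ → N)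
    (hF : (Function.support F).Finite) :
    ∑ᶠ p, F p = ∑ᶠ n : ℕ, ∑ p ∈ Finset.HasAntidiagonal.antidiagonal n, F p := by
  have hs : ∀ p, p ∉ hF.toFinset → F p = 0 := fun p hp => by simpa using hp
  rw [finsum_eq_sum_of_support_subset F (s := hF.toFinset) (by simp),
    finsum_eq_sum_of_support_subset _ (s := hF.toFinset.image fun p => p.1 + p.2),
    ← Finset.sum_fiberwise_of_maps_to fun p hp => Finset.mem_image_of_mem (fun p => p.1 + p.2) hp]
  · refine Finset.sum_congr rfl fun n _ => ?_
    refine Finset.sum_subset (fun p hp => ?_) fun p hp hp' => ?_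
    · rw [Finset.HasAntidiagonal.mem_antidiagonal]
      exact (Finset.mem_filter.mp hp).2
    · rw [Finset.HasAntidiagonal.mem_antidiagonal] at hp
      exact hs p fun h => hp' (Finset.mem_filter.mpr ⟨h, hp⟩)
  · intro n hn
    obtain ⟨p, hp, hp0⟩ := Finset.exists_ne_zero_of_sum_ne_zero hn
    rw [Finset.HasAntidiagonal.mem_antidiagonal] at hp
    rw [Finset.coe_image]
    exact ⟨p, by simpa using hp0, hp⟩

theorem mulDir_mul {a : Λ} {S : Λ → M} (h : LocFinite a S) (f g : ℂ⟦X⟧) :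
    mulDir (f * g) a S = mulDir f a (mulDir g a S) := by
  funext κ
  obtain ⟨N, hN⟩ := h κ
  set F : ℕ × ℕ → M := fun p => coeff p.1 f • coeff p.2 g • S (κ - p.1 • a - p.2 • a) with hF
  have hfin : (Function.support F).Finite := by
    refine ((Set.finite_Iio N).prod (Set.finite_Iio N)).subset ?_
    rintro ⟨n, p⟩ hnp
    rw [Set.mem_prod, Set.mem_Iio, Set.mem_Iio]
    by_contra hc
    refine hnp ?_
    simp only [hF]
    rw [sub_sub, ← add_smul, hN _ (by simp only at hc; omega), smul_zero, smul_zero]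
  have h1 := finsum_curry F hfin
  rw [finsum_eq_finsum_antidiagonal F hfin] at h1
  simp only [mulDir, smul_finsum]
  refine Eq.trans (finsum_congr fun n => ?_) h1
  rw [coeff_mul, Finset.sum_smul]
  refine Finset.sum_congr rfl fun p hp => ?_
  rw [Finset.HasAntidiagonal.mem_antidiagonal] at hp
  simp only [hF]
  rw [mul_smul, sub_sub, ← add_smul, hp]

theorem mulDir_cancel {a : Λ} {S : Λ → M} (h : LocFinite a S) {f g : ℂ⟦X⟧} (hfg : f * g = 1) :
    mulDir f a (mulDir g a S) = S := by
  rw [← mulDir_mul h, hfg, mulDir_one]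

/-- A linear map commutes with multiplication by `f(t^a)`. -/
theorem map_mulDir {N : Type*} [AddCommGroup N] [Module ℂ N] (T : M →ₗ[ℂ] N) {a : Λ} {S : Λ → M}
    (h : LocFinite a S) (f : ℂ⟦X⟧) (κ : Λ) :
    T (mulDir f a S κ) = mulDir f a (fun κ => T (S κ)) κ := by
  have := T.toAddMonoidHom.map_finsum (h.support_finite (fun n => coeff n f) κ)
  simpa [mulDir] using this

end Distributions

/-! ### Distributions as a module over Laurent polynomials -/

section LaurentModule

variable {Λ A : Type*} [AddCommGroup Λ] [CommRing A]

/-- The monomial `t^a` acting on formal distributions. -/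
def shiftHom : Multiplicative Λ →* Module.End A (Λ → A) where
  toFun a :=
    { toFun := fun S κ => S (κ - a.toAdd)
      map_add' := fun _ _ => rfl
      map_smul' := fun _ _ => rfl }
  map_one' := by ext; simp
  map_mul' a b := by ext S κ; simp [sub_sub]

/-- Formal distributions form a module over the ring of Laurent polynomials. -/
instance laurentModule : Module (AddMonoidAlgebra A Λ) (Λ → A) :=
  Module.compHom _ (AddMonoidAlgebra.lift A (Module.End A (Λ → A)) Λ shiftHom).toRingHom

theorem single_smul_apply (a : Λ) (r : A) (S : Λ → A) (κ : Λ) :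
    (AddMonoidAlgebra.single a r • S) κ = r * S (κ - a) := by
  change (AddMonoidAlgebra.lift A (Module.End A (Λ → A)) Λ shiftHom
    (AddMonoidAlgebra.single a r)) S κ = _
  rw [AddMonoidAlgebra.lift_single]
  rfl

theorem single_smul (a : Λ) (r : A) (S : Λ → A) :
    AddMonoidAlgebra.single a r • S = fun κ => r * S (κ - a) :=
  funext fun κ => single_smul_apply a r S κ

theorem LocFinite.laurent_smul {a : Λ} {S : Λ → A} (h : LocFinite a S)
    (t : AddMonoidAlgebra A Λ) : LocFinite a (t • S) := by
  induction t using AddMonoidAlgebra.induction_linear with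
  | zero => exact fun κ => ⟨0, fun n _ => by simp⟩
  | add x y hx hy => rw [add_smul]; exact hx.add hy
  | single b r =>
    intro κ
    obtain ⟨N, hN⟩ := h (κ - b)
    refine ⟨N, fun n hn => ?_⟩
    rw [single_smul_apply, sub_right_comm, hN n hn, mul_zero]

theorem mulDir_laurent_smul [Algebra ℂ A] {a : Λ} {S : Λ → A} (h : LocFinite a S) (f : ℂ⟦X⟧)
    (t : AddMonoidAlgebra A Λ) : mulDir f a (t • S) = t • mulDir f a S := by
  induction t using AddMonoidAlgebra.induction_linear with
  | zero =>
    ext κ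
    simp [mulDir]
  | add x y hx hy =>
    rw [add_smul, add_smul, mulDir_add (h.laurent_smul x) (h.laurent_smul y), hx, hy]
  | single b r =>
    ext κ
    simp only [single_smul]
    rw [mulDir_shift f a b (fun κ => r * S κ)]
    exact (map_mulDir (LinearMap.mulLeft ℂ r) h f (κ - b)).symm

end LaurentModule

/-! ### Exponentials of power series -/

section Exponentials

variable {R : Type*} [CommRing R]

/-- `γ = exp (∑_{n ≥ 1} β n xⁿ)`, expressed by the differential equation
`x γ' = (∑ n β n xⁿ) γ` and `γ(0) = 1`. The value `β 0` is irrelevant. -/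
def IsExp (β : ℕ → R) (γ : R⟦X⟧) : Prop :=
  constantCoeff γ = 1 ∧ X * derivative R γ = mk (fun n => n * β n) * γ

theorem coeff_X_mul_derivative (f : R⟦X⟧) (n : ℕ) :
    coeff n (X * derivative R f) = n * coeff n f := by
  cases n with
  | zero => simp
  | succ n => rw [coeff_succ_X_mul, coeff_derivative, mul_comm]; push_cast; rfl

theorem IsExp.coeff_eq {β : ℕ → R} {γ : R⟦X⟧} (h : IsExp β γ) (n : ℕ) :
    n * coeff n γ =
      ∑ p ∈ Finset.HasAntidiagonal.antidiagonal n, (p.1 * β p.1) * coeff p.2 γ := by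
  rw [← coeff_X_mul_derivative, h.2, coeff_mul]
  simp

theorem IsExp.congr {β β' : ℕ → R} {γ : R⟦X⟧} (h : IsExp β γ) (hβ : ∀ n, 0 < n → β n = β' n) :
    IsExp β' γ := by
  refine ⟨h.1, ?_⟩
  rw [h.2]
  congr 2
  ext n
  rcases Nat.eq_zero_or_pos n with rfl | hn
  · simp
  · simp [hβ n hn]

theorem isExp_zero : IsExp (0 : ℕ → R) 1 := by
  refine ⟨by simp, ?_⟩
  have h : (mk fun n => (n : R) * (0 : ℕ → R) n) = 0 := by ext n; simp
  rw [h]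
  simp

theorem IsExp.mul {β β' : ℕ → R} {γ γ' : R⟦X⟧} (h : IsExp β γ) (h' : IsExp β' γ') :
    IsExp (β + β') (γ * γ') := by
  refine ⟨by simp [h.1, h'.1], ?_⟩
  have hs : (mk fun n => (n : R) * (β + β') n) =
      mk (fun n => n * β n) + mk (fun n => n * β' n) := by
    ext n
    simp [mul_add]
  rw [Derivation.leibniz, smul_eq_mul, smul_eq_mul, hs]
  linear_combination γ * h'.2 + γ' * h.2

theorem IsExp.rescale {β : ℕ → R} {γ : R⟦X⟧} (h : IsExp β γ) (a : R) :
    IsExp (fun n => a ^ n * β n) (PowerSeries.rescale a γ) := by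
  refine ⟨?_, ?_⟩
  · rw [← coeff_zero_eq_constantCoeff_apply, coeff_rescale, coeff_zero_eq_constantCoeff_apply, h.1]
    simp
  have h1 : X * derivative R (PowerSeries.rescale a γ)
      = PowerSeries.rescale a (X * derivative R γ) := by
    ext n
    rw [coeff_X_mul_derivative, coeff_rescale, coeff_rescale, coeff_X_mul_derivative]
    ring
  have h2 : (mk fun n => (n : R) * (a ^ n * β n))
      = PowerSeries.rescale a (mk fun n => (n : R) * β n) := by
    ext n
    rw [coeff_rescale, coeff_mk, coeff_mk]
    ring
  rw [h1, h2, h.2, map_mul]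

theorem IsExp.ext [IsDomain R] [CharZero R] {β : ℕ → R} {γ γ' : R⟦X⟧} (h : IsExp β γ)
    (h' : IsExp β γ') : γ = γ' := by
  ext n
  induction n using Nat.strong_induction_on with
  | _ n ih =>
    rcases Nat.eq_zero_or_pos n with rfl | hn
    · rw [coeff_zero_eq_constantCoeff_apply, coeff_zero_eq_constantCoeff_apply, h.1, h'.1]
    · have hn' : (n : R) ≠ 0 := Nat.cast_ne_zero.mpr hn.ne'
      refine mul_left_cancel₀ hn' ?_
      rw [h.coeff_eq, h'.coeff_eq]
      refine Finset.sum_congr rfl fun p hp => ?_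
      rw [Finset.HasAntidiagonal.mem_antidiagonal] at hp
      rcases Nat.eq_zero_or_pos p.1 with h0 | h0
      · simp [h0]
      · rw [ih p.2 (by omega)]

theorem IsExp.eq_one [IsDomain R] [CharZero R] {β : ℕ → R} {γ : R⟦X⟧} (h : IsExp β γ)
    (hβ : ∀ n, 0 < n → β n = 0) : γ = 1 :=
  (h.congr (β' := 0) hβ).ext isExp_zero

theorem isExp_one_sub (a : ℂ) : IsExp (fun n => -(a ^ n / n)) (1 - C a * X) := by
  refine ⟨by simp, ?_⟩
  have h : (mk fun n : ℕ => (n : ℂ) * -(a ^ n / n)) * (1 - C a * X) = -(C a * X) := by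
    have h1 : (mk fun n : ℕ => (n : ℂ) * -(a ^ n / n)) = -(C a * X * mk fun n => a ^ n) := by
      ext n
      rw [map_neg, mul_assoc, coeff_C_mul, coeff_mk]
      cases n with
      | zero => simp
      | succ n =>
        rw [coeff_succ_X_mul, coeff_mk]
        have : ((n + 1 : ℕ) : ℂ) ≠ 0 := Nat.cast_ne_zero.mpr (by omega)
        field_simp
        ring
    have h2 : (mk fun n : ℕ => a ^ n) * (1 - C a * X) = 1 := by
      have := congrArg (PowerSeries.rescale a) (mk_one_mul_one_sub_eq_one ℂ)
      rw [map_mul, map_sub, rescale_X, map_one] at this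
      have h3 : (mk fun n : ℕ => a ^ n) = PowerSeries.rescale a (mk 1) := by
        ext n
        simp
      rw [h3, this]
    rw [h1, neg_mul, mul_assoc, h2, mul_one]
  rw [h]
  simp [mul_comm]

theorem IsExp.inv {β : ℕ → ℂ} {γ : ℂ⟦X⟧} (h : IsExp β γ) : IsExp (-β) γ⁻¹ := by
  have h0 : constantCoeff γ ≠ 0 := by simp [h.1]
  refine ⟨by rw [constantCoeff_inv, h.1, inv_one], ?_⟩
  have hs : (mk fun n => (n : ℂ) * (-β) n) = -mk (fun n => n * β n) := by
    ext n
    simp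
  rw [derivative_inv', hs]
  have h1 := PowerSeries.inv_mul_cancel γ h0
  linear_combination (-γ⁻¹ ^ 2) * h.2 - (mk fun n => n * β n) * γ⁻¹ * h1

theorem isExp_geometric (a : ℂ) : IsExp (fun n => a ^ n / n) (1 - C a * X)⁻¹ := by
  refine (isExp_one_sub a).inv.congr fun n _ => ?_
  simp

end Exponentials

/-! ### The function `α_φ` -/

section Alpha

open scoped PowerSeries.WithPiTopology

theorem qPoch_eq_mul (a p : ℂ) (hp : ‖p‖ < 1) :
    qPoch a p = (1 - C a * X) * qPoch (a * p) p := by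
  have h1 : (fun j : ℕ => (1 - C (a * p * p ^ j) * X : ℂ⟦X⟧)) =
      fun j => 1 - C (a * p ^ (j + 1)) * X := by
    funext j
    rw [mul_assoc a, ← pow_succ']
  have h := qPoch_multipliable (a * p) p hp
  rw [h1] at h
  have h2 := tprod_eq_zero_mul' (f := fun j : ℕ => (1 - C (a * p ^ j) * X : ℂ⟦X⟧)) h
  rw [pow_zero, mul_one] at h2
  rw [qPoch, h2, qPoch, h1]

theorem rescale_qPoch (b a p : ℂ) (hp : ‖p‖ < 1) :
    rescale b (qPoch a p) = qPoch (a * b) p := by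
  have hc : Continuous (rescale b : ℂ⟦X⟧ → ℂ⟦X⟧) := by
    refine continuous_pi fun s => ?_
    obtain ⟨n, rfl⟩ : ∃ n : ℕ, s = Finsupp.single () n := ⟨s (), by ext; simp⟩
    change Continuous fun f : ℂ⟦X⟧ => coeff n (rescale b f)
    simp only [coeff_rescale]
    exact continuous_const.mul (WithPiTopology.continuous_coeff ℂ n)
  rw [qPoch, (qPoch_multipliable a p hp).map_tprod (rescale b) hc, qPoch]
  refine tprod_congr fun j => ?_
  rw [map_sub, map_mul, rescale_X, map_one]
  have : rescale b (C (a * p ^ j)) = C (a * p ^ j) := by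
    ext n
    rw [coeff_rescale, coeff_C]
    split_ifs with h <;> simp [h]
  rw [this, ← mul_assoc, ← map_mul]
  ring_nf

theorem constantCoeff_qPoch (a p : ℂ) (hp : ‖p‖ < 1) : constantCoeff (qPoch a p) = 1 := by
  rw [qPoch, (qPoch_multipliable a p hp).map_tprod _ (WithPiTopology.continuous_constantCoeff ℂ)]
  simp

theorem constantCoeff_alphaPhi {q : ℂ} (hq1 : ‖q‖ < 1) : constantCoeff (alphaPhi q) = 1 := by
  have hp : ‖q ^ 4‖ < 1 := by
    rw [norm_pow]
    exact pow_lt_one₀ (norm_nonneg q) hq1 (by norm_num)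
  rw [alphaPhi, map_mul, constantCoeff_inv, constantCoeff_qPoch _ _ hp, constantCoeff_qPoch _ _ hp]
  simp

/-- The functional equation `α_φ(x) α_φ(q² x) = (1 - q² x)⁻¹`. -/
theorem alphaPhi_mul_rescale {q : ℂ} (hq1 : ‖q‖ < 1) :
    alphaPhi q * rescale (q ^ 2) (alphaPhi q) * (1 - C (q ^ 2) * X) = 1 := by
  have hp : ‖q ^ 4‖ < 1 := by
    rw [norm_pow]
    exact pow_lt_one₀ (norm_nonneg q) hq1 (by norm_num)
  have hinv : ∀ a, qPoch a (q ^ 4) * (qPoch a (q ^ 4))⁻¹ = 1 := fun a =>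
    PowerSeries.mul_inv_cancel _ (by simp [constantCoeff_qPoch _ _ hp])
  have h1 : qPoch (q ^ 2) (q ^ 4) = (1 - C (q ^ 2) * X) * qPoch (q ^ 6) (q ^ 4) := by
    rw [qPoch_eq_mul _ _ hp]
    ring_nf
  have h2 : rescale (q ^ 2) (alphaPhi q) * qPoch (q ^ 4) (q ^ 4) = qPoch (q ^ 6) (q ^ 4) := by
    have h3 : alphaPhi q * qPoch (q ^ 2) (q ^ 4) = qPoch (q ^ 4) (q ^ 4) := by
      rw [alphaPhi, mul_assoc, mul_comm _ (qPoch (q ^ 2) (q ^ 4)), hinv, mul_one]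
    have h4 := congrArg (rescale (q ^ 2)) h3
    rw [map_mul, rescale_qPoch _ _ _ hp, rescale_qPoch _ _ _ hp] at h4
    ring_nf at h4 ⊢
    exact h4
  have h5 := hinv (q ^ 2)
  rw [alphaPhi] at h2 ⊢
  linear_combination (qPoch (q ^ 2) (q ^ 4))⁻¹ * (1 - C (q ^ 2) * X) * h2 + h5
    - (qPoch (q ^ 2) (q ^ 4))⁻¹ * h1

theorem one_add_pow_ne_zero {q : ℂ} (hq1 : ‖q‖ < 1) {n : ℕ} (hn : 0 < n) : 1 + q ^ n ≠ 0 := by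
  intro h
  have h1 : q ^ n = -1 := by linear_combination h
  have h2 : ‖q ^ n‖ < 1 := by
    rw [norm_pow]
    exact pow_lt_one₀ (norm_nonneg q) hq1 hn.ne'
  rw [h1] at h2
  simp at h2

/-- The logarithm of `α_φ`; its coefficients can be read off from the functional equation. -/
theorem isExp_alphaPhi {q : ℂ} (hq1 : ‖q‖ < 1) :
    IsExp (fun n => q ^ (2 * n) / (n * (1 + q ^ (2 * n)))) (alphaPhi q) := by
  have h0 : constantCoeff (alphaPhi q) ≠ 0 := by simp [constantCoeff_alphaPhi hq1]
  refine ⟨constantCoeff_alphaPhi hq1, ?_⟩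
  -- Every series with constant term `1` is the exponential of its logarithmic derivative.
  set L := X * derivative ℂ (alphaPhi q) * (alphaPhi q)⁻¹ with hL
  have hαL : X * derivative ℂ (alphaPhi q) = L * alphaPhi q := by
    rw [hL, mul_assoc, PowerSeries.inv_mul_cancel _ h0, mul_one]
  have hLn : ∀ n : ℕ, 0 < n → (n : ℂ) * (coeff n L / n) = coeff n L := fun n hn => by
    have : (n : ℂ) ≠ 0 := Nat.cast_ne_zero.mpr hn.ne'
    field_simp
  have hL0 : coeff 0 L = 0 := by simp [hL]
  have hmk : (mk fun n : ℕ => (n : ℂ) * (coeff n L / n)) = L := by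
    ext n
    rw [coeff_mk]
    rcases Nat.eq_zero_or_pos n with rfl | hn
    · simpa using hL0.symm
    · exact hLn n hn
  have hexp : IsExp (fun n => coeff n L / n) (alphaPhi q) :=
    ⟨constantCoeff_alphaPhi hq1, by rw [hmk, hαL]⟩
  have h1 := (hexp.mul (hexp.rescale (q ^ 2))).mul (isExp_one_sub (q ^ 2))
  rw [alphaPhi_mul_rescale hq1] at h1
  have h2 : ∀ n : ℕ, 0 < n → coeff n L / n = q ^ (2 * n) / (n * (1 + q ^ (2 * n))) := fun n hn => by
    have hn' : (n : ℂ) ≠ 0 := Nat.cast_ne_zero.mpr hn.ne'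
    have h3 := congrArg (coeff n) h1.2
    simp only [mul_one, coeff_mk, coeff_X_mul_derivative, coeff_one, hn.ne', if_false, mul_zero,
      Pi.add_apply] at h3
    have h4 := one_add_pow_ne_zero hq1 (n := 2 * n) (by omega)
    rw [← pow_mul] at h3
    field_simp at h3 ⊢
    linear_combination -h3
  exact (hexp.congr h2).2

end Alpha

/-! ### Exponentials of creation and annihilation operators -/

section OperatorExponentials

/-- `x d/dx` on power series with noncommuting coefficients. -/
def eulerOp (f : PowerSeries (Module.End ℂ Pol)) : PowerSeries (Module.End ℂ Pol) :=
  mk fun n => n • coeff n f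

theorem eulerOp_mul (f g : PowerSeries (Module.End ℂ Pol)) :
    eulerOp (f * g) = eulerOp f * g + f * eulerOp g := by
  ext1 n
  simp only [eulerOp, coeff_mk, coeff_mul, map_add, Finset.smul_sum, ← Finset.sum_add_distrib]
  refine Finset.sum_congr rfl fun p hp => ?_
  rw [Finset.HasAntidiagonal.mem_antidiagonal] at hp
  rw [← hp, add_smul, smul_mul_assoc, mul_smul_comm]

theorem eulerOp_pow_succ {f : PowerSeries (Module.End ℂ Pol)} (hf : Commute f (eulerOp f)) (j : ℕ) :
    eulerOp (f ^ (j + 1)) = (j + 1) • (eulerOp f * f ^ j) := by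
  induction j with
  | zero => simp
  | succ j ih =>
    rw [pow_succ', eulerOp_mul, ih, mul_smul_comm, ← mul_assoc, hf.eq, mul_assoc, ← pow_succ',
      add_comm, ← succ_nsmul]

theorem coeff_opSeries_zero (c : ℕ+ → ℂ) (a : ℕ+ → Module.End ℂ Pol) :
    coeff 0 (opSeries c a) = 0 := by
  simp [opSeries]

theorem coeff_opSeries_pnat (c : ℕ+ → ℂ) (a : ℕ+ → Module.End ℂ Pol) (n : ℕ+) :
    coeff (n : ℕ) (opSeries c a) = c n • a n := by
  rw [opSeries, coeff_mk, dif_pos n.pos]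
  rfl

theorem coeff_complex_smul (t : ℂ) (f : PowerSeries (Module.End ℂ Pol)) (n : ℕ) :
    coeff n (t • f) = t • coeff n f :=
  rfl

theorem coeff_opSeries_pow (c : ℕ+ → ℂ) (a : ℕ+ → Module.End ℂ Pol) {n j : ℕ} (h : n < j) :
    coeff n (opSeries c a ^ j) = 0 := by
  induction j generalizing n with
  | zero => omega
  | succ j ih =>
    rw [pow_succ', coeff_mul]
    refine Finset.sum_eq_zero fun p hp => ?_
    rw [Finset.HasAntidiagonal.mem_antidiagonal] at hp
    rcases Nat.eq_zero_or_pos p.1 with h0 | h0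
    · rw [h0, coeff_opSeries_zero, zero_mul]
    · rw [ih (by omega), mul_zero]

theorem coeff_expSeries_opSeries (c : ℕ+ → ℂ) (a : ℕ+ → Module.End ℂ Pol) {n K : ℕ} (h : n < K) :
    coeff n (expSeries (opSeries c a)) =
      ∑ j ∈ Finset.range K, ((j.factorial : ℂ)⁻¹) • coeff n (opSeries c a ^ j) := by
  rw [expSeries, coeff_mk]
  refine Finset.sum_subset (Finset.range_mono h) fun j _ hj => ?_
  rw [coeff_opSeries_pow c a (by simpa using hj), smul_zero]

theorem expSeries_coeff_zero (c : ℕ+ → ℂ) (a : ℕ+ → Module.End ℂ Pol) :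
    coeff 0 (expSeries (opSeries c a)) = 1 := by
  simp [expSeries]

theorem inv_factorial_smul_succ {M : Type*} [AddCommGroup M] [Module ℂ M] (j : ℕ) (x : M) :
    (((j + 1).factorial : ℂ)⁻¹) • ((j + 1) • x) = ((j.factorial : ℂ)⁻¹) • x := by
  rw [← Nat.cast_smul_eq_nsmul ℂ, smul_smul, Nat.factorial_succ]
  congr 1
  have h1 : ((j + 1 : ℕ) : ℂ) ≠ 0 := Nat.cast_ne_zero.mpr (by omega)
  have h2 : (j.factorial : ℂ) ≠ 0 := Nat.cast_ne_zero.mpr (Nat.factorial_ne_zero j)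
  push_cast at h1 ⊢
  field_simp

/-- The differential equation of the exponential of a series with commuting coefficients. -/
theorem nsmul_coeff_expSeries (c : ℕ+ → ℂ) (a : ℕ+ → Module.End ℂ Pol)
    (ha : ∀ m n, Commute (a m) (a n)) (n : ℕ) :
    n • coeff n (expSeries (opSeries c a)) =
      ∑ p ∈ Finset.HasAntidiagonal.antidiagonal n,
        (p.1 • coeff p.1 (opSeries c a)) * coeff p.2 (expSeries (opSeries c a)) := by
  have hcomm : Commute (opSeries c a) (eulerOp (opSeries c a)) := by
    ext1 n
    rw [coeff_mul, coeff_mul, ← Finset.Nat.sum_antidiagonal_swap]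
    refine Finset.sum_congr rfl fun p _ => ?_
    simp only [Prod.fst_swap, Prod.snd_swap, eulerOp, opSeries, coeff_mk]
    split_ifs
    · exact (((ha _ _).smul_left _).smul_right _).smul_right _
    all_goals simp
  have hpow : ∀ j, n • coeff n (opSeries c a ^ (j + 1)) = (j + 1) •
      ∑ p ∈ Finset.HasAntidiagonal.antidiagonal n,
        (p.1 • coeff p.1 (opSeries c a)) * coeff p.2 (opSeries c a ^ j) := fun j => by
    have h := congrArg (coeff n) (eulerOp_pow_succ hcomm j)
    rw [map_nsmul, coeff_mul] at h
    simpa only [eulerOp, coeff_mk] using h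
  rw [coeff_expSeries_opSeries c a (show n < n + 1 + 1 by omega), Finset.sum_range_succ', smul_add]
  have h0 : n • (((Nat.factorial 0 : ℕ) : ℂ)⁻¹ • coeff n (opSeries c a ^ 0)) = 0 := by
    rcases Nat.eq_zero_or_pos n with rfl | hn
    · simp
    · simp [coeff_one, hn.ne']
  rw [h0, add_zero, Finset.smul_sum]
  have h1 : ∀ p ∈ Finset.HasAntidiagonal.antidiagonal n,
      (p.1 • coeff p.1 (opSeries c a)) * coeff p.2 (expSeries (opSeries c a)) =
      ∑ j ∈ Finset.range (n + 1), ((j.factorial : ℂ)⁻¹) •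
        ((p.1 • coeff p.1 (opSeries c a)) * coeff p.2 (opSeries c a ^ j)) := fun p hp => by
    rw [Finset.HasAntidiagonal.mem_antidiagonal] at hp
    rw [coeff_expSeries_opSeries c a (show p.2 < n + 1 by omega), Finset.mul_sum]
    exact Finset.sum_congr rfl fun j _ => mul_smul_comm _ _ _
  rw [Finset.sum_congr rfl h1, Finset.sum_comm]
  refine Finset.sum_congr rfl fun j _ => ?_
  rw [smul_comm n, hpow, inv_factorial_smul_succ, Finset.smul_sum]

/-! ### Creation operators -/

/-- The logarithm `∑ c n a_{-n} xⁿ` of `creation c`. -/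
def creationLog (c : ℕ+ → ℂ) (n : ℕ) : Pol :=
  if h : 0 < n then MvPolynomial.C (c ⟨n, h⟩) * MvPolynomial.X ⟨n, h⟩ else 0

/-- The power series `exp (∑ c n a_{-n} xⁿ)` with coefficients in `ℂ[a_{-1}, a_{-2}, …]`. -/
def creation (c : ℕ+ → ℂ) : Pol⟦X⟧ :=
  mk fun n => coeff n (expSeries (opSeries c aNeg)) 1

theorem commute_aNeg (m n : ℕ+) : Commute (aNeg m) (aNeg n) :=
  LinearMap.ext fun v => mul_left_comm _ _ v

theorem coeff_opSeries_aNeg (c : ℕ+ → ℂ) (n : ℕ) (v : Pol) :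
    coeff n (opSeries c aNeg) v = creationLog c n * v := by
  rw [opSeries, coeff_mk, creationLog]
  split_ifs
  · rw [LinearMap.smul_apply, MvPolynomial.smul_eq_C_mul, mul_assoc]
    rfl
  · simp

theorem coeff_expSeries_aNeg (c : ℕ+ → ℂ) (n : ℕ) (v : Pol) :
    coeff n (expSeries (opSeries c aNeg)) v = coeff n (creation c) * v := by
  induction n using Nat.strong_induction_on with
  | _ n ih =>
    rcases Nat.eq_zero_or_pos n with rfl | hn
    · rw [creation, coeff_mk, expSeries_coeff_zero]
      simp
    · have hn' : (n : Pol) ≠ 0 := Nat.cast_ne_zero.mpr hn.ne'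
      have h : ∀ v : Pol, (n : Pol) * coeff n (expSeries (opSeries c aNeg)) v =
          ∑ p ∈ Finset.HasAntidiagonal.antidiagonal n,
            (p.1 : Pol) * (creationLog c p.1 *
              (coeff p.2 (expSeries (opSeries c aNeg)) v)) := fun v => by
        have h1 := LinearMap.congr_fun (nsmul_coeff_expSeries c aNeg commute_aNeg n) v
        simpa [LinearMap.sum_apply, coeff_opSeries_aNeg, nsmul_eq_mul] using h1
      refine mul_left_cancel₀ hn' ?_
      rw [h, creation, coeff_mk, ← mul_assoc, h, Finset.sum_mul]
      refine Finset.sum_congr rfl fun p hp => ?_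
      rw [Finset.HasAntidiagonal.mem_antidiagonal] at hp
      rcases Nat.eq_zero_or_pos p.1 with h0 | h0
      · simp [h0]
      · rw [ih p.2 (by omega), creation, coeff_mk]
        ring

theorem isExp_creation (c : ℕ+ → ℂ) : IsExp (creationLog c) (creation c) := by
  refine ⟨?_, ?_⟩
  · rw [← coeff_zero_eq_constantCoeff_apply, creation, coeff_mk, expSeries_coeff_zero]
    rfl
  · ext1 n
    rw [coeff_X_mul_derivative, creation, coeff_mk, coeff_mul]
    have h1 := LinearMap.congr_fun (nsmul_coeff_expSeries c aNeg commute_aNeg n) 1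
    simpa [LinearMap.sum_apply, coeff_opSeries_aNeg, nsmul_eq_mul, mul_assoc] using h1

/-! ### Annihilation operators -/

/-- The coefficient of `x^n` in `exp (∑ d n a_n x^n)`. -/
def annih (q : ℂ) (d : ℕ+ → ℂ) (n : ℕ) : Module.End ℂ Pol :=
  coeff n (expSeries (opSeries d (aPos q)))

/-- The commutator `[d n a_n, a_{-n}]`. -/
def annihWeight (q : ℂ) (d : ℕ+ → ℂ) (n : ℕ+) : ℂ :=
  d n * (qInt q (2 * n) * qInt q n / n)

theorem aPos_X_mul (q : ℂ) (k m : ℕ+) (v : Pol) :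
    aPos q k (MvPolynomial.X m * v) = MvPolynomial.X m * aPos q k v +
      if k = m then (qInt q (2 * m) * qInt q m / m : ℂ) • v else 0 := by
  simp only [aPos, LinearMap.smul_apply, Derivation.coeFn_coe, Derivation.leibniz,
    MvPolynomial.pderiv_X, smul_eq_mul, smul_add, mul_smul_comm]
  split_ifs with h
  · subst h
    simp
  · simp [Ne.symm h]

theorem opSeries_aPos_mul_X (q : ℂ) (d : ℕ+ → ℂ) (m : ℕ+) :
    opSeries d (aPos q) * C (aNeg m) =
      C (aNeg m) * opSeries d (aPos q) + annihWeight q d m • X ^ (m : ℕ) := by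
  ext1 n
  rw [coeff_mul_C, map_add, coeff_C_mul, coeff_complex_smul, coeff_X_pow]
  rcases Nat.eq_zero_or_pos n with rfl | hn
  · rw [coeff_opSeries_zero, if_neg m.ne_zero.symm]
    simp
  · obtain ⟨k, rfl⟩ : ∃ k : ℕ+, n = k := ⟨⟨n, hn⟩, rfl⟩
    have hk : ((k : ℕ) = m) ↔ k = m := PNat.coe_inj
    rw [coeff_opSeries_pnat]
    refine LinearMap.ext fun v => ?_
    have h := aPos_X_mul q k m v
    simp only [hk, LinearMap.add_apply, LinearMap.smul_apply, Module.End.mul_apply]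
    have h2 : ∀ w, aNeg m w = MvPolynomial.X m * w := fun w => rfl
    rw [h2, h2, h, smul_add, mul_smul_comm]
    split_ifs with hkm
    · subst hkm
      rw [annihWeight, mul_smul, Module.End.one_apply]
    · simp

theorem opSeries_aPos_pow_mul_X (q : ℂ) (d : ℕ+ → ℂ) (m : ℕ+) (j : ℕ) :
    opSeries d (aPos q) ^ (j + 1) * C (aNeg m) =
      C (aNeg m) * opSeries d (aPos q) ^ (j + 1) +
        (j + 1) • annihWeight q d m • (X ^ (m : ℕ) * opSeries d (aPos q) ^ j) := by
  induction j with
  | zero => simpa using opSeries_aPos_mul_X q d m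
  | succ j ih =>
    have hX : opSeries d (aPos q) * X ^ (m : ℕ) = X ^ (m : ℕ) * opSeries d (aPos q) :=
      (commute_X_pow _ _).eq
    rw [pow_succ', mul_assoc, ih, mul_add, ← mul_assoc, opSeries_aPos_mul_X, add_mul, mul_assoc,
      mul_smul_comm, mul_smul_comm, ← mul_assoc (opSeries d (aPos q)) (X ^ (m : ℕ)), hX,
      mul_assoc (X ^ (m : ℕ)), ← pow_succ' _ (j + 1), ← pow_succ' _ j, smul_mul_assoc, add_assoc,
      ← succ_nsmul']

/-- `exp (∑ d n a_n xⁿ)` translates the variable `a_{-m}` by a multiple of `x^m`. -/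
theorem annih_X_mul (q : ℂ) (d : ℕ+ → ℂ) (n : ℕ) (m : ℕ+) (v : Pol) :
    annih q d n (MvPolynomial.X m * v) = MvPolynomial.X m * annih q d n v +
      if (m : ℕ) ≤ n then annihWeight q d m • annih q d (n - m) v else 0 := by
  have h1 : annih q d n * aNeg m = aNeg m * annih q d n +
      if (m : ℕ) ≤ n then annihWeight q d m • annih q d (n - m) else 0 := by
    simp only [annih]
    rw [coeff_expSeries_opSeries d (aPos q) (show n < n + 1 by omega), Finset.sum_range_succ',
      add_mul, Finset.sum_mul, mul_add, Finset.mul_sum]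
    have h2 : ∀ j, ((((j + 1).factorial : ℕ) : ℂ)⁻¹ •
          coeff n (opSeries d (aPos q) ^ (j + 1))) * aNeg m =
        aNeg m * ((((j + 1).factorial : ℕ) : ℂ)⁻¹ • coeff n (opSeries d (aPos q) ^ (j + 1))) +
        ((j.factorial : ℂ)⁻¹ • annihWeight q d m •
          if (m : ℕ) ≤ n then coeff (n - m) (opSeries d (aPos q) ^ j) else 0) := fun j => by
      have h3 := congrArg (coeff n) (opSeries_aPos_pow_mul_X q d m j)
      rw [coeff_mul_C, map_add, coeff_C_mul, map_nsmul, coeff_complex_smul, coeff_X_pow_mul'] at h3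
      rw [smul_mul_assoc, h3, smul_add, mul_smul_comm, inv_factorial_smul_succ]
    rw [Finset.sum_congr rfl fun j _ => h2 j, Finset.sum_add_distrib]
    have h4 : (((Nat.factorial 0 : ℕ) : ℂ)⁻¹ • coeff n (opSeries d (aPos q) ^ 0)) * aNeg m =
        aNeg m * (((Nat.factorial 0 : ℕ) : ℂ)⁻¹ • coeff n (opSeries d (aPos q) ^ 0)) := by
      rw [pow_zero, coeff_one]
      split_ifs <;> simp
    rw [h4]
    split_ifs with hmn
    · have hm := m.pos
      rw [coeff_expSeries_opSeries d (aPos q) (show n - m < n by omega), Finset.smul_sum,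
        Finset.sum_congr rfl fun j (_ : j ∈ Finset.range n) => smul_comm ((j.factorial : ℂ)⁻¹)
          (annihWeight q d m) (coeff (n - m) (opSeries d (aPos q) ^ j))]
      abel
    · simp
  have h5 := LinearMap.congr_fun h1 v
  split_ifs at h5 ⊢ <;> exact h5

theorem annih_one (q : ℂ) (d : ℕ+ → ℂ) {n : ℕ} (hn : 0 < n) : annih q d n 1 = 0 := by
  have h1 : (1 : Pol) ∈ degLT 1 := by
    rw [degLT, ← MvPolynomial.C_1, ← MvPolynomial.monomial_zero',
      MvPolynomial.monomial_mem_restrictSupport]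
    left
    simp
  have key := fun j => coeff_pow_mem_degLT q d j n 1 1 h1
  simp only [Nat.sub_eq_zero_of_le (show 1 ≤ n by omega), degLT_zero, Submodule.mem_bot] at key
  simp [annih, expSeries, LinearMap.sum_apply, key]

theorem annih_zero (q : ℂ) (d : ℕ+ → ℂ) (v : Pol) : annih q d 0 v = v := by
  rw [annih, expSeries_coeff_zero]
  rfl

/-- The image of a polynomial under `exp (∑ d n a_n xⁿ)`. -/
def annihSeries (q : ℂ) (d : ℕ+ → ℂ) (v : Pol) : Pol⟦X⟧ :=
  mk fun n => annih q d n v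

theorem annihSeries_X_mul (q : ℂ) (d : ℕ+ → ℂ) (m : ℕ+) (v : Pol) :
    annihSeries q d (MvPolynomial.X m * v) =
      (C (MvPolynomial.X m) + C (MvPolynomial.C (annihWeight q d m)) * X ^ (m : ℕ)) *
        annihSeries q d v := by
  ext1 n
  rw [annihSeries, coeff_mk, annih_X_mul, add_mul, map_add, coeff_C_mul, mul_assoc, coeff_C_mul,
    coeff_X_pow_mul', annihSeries, coeff_mk]
  split_ifs
  · rw [coeff_mk, MvPolynomial.smul_eq_C_mul]
  · simp

theorem annihSeries_one (q : ℂ) (d : ℕ+ → ℂ) : annihSeries q d 1 = 1 := by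
  ext1 n
  rw [annihSeries, coeff_mk, coeff_one]
  split_ifs with h
  · rw [h, annih_zero]
  · exact annih_one q d (Nat.pos_of_ne_zero h)

theorem annihSeries_add (q : ℂ) (d : ℕ+ → ℂ) (u v : Pol) :
    annihSeries q d (u + v) = annihSeries q d u + annihSeries q d v := by
  ext1 n
  simp [annihSeries]

/-- The exponential of a derivation is multiplicative. -/
theorem annihSeries_mul (q : ℂ) (d : ℕ+ → ℂ) (u v : Pol) :
    annihSeries q d (u * v) = annihSeries q d u * annihSeries q d v := by
  have hC : ∀ (t : ℂ) (v : Pol), annihSeries q d (MvPolynomial.C t * v) =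
      C (MvPolynomial.C t) * annihSeries q d v := fun t v => by
    ext1 n
    rw [coeff_C_mul, annihSeries, annihSeries, coeff_mk, coeff_mk, ← MvPolynomial.smul_eq_C_mul,
      map_smul, MvPolynomial.smul_eq_C_mul]
  induction u using MvPolynomial.induction_on generalizing v with
  | C t =>
    have h := hC t 1
    rw [mul_one, annihSeries_one, mul_one] at h
    rw [hC, h]
  | add f g hf hg => rw [add_mul, annihSeries_add, hf, hg, annihSeries_add, add_mul]
  | mul_X f m hf => rw [mul_assoc, hf, annihSeries_X_mul, mul_comm f, annihSeries_X_mul]; ring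

/-- `exp (∑ d n a_n xⁿ)` as a homomorphism of rings. -/
def annihHom (q : ℂ) (d : ℕ+ → ℂ) : Pol →+* Pol⟦X⟧ where
  toFun := annihSeries q d
  map_one' := annihSeries_one q d
  map_mul' := annihSeries_mul q d
  map_zero' := by ext1 n; simp [annihSeries]
  map_add' := annihSeries_add q d

theorem IsExp.map {R S : Type*} [CommRing R] [CommRing S] {β : ℕ → R} {γ : R⟦X⟧} (h : IsExp β γ)
    (φ : R →+* S) : IsExp (fun n => φ (β n)) (PowerSeries.map φ γ) := by
  refine ⟨?_, ?_⟩
  · rw [← coeff_zero_eq_constantCoeff_apply, coeff_map, coeff_zero_eq_constantCoeff_apply, h.1,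
      map_one]
  · have h1 := congrArg (PowerSeries.map φ) h.2
    rw [map_mul, map_mul, map_X] at h1
    have h2 : derivative S (PowerSeries.map φ γ) = PowerSeries.map φ (derivative R γ) := by
      ext n
      simp [coeff_derivative]
    have h3 : (mk fun n => (n : S) * φ (β n)) = PowerSeries.map φ (mk fun n => (n : R) * β n) := by
      ext n
      simp
    rw [h2, h3, h1]

/-- Moving an annihilation exponential past a creation exponential produces a scalar series. Both
sides are exponentials of a series in a second variable. -/
theorem annihHom_coeff_creation (q : ℂ) (c d : ℕ+ → ℂ) {β : ℕ → ℂ} {γ : ℂ⟦X⟧} (h : IsExp β γ)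
    (hβ : ∀ n : ℕ+, β n = annihWeight q d n * c n) (N : ℕ) :
    annihHom q d (coeff N (creation c)) =
      ∑ p ∈ Finset.HasAntidiagonal.antidiagonal N,
        C (MvPolynomial.C (coeff p.1 γ) * coeff p.2 (creation c)) * X ^ p.1 := by
  have : CharZero Pol⟦X⟧ := charZero_of_injective_ringHom (C_injective (R := Pol))
  have h1 := (isExp_creation c).map (annihHom q d)
  have h2 := (isExp_creation c).map (C (R := Pol))
  have h3 := ((h.map (MvPolynomial.C (σ := ℕ+))).map (C (R := Pol))).rescale X
  have h4 := (h3.mul h2).congr (β' := fun n => annihHom q d (creationLog c n)) fun n hn => by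
    obtain ⟨k, rfl⟩ : ∃ k : ℕ+, n = k := ⟨⟨n, hn⟩, rfl⟩
    have hk : creationLog c k = MvPolynomial.X k * MvPolynomial.C (c k) := by
      rw [creationLog, dif_pos k.pos, mul_comm]
      rfl
    have hc : annihHom q d (MvPolynomial.C (c k)) = C (MvPolynomial.C (c k)) := by
      change annihSeries q d _ = _
      ext1 n
      rw [annihSeries, coeff_mk, ← mul_one (MvPolynomial.C (c k)), ← MvPolynomial.smul_eq_C_mul,
        map_smul]
      have := congrArg (coeff n) (annihSeries_one q d)
      rw [annihSeries, coeff_mk] at this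
      rw [this, coeff_C, coeff_one]
      split_ifs <;> simp [MvPolynomial.smul_eq_C_mul]
    have hX : annihHom q d (MvPolynomial.X k) = C (MvPolynomial.X k) +
        C (MvPolynomial.C (annihWeight q d k)) * X ^ (k : ℕ) := by
      have := annihSeries_X_mul q d k 1
      rw [annihSeries_one, mul_one, mul_one] at this
      exact this
    simp only [Pi.add_apply, hk, map_mul, hc, hX, hβ]
    ring
  have h5 := congrArg (coeff N) (h1.ext h4)
  rw [coeff_map, coeff_mul] at h5
  rw [h5]
  refine Finset.sum_congr rfl fun p _ => ?_
  rw [coeff_rescale, coeff_map, coeff_map, coeff_map, map_mul]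
  ring

end OperatorExponentials

/-! ### Products of normally ordered exponentials -/

section Products

/-- The coefficient of `x^k`, `k ∈ ℤ`, of a power series (zero for `k < 0`). -/
def intCoeff (f : Pol⟦X⟧) (k : ℤ) : Pol :=
  if 0 ≤ k then coeff k.toNat f else 0

theorem intCoeff_of_neg (f : Pol⟦X⟧) {k : ℤ} (hk : k < 0) : intCoeff f k = 0 :=
  if_neg (not_le.mpr hk)

theorem intCoeff_natCast (f : Pol⟦X⟧) (n : ℕ) : intCoeff f n = coeff n f := by
  simp [intCoeff]

theorem normalExp_apply (q : ℂ) (c d : ℕ+ → ℂ) (k : ℤ) (v : Pol) :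
    normalExp q c d k v = ∑ᶠ n : ℕ, intCoeff (creation c) (k + n) * annih q d n v := by
  refine finsum_congr fun n => ?_
  rw [coeffZ, intCoeff]
  split_ifs
  · exact coeff_expSeries_aNeg c _ _
  · simp

theorem annih_eventually_zero (q : ℂ) (d : ℕ+ → ℂ) (v : Pol) :
    ∃ N : ℕ, ∀ n, N ≤ n → annih q d n v = 0 :=
  expPos_locallyFinite q d v

theorem normalExp_one (q : ℂ) (c d : ℕ+ → ℂ) (k : ℤ) :
    normalExp q c d k 1 = intCoeff (creation c) k := by
  rw [normalExp_apply, finsum_eq_single _ 0 fun n hn => by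
    rw [annih_one q d (Nat.pos_of_ne_zero hn), mul_zero]]
  simp [annih_zero]

/-- The commutator of a vertex operator with a creation operator. -/
theorem normalExp_X_mul (q : ℂ) (c d : ℕ+ → ℂ) (k : ℤ) (m : ℕ+) (v : Pol) :
    normalExp q c d k (MvPolynomial.X m * v) = MvPolynomial.X m * normalExp q c d k v +
      MvPolynomial.C (annihWeight q d m) * normalExp q c d (k + m) v := by
  obtain ⟨N, hN⟩ := annih_eventually_zero q d v
  have hsum : ∀ (u : Pol) (j : ℤ) (K : ℕ), (∀ n, K ≤ n → annih q d n u = 0) →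
      normalExp q c d j u =
        ∑ n ∈ Finset.range K, intCoeff (creation c) (j + n) * annih q d n u := fun u j K hK => by
    rw [normalExp_apply, finsum_eq_sum_of_support_subset]
    intro n hn
    rw [Finset.coe_range, Set.mem_Iio]
    by_contra hc
    exact hn (by simp [hK n (not_lt.mp hc)])
  rw [hsum (MvPolynomial.X m * v) k (m + N) fun n hn => by
      rw [annih_X_mul, hN n (by omega), if_pos (by omega), hN (n - m) (by omega)]; simp,
    hsum v k (m + N) fun n hn => hN n (by omega), hsum v (k + m) N hN]
  simp only [annih_X_mul, mul_add, Finset.sum_add_distrib, Finset.mul_sum]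
  congr 1
  · exact Finset.sum_congr rfl fun n _ => mul_left_comm _ _ _
  · rw [Finset.sum_range_add, Finset.sum_eq_zero, zero_add]
    · refine Finset.sum_congr rfl fun n _ => ?_
      rw [if_pos (by omega), Nat.add_sub_cancel_left, MvPolynomial.smul_eq_C_mul, mul_left_comm,
        Nat.cast_add, add_assoc]
    · intro n hn
      rw [Finset.mem_range] at hn
      rw [if_neg (by omega), mul_zero]

/-- `γ(w/z)` is the contraction of a vertex operator with annihilation part `d`, in the variable
`z`, and a vertex operator with creation part `c`, in the variable `w`. -/
def IsContraction (q : ℂ) (d c : ℕ+ → ℂ) (γ : ℂ⟦X⟧) : Prop :=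
  ∃ β : ℕ → ℂ, IsExp β γ ∧ ∀ n : ℕ+, β n = annihWeight q d n * c n

theorem annih_intCoeff_creation {q : ℂ} {c d : ℕ+ → ℂ} {γ : ℂ⟦X⟧} (h : IsContraction q d c γ)
    (n : ℕ) (l : ℤ) : annih q d n (intCoeff (creation c) l) =
      coeff n γ • intCoeff (creation c) (l - n) := by
  obtain ⟨β, hβ, hβ'⟩ := h
  rcases lt_or_ge l 0 with hl | hl
  · rw [intCoeff_of_neg _ hl, intCoeff_of_neg _ (by omega), map_zero, smul_zero]
  · obtain ⟨N, rfl⟩ := Int.eq_ofNat_of_zero_le hl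
    have h1 := congrArg (coeff n) (annihHom_coeff_creation q c d hβ hβ' N)
    rw [map_sum] at h1
    have h2 : annih q d n (coeff N (creation c)) =
        coeff n (annihHom q d (coeff N (creation c))) :=
      (coeff_mk n fun n => annih q d n (coeff N (creation c))).symm
    simp only [coeff_C_mul_X_pow] at h1
    rw [intCoeff_natCast, h2, h1]
    rcases lt_or_ge N n with hn | hn
    · rw [intCoeff_of_neg _ (by omega), smul_zero]
      refine Finset.sum_eq_zero fun p hp => if_neg ?_
      rw [Finset.HasAntidiagonal.mem_antidiagonal] at hp
      omega
    · rw [Finset.sum_eq_single (n, N - n), if_pos rfl, ← Nat.cast_sub hn, intCoeff_natCast,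
        MvPolynomial.smul_eq_C_mul]
      · rintro ⟨a, b⟩ hp hne
        rw [Finset.HasAntidiagonal.mem_antidiagonal] at hp
        refine if_neg fun h => hne ?_
        simp only at hp h
        subst h
        rw [← hp, Nat.add_sub_cancel_left]
      · intro hp
        rw [Finset.HasAntidiagonal.mem_antidiagonal] at hp
        exact absurd (show n + (N - n) = N by omega) hp

theorem normalExp_intCoeff {q : ℂ} (c : ℕ+ → ℂ) {d c' : ℕ+ → ℂ} {γ : ℂ⟦X⟧}
    (h : IsContraction q d c' γ) (k l : ℤ) :
    normalExp q c d k (intCoeff (creation c') l) = ∑ᶠ n : ℕ,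
      coeff n γ • (intCoeff (creation c) (k + n) * intCoeff (creation c') (l - n)) := by
  rw [normalExp_apply]
  refine finsum_congr fun n => ?_
  rw [annih_intCoeff_creation h, mul_smul_comm]

theorem normalExp_intCoeff_mul {q : ℂ} (c : ℕ+ → ℂ) {d c' c'' : ℕ+ → ℂ} {γ γ' : ℂ⟦X⟧}
    (h : IsContraction q d c' γ) (h' : IsContraction q d c'' γ') (k l m : ℤ) :
    normalExp q c d k (intCoeff (creation c') l * intCoeff (creation c'') m) =
      ∑ᶠ n : ℕ, coeff n γ • ∑ᶠ p : ℕ, coeff p γ' •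
        (intCoeff (creation c) (k + n + p) * intCoeff (creation c') (l - n) *
          intCoeff (creation c'') (m - p)) := by
  set F : ℕ × ℕ → Pol := fun p => coeff p.1 γ • coeff p.2 γ' •
    (intCoeff (creation c) (k + p.1 + p.2) * intCoeff (creation c') (l - p.1) *
          intCoeff (creation c'') (m - p.2)) with hF
  have hfin : (Function.support F).Finite := by
    refine ((Set.finite_Iio (l.toNat + 1)).prod (Set.finite_Iio (m.toNat + 1))).subset ?_
    rintro ⟨n, p⟩ hnp
    rw [Set.mem_prod, Set.mem_Iio, Set.mem_Iio]
    by_contra hc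
    refine hnp ?_
    rcases lt_or_ge (l - n) 0 with h1 | h1
    · simp [hF, intCoeff_of_neg _ h1]
    · have h2 : m - p < 0 := by
        simp only at hc
        omega
      simp [hF, intCoeff_of_neg _ h2]
  have h1 := finsum_curry F hfin
  rw [finsum_eq_finsum_antidiagonal F hfin] at h1
  simp only [smul_finsum]
  rw [normalExp_apply]
  refine Eq.trans (finsum_congr fun n => ?_) h1
  have h2 : annih q d n (intCoeff (creation c') l * intCoeff (creation c'') m) =
      ∑ p ∈ Finset.HasAntidiagonal.antidiagonal n,
        annih q d p.1 (intCoeff (creation c') l) * annih q d p.2 (intCoeff (creation c'') m) := by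
    have h3 := congrArg (coeff n) (annihSeries_mul q d (intCoeff (creation c') l)
      (intCoeff (creation c'') m))
    rw [coeff_mul] at h3
    simpa only [annihSeries, coeff_mk] using h3
  rw [h2, Finset.mul_sum]
  refine Finset.sum_congr rfl fun p hp => ?_
  rw [Finset.HasAntidiagonal.mem_antidiagonal] at hp
  simp only [hF]
  rw [annih_intCoeff_creation h, annih_intCoeff_creation h', ← hp, smul_mul_smul_comm,
    mul_smul_comm, mul_smul, mul_assoc, Nat.cast_add, add_assoc]

end Products

/-! ### Products of several vertex operators as formal distributions -/

section OpProduct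

variable {ι : Type*} (q : ℂ) (c d : ι → ℕ+ → ℂ)

/-- The product `V_{i₁}(t_{i₁}) V_{i₂}(t_{i₂}) ⋯ v` of the normally ordered exponentials with
labels in the given list, as a distribution in the variables `t_i`. -/
def opProduct : List ι → Pol → (ι → ℤ) → Pol
  | [], v, _ => v
  | i :: L, v, κ => normalExp q (c i) (d i) (κ i) (opProduct L v κ)

theorem opProduct_congr (L : List ι) (v : Pol) {κ κ' : ι → ℤ} (h : ∀ i ∈ L, κ i = κ' i) :
    opProduct q c d L v κ = opProduct q c d L v κ' := by
  induction L with
  | nil => rfl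
  | cons i L ih =>
    rw [opProduct, opProduct, h i (by simp), ih fun j hj => h j (by simp [hj])]

variable [DecidableEq ι]

/-- The Laurent polynomial by which a product of vertex operators with labels in `L` is multiplied
when a polynomial is inserted on the right: the homomorphism sending `a_{-n}` to
`a_{-n} + ∑_i w_{i,n} t_i^{-n}`. -/
def dressing (L : List ι) : Pol →ₐ[ℂ] AddMonoidAlgebra Pol (ι → ℤ) :=
  MvPolynomial.aeval fun n => AddMonoidAlgebra.single 0 (MvPolynomial.X n) +
    (L.map fun i => AddMonoidAlgebra.single (-Pi.single i (n : ℤ))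
      (MvPolynomial.C (annihWeight q (d i) n))).sum

theorem dressing_perm {L L' : List ι} (h : L.Perm L') : dressing q d L = dressing q d L' := by
  unfold dressing
  congr 1
  funext n
  rw [(h.map _).sum_eq]

theorem list_sum_single_smul_apply (L : List ι) (n : ℕ+) (S : (ι → ℤ) → Pol) (κ : ι → ℤ) :
    ((L.map fun i => AddMonoidAlgebra.single (-Pi.single i (n : ℤ))
      (MvPolynomial.C (annihWeight q (d i) n) : Pol)).sum • S) κ =
    (L.map fun i => MvPolynomial.C (annihWeight q (d i) n) * S (κ + Pi.single i (n : ℤ))).sum := by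
  induction L with
  | nil => simp
  | cons i L ih =>
    rw [List.map_cons, List.sum_cons, List.map_cons, List.sum_cons, add_smul, Pi.add_apply, ih,
      single_smul_apply, sub_neg_eq_add]

theorem opProduct_X_mul (L : List ι) (hL : L.Nodup) (n : ℕ+) (v : Pol) :
    opProduct q c d L (MvPolynomial.X n * v) =
      dressing q d L (MvPolynomial.X n) • opProduct q c d L v := by
  rw [dressing, MvPolynomial.aeval_X]
  funext κ
  rw [add_smul, Pi.add_apply, single_smul_apply, list_sum_single_smul_apply, sub_zero]
  induction L with
  | nil => simp [opProduct]
  | cons i L ih =>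
    rw [List.nodup_cons] at hL
    rw [opProduct, ih hL.2, map_add, normalExp_X_mul, List.map_cons, List.sum_cons, add_assoc,
      map_list_sum, List.map_map, opProduct]
    congr 2
    · rw [opProduct, Pi.add_apply, Pi.single_eq_same]
      congr 2
      refine opProduct_congr q c d L v fun j hj => ?_
      have : j ≠ i := fun h => hL.1 (h ▸ hj)
      simp [this]
    · congr 1
      refine List.map_congr_left fun j hj => ?_
      have : i ≠ j := fun h => hL.1 (h ▸ hj)
      rw [Function.comp_apply, ← MvPolynomial.smul_eq_C_mul, map_smul, MvPolynomial.smul_eq_C_mul,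
        opProduct, Pi.add_apply, Pi.single_eq_of_ne this, add_zero]

/-- A product of vertex operators on an arbitrary polynomial is determined by its value on `1`. -/
theorem opProduct_eq_dressing_smul (L : List ι) (hL : L.Nodup) (v : Pol) :
    opProduct q c d L v = dressing q d L v • opProduct q c d L 1 := by
  have hadd : ∀ (L : List ι) u v,
      opProduct q c d L (u + v) = opProduct q c d L u + opProduct q c d L v := by
    intro L u v
    funext κ
    induction L with
    | nil => rfl
    | cons i L ih => rw [opProduct, ih, Pi.add_apply, map_add]; rfl
  have hsmul : ∀ (L : List ι) (t : ℂ) κ,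
      opProduct q c d L (MvPolynomial.C t) κ = MvPolynomial.C t * opProduct q c d L 1 κ := by
    intro L t κ
    induction L with
    | nil => simp [opProduct]
    | cons i L ih =>
      rw [opProduct, ih, ← MvPolynomial.smul_eq_C_mul, map_smul, MvPolynomial.smul_eq_C_mul]
      rfl
  induction v using MvPolynomial.induction_on with
  | C t =>
    funext κ
    have h : dressing q d L (MvPolynomial.C t) = AddMonoidAlgebra.single 0 (MvPolynomial.C t) := by
      rw [dressing, MvPolynomial.aeval_C]
      rfl
    rw [hsmul, h, single_smul_apply, sub_zero]
  | add f g hf hg => rw [hadd, hf, hg, map_add, add_smul]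
  | mul_X f n hf =>
    rw [mul_comm f, opProduct_X_mul q c d L hL, hf, smul_smul, map_mul]

/-- The exponent of `t_j / t_i`. -/
def ratio (i j : ι) : ι → ℤ := Pi.single j 1 - Pi.single i 1

theorem linearMap_finsum {M N : Type*} [AddCommGroup M] [Module ℂ M] [AddCommGroup N] [Module ℂ N]
    {f : ℕ → M} (T : M →ₗ[ℂ] N) (hf : (Function.support f).Finite) :
    T (∑ᶠ n, f n) = ∑ᶠ n, T (f n) :=
  T.toAddMonoidHom.map_finsum hf

theorem opProduct_pair {γ : ℂ⟦X⟧} {i j : ι} (hij : i ≠ j) (h : IsContraction q (d i) (c j) γ) :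
    opProduct q c d [i, j] 1 = mulDir γ (ratio i j) fun κ =>
      intCoeff (creation (c i)) (κ i) * intCoeff (creation (c j)) (κ j) := by
  funext κ
  rw [opProduct, opProduct, opProduct, normalExp_one, normalExp_intCoeff _ h]
  refine finsum_congr fun n => ?_
  simp [ratio, hij, hij.symm]

theorem opProduct_triple {γij γik γjk : ℂ⟦X⟧} {i j k : ι} (hij : i ≠ j) (hik : i ≠ k) (hjk : j ≠ k)
    (h1 : IsContraction q (d i) (c j) γij) (h2 : IsContraction q (d i) (c k) γik)
    (h3 : IsContraction q (d j) (c k) γjk) :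
    opProduct q c d [i, j, k] 1 = mulDir γjk (ratio j k) (mulDir γij (ratio i j)
      (mulDir γik (ratio i k) fun κ => intCoeff (creation (c i)) (κ i) *
        intCoeff (creation (c j)) (κ j) * intCoeff (creation (c k)) (κ k))) := by
  funext κ
  rw [opProduct, opProduct, opProduct, opProduct, normalExp_one, normalExp_intCoeff _ h3]
  have hfin : (Function.support fun n : ℕ => coeff n γjk • (intCoeff (creation (c j)) (κ j + n) *
      intCoeff (creation (c k)) (κ k - n))).Finite := by
    refine (Set.finite_Iio ((κ k).toNat + 1)).subset fun n hn => ?_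
    rw [Set.mem_Iio]
    by_contra hc
    exact hn (by simp [intCoeff_of_neg _ (show κ k - n < 0 by omega)])
  rw [linearMap_finsum _ hfin]
  simp only [mulDir]
  refine finsum_congr fun n => ?_
  rw [map_smul, normalExp_intCoeff_mul _ h1 h2]
  have e1 : ∀ m p : ℕ, (κ - n • ratio j k - m • ratio i j - p • ratio i k) i = κ i + m + p := by
    intro m p
    simp [ratio, hij, hik]
  have e2 : ∀ m p : ℕ, (κ - n • ratio j k - m • ratio i j - p • ratio i k) j = κ j + n - m := by
    intro m p
    simp [ratio, hij.symm, hjk]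
  have e3 : ∀ m p : ℕ, (κ - n • ratio j k - m • ratio i j - p • ratio i k) k = κ k - n - p := by
    intro m p
    simp [ratio, hik.symm, hjk.symm]
  simp only [e1, e2, e3]

end OpProduct

/-! ### Contractions of the vertex operators -/

section Contractions

/-- The creation part of `Φ_-`. -/
def phiCreate (q r : ℂ) (n : ℕ+) : ℂ := r ^ (7 * (n : ℕ)) / qInt q (2 * n)

/-- The annihilation part of `Φ_-`. -/
def phiAnnih (q r : ℂ) (n : ℕ+) : ℂ := -((r ^ (5 * (n : ℕ)))⁻¹ / qInt q (2 * n))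

/-- The creation part of `X^-`. -/
def curCreate (q r : ℂ) (n : ℕ+) : ℂ := -(r ^ (n : ℕ) / qInt q n)

/-- The annihilation part of `X^-`. -/
def curAnnih (q r : ℂ) (n : ℕ+) : ℂ := r ^ (n : ℕ) / qInt q n

variable {q r : ℂ}

theorem one_sub_pow_ne_zero (hq1 : ‖q‖ < 1) {n : ℕ} (hn : 0 < n) : 1 - q ^ n ≠ 0 := by
  intro h
  have h1 : q ^ n = 1 := by linear_combination -h
  have h2 : ‖q ^ n‖ < 1 := by
    rw [norm_pow]
    exact pow_lt_one₀ (norm_nonneg q) hq1 hn.ne'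
  rw [h1] at h2
  simp at h2

theorem pow_sub_inv_ne_zero (hq0 : q ≠ 0) (hq1 : ‖q‖ < 1) {n : ℕ} (hn : 0 < n) :
    q ^ n - (q ^ n)⁻¹ ≠ 0 := by
  have h1 := one_sub_pow_ne_zero hq1 (n := 2 * n) (by omega)
  have h2 : q ^ n ≠ 0 := pow_ne_zero n hq0
  intro h
  apply h1
  field_simp at h
  rw [mul_comm 2 n, pow_mul]
  linear_combination -h

theorem qInt_ne_zero (hq0 : q ≠ 0) (hq1 : ‖q‖ < 1) {n : ℕ} (hn : 0 < n) : qInt q n ≠ 0 := by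
  have h1 := pow_sub_inv_ne_zero hq0 hq1 Nat.one_pos
  rw [pow_one] at h1
  exact div_ne_zero (pow_sub_inv_ne_zero hq0 hq1 hn) h1

theorem qInt_two_mul (q : ℂ) (n : ℕ) : qInt q (2 * n) = qInt q n * (q ^ n + (q ^ n)⁻¹) := by
  rw [qInt, qInt, mul_comm 2 n, pow_mul]
  ring

theorem isContraction_phi_phi (hq0 : q ≠ 0) (hq1 : ‖q‖ < 1) (hr : r ^ 2 = q) :
    IsContraction q (phiAnnih q r) (phiCreate q r) (alphaPhi q)⁻¹ := by
  refine ⟨_, (isExp_alphaPhi hq1).inv, fun n => ?_⟩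
  have h1 := qInt_ne_zero hq0 hq1 n.pos
  have h2 : (n : ℂ) ≠ 0 := Nat.cast_ne_zero.mpr n.ne_zero
  have h3 : q ^ (n : ℕ) ≠ 0 := pow_ne_zero _ hq0
  have h4 := one_add_pow_ne_zero hq1 (n := 2 * n) (by have := n.pos; omega)
  have hr0 : r ≠ 0 := fun h => hq0 (by rw [← hr, h]; simp)
  have h5 : r ^ (n : ℕ) ≠ 0 := pow_ne_zero _ hr0
  have h6 : (r ^ (n : ℕ)) ^ 2 = q ^ (n : ℕ) := by rw [← hr]; ring
  simp only [Pi.neg_apply, annihWeight, phiAnnih, phiCreate, qInt_two_mul]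
  rw [mul_comm 2 (n : ℕ), pow_mul] at h4 ⊢
  rw [mul_comm 5, mul_comm 7, pow_mul, pow_mul]
  generalize r ^ (n : ℕ) = R at *
  generalize q ^ (n : ℕ) = Q at *
  generalize qInt q n = u at *
  have h7 : Q + Q⁻¹ ≠ 0 := by
    intro h
    apply h4
    field_simp at h
    linear_combination h
  have h8 : Q ^ 2 + 1 ≠ 0 := by rwa [add_comm]
  subst h6
  field_simp
  ring

theorem isContraction_phi_cur (hq0 : q ≠ 0) (hq1 : ‖q‖ < 1) (hr : r ^ 2 = q) :
    IsContraction q (phiAnnih q r) (curCreate q r) (1 - C ((q ^ 2)⁻¹) * X)⁻¹ := by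
  refine ⟨_, isExp_geometric _, fun n => ?_⟩
  have h1 := qInt_ne_zero hq0 hq1 n.pos
  have h1' := qInt_ne_zero hq0 hq1 (n := 2 * n) (by have := n.pos; omega)
  have h2 : (n : ℂ) ≠ 0 := Nat.cast_ne_zero.mpr n.ne_zero
  have hr0 : r ≠ 0 := fun h => hq0 (by rw [← hr, h]; simp)
  have h5 : r ^ (n : ℕ) ≠ 0 := pow_ne_zero _ hr0
  have h6 : q ^ (n : ℕ) = (r ^ (n : ℕ)) ^ 2 := by rw [← hr]; ring
  simp only [annihWeight, phiAnnih, curCreate, inv_pow]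
  rw [← pow_mul, mul_comm 2 (n : ℕ), pow_mul, h6, mul_comm 5, pow_mul]
  rw [mul_comm (n : ℕ) 2]
  field_simp

theorem isContraction_cur_phi (hq0 : q ≠ 0) (hq1 : ‖q‖ < 1) (hr : r ^ 2 = q) :
    IsContraction q (curAnnih q r) (phiCreate q r) (1 - C (q ^ 4) * X)⁻¹ := by
  refine ⟨_, isExp_geometric _, fun n => ?_⟩
  have h1 := qInt_ne_zero hq0 hq1 n.pos
  have h1' := qInt_ne_zero hq0 hq1 (n := 2 * n) (by have := n.pos; omega)
  have h2 : (n : ℂ) ≠ 0 := Nat.cast_ne_zero.mpr n.ne_zero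
  have h6 : (q ^ 4) ^ (n : ℕ) = (r ^ (n : ℕ)) ^ 8 := by rw [← hr]; ring
  simp only [annihWeight, curAnnih, phiCreate]
  rw [h6, mul_comm 7, pow_mul]
  field_simp

theorem isContraction_cur_cur (hq0 : q ≠ 0) (hq1 : ‖q‖ < 1) (hr : r ^ 2 = q) :
    IsContraction q (curAnnih q r) (curCreate q r)
      ((1 - C 1 * X) * (1 - C (q ^ 2) * X)) := by
  refine ⟨_, (isExp_one_sub _).mul (isExp_one_sub _), fun n => ?_⟩
  have h1 := qInt_ne_zero hq0 hq1 n.pos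
  have h2 : (n : ℂ) ≠ 0 := Nat.cast_ne_zero.mpr n.ne_zero
  have h3 : q ^ (n : ℕ) ≠ 0 := pow_ne_zero _ hq0
  have h6 : (r ^ (n : ℕ)) ^ 2 = q ^ (n : ℕ) := by rw [← hr]; ring
  simp only [annihWeight, curAnnih, curCreate, Pi.add_apply, qInt_two_mul, one_pow]
  rw [← pow_mul, mul_comm 2 (n : ℕ), pow_mul]
  generalize r ^ (n : ℕ) = R at *
  generalize q ^ (n : ℕ) = Q at *
  field_simp
  linear_combination (Q ^ 2 + 1) * h6

/-- The creation parts of `Φ_-(q² w)`, `Φ_-(w)` and `X^-(q⁴ w)` cancel; here with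
`w` replaced by `q⁻⁴ w`. -/
theorem creation_fusion (hq0 : q ≠ 0) (hq1 : ‖q‖ < 1) (hr : r ^ 2 = q) :
    rescale (MvPolynomial.C ((q ^ 2)⁻¹)) (creation (phiCreate q r)) *
      rescale (MvPolynomial.C ((q ^ 4)⁻¹)) (creation (phiCreate q r)) *
      creation (curCreate q r) = 1 := by
  refine ((((isExp_creation _).rescale _).mul ((isExp_creation _).rescale _)).mul
    (isExp_creation _)).eq_one fun n hn => ?_
  obtain ⟨k, rfl⟩ : ∃ k : ℕ+, n = k := ⟨⟨n, hn⟩, rfl⟩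
  have hk : ∀ c : ℕ+ → ℂ, creationLog c k = MvPolynomial.C (c k) * MvPolynomial.X k := fun c => by
    rw [creationLog, dif_pos k.pos]
    rfl
  have h1 := qInt_ne_zero hq0 hq1 k.pos
  have h3 : q ^ (k : ℕ) ≠ 0 := pow_ne_zero _ hq0
  have h4 := one_add_pow_ne_zero hq1 (n := 2 * k) (by have := k.pos; omega)
  have h6 : q ^ (k : ℕ) = (r ^ (k : ℕ)) ^ 2 := by rw [← hr]; ring
  have hr0 : r ≠ 0 := fun h => hq0 (by rw [← hr, h]; simp)
  have h5 : r ^ (k : ℕ) ≠ 0 := pow_ne_zero _ hr0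
  simp only [Pi.add_apply, hk, ← map_pow, ← mul_assoc, ← map_mul, ← add_mul, ← map_add]
  have h0 : ((q ^ 2)⁻¹) ^ (k : ℕ) * phiCreate q r k + ((q ^ 4)⁻¹) ^ (k : ℕ) * phiCreate q r k +
      curCreate q r k = 0 := by
    have e2 : ((q ^ 2)⁻¹) ^ (k : ℕ) = ((q ^ (k : ℕ)) ^ 2)⁻¹ := by rw [inv_pow, ← pow_mul,
      ← pow_mul, mul_comm]
    have e4 : ((q ^ 4)⁻¹) ^ (k : ℕ) = ((q ^ (k : ℕ)) ^ 4)⁻¹ := by rw [inv_pow, ← pow_mul,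
      ← pow_mul, mul_comm]
    rw [mul_comm 2 (k : ℕ), pow_mul] at h4
    rw [phiCreate, curCreate, qInt_two_mul, e2, e4, mul_comm 7, pow_mul]
    rw [h6] at h3 h4 ⊢
    generalize r ^ (k : ℕ) = R at *
    generalize qInt q k = u at *
    have h7 : R ^ 2 + (R ^ 2)⁻¹ ≠ 0 := by
      intro h
      apply h4
      field_simp at h
      linear_combination h
    have h8 : R ^ 4 + 1 ≠ 0 := by
      intro h
      apply h4
      linear_combination h
    field_simp
    ring
  rw [add_mul, h0, map_zero, zero_mul]

/-- The annihilation parts of `Φ_-(q² w)`, `Φ_-(w)` and `X^-(q⁴ w)` cancel. -/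
theorem annihWeight_fusion (hq0 : q ≠ 0) (hq1 : ‖q‖ < 1) (hr : r ^ 2 = q) (n : ℕ+) :
    annihWeight q (phiAnnih q r) n * ((q ^ 2)⁻¹) ^ (n : ℕ) + annihWeight q (phiAnnih q r) n +
      annihWeight q (curAnnih q r) n * ((q ^ 4)⁻¹) ^ (n : ℕ) = 0 := by
  have h1 := qInt_ne_zero hq0 hq1 n.pos
  have h3 : q ^ (n : ℕ) ≠ 0 := pow_ne_zero _ hq0
  have h4 := one_add_pow_ne_zero hq1 (n := 2 * n) (by have := n.pos; omega)
  have h6 : q ^ (n : ℕ) = (r ^ (n : ℕ)) ^ 2 := by rw [← hr]; ring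
  have hr0 : r ≠ 0 := fun h => hq0 (by rw [← hr, h]; simp)
  have h5 : r ^ (n : ℕ) ≠ 0 := pow_ne_zero _ hr0
  have h2 : (n : ℂ) ≠ 0 := Nat.cast_ne_zero.mpr n.ne_zero
  have e2 : ((q ^ 2)⁻¹) ^ (n : ℕ) = ((q ^ (n : ℕ)) ^ 2)⁻¹ := by rw [inv_pow, ← pow_mul,
    ← pow_mul, mul_comm]
  have e4 : ((q ^ 4)⁻¹) ^ (n : ℕ) = ((q ^ (n : ℕ)) ^ 4)⁻¹ := by rw [inv_pow, ← pow_mul,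
    ← pow_mul, mul_comm]
  rw [mul_comm 2 (n : ℕ), pow_mul] at h4
  rw [annihWeight, annihWeight, phiAnnih, curAnnih, qInt_two_mul, e2, e4, mul_comm 5, pow_mul]
  rw [h6] at h3 h4 ⊢
  generalize r ^ (n : ℕ) = R at *
  generalize qInt q n = u at *
  have h7 : R ^ 2 + (R ^ 2)⁻¹ ≠ 0 := by
    intro h
    apply h4
    field_simp at h
    linear_combination h
  have h8 : R ^ 4 + 1 ≠ 0 := by
    intro h
    apply h4
    linear_combination h
  field_simp
  ring

end Contractions

/-! ### Geometric kernels -/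

section Kernels

/-- The ring of Laurent polynomials in three variables, with coefficients in `Pol`. -/
abbrev Laurent : Type := AddMonoidAlgebra Pol (Fin 3 → ℤ)

/-- The monomial `c t^a`. -/
def mono (a : Fin 3 → ℤ) (c : ℂ) : Laurent := AddMonoidAlgebra.single a (MvPolynomial.C c)

theorem mono_mul (a b : Fin 3 → ℤ) (c d : ℂ) : mono a c * mono b d = mono (a + b) (c * d) := by
  rw [mono, mono, mono, AddMonoidAlgebra.single_mul_single, map_mul]

theorem mono_zero_one : mono 0 1 = 1 := by
  rw [mono, MvPolynomial.C_1]
  rfl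

theorem mono_smul_apply (a : Fin 3 → ℤ) (c : ℂ) (S : (Fin 3 → ℤ) → Pol) (κ : Fin 3 → ℤ) :
    (mono a c • S) κ = c • S (κ - a) := by
  rw [mono, single_smul_apply, MvPolynomial.smul_eq_C_mul]

/-- The variables `t_i`. -/
def var (i : Fin 3) : Laurent := mono (Pi.single i 1) 1

/-- The inverses of the variables. -/
def varInv (i : Fin 3) : Laurent := mono (-Pi.single i 1) 1

/-- Scalars as Laurent polynomials. -/
def scal (c : ℂ) : Laurent := mono 0 c

theorem var_mul_varInv (i : Fin 3) : var i * varInv i = 1 := by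
  rw [var, varInv, mono_mul, add_neg_cancel, mul_one, mono_zero_one]

theorem scal_mul (c d : ℂ) : scal c * scal d = scal (c * d) := by
  rw [scal, scal, scal, mono_mul, add_zero]

theorem scal_pow (c : ℂ) (n : ℕ) : scal (c ^ n) = scal c ^ n := by
  induction n with
  | zero => rw [pow_zero, pow_zero, scal, mono_zero_one]
  | succ n ih => rw [pow_succ, pow_succ, ← ih, scal_mul]

theorem scal_mul_inv {q : ℂ} (hq0 : q ≠ 0) : scal q * scal q⁻¹ = 1 := by
  rw [scal_mul, mul_inv_cancel₀ hq0, scal, mono_zero_one]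

theorem scal_mul_mono (a : Fin 3 → ℤ) (c : ℂ) : scal c * mono a 1 = mono a c := by
  rw [scal, mono_mul, zero_add, mul_one]

theorem mono_ratio (i j : Fin 3) : mono (ratio i j) 1 = var j * varInv i := by
  rw [var, varInv, mono_mul, ratio, sub_eq_add_neg, mul_one]

theorem mulDir_one_sub {a : Fin 3 → ℤ} {S : (Fin 3 → ℤ) → Pol} (h : LocFinite a S) (c : ℂ) :
    mulDir (1 - C c * X) a S = (1 - mono a c) • S := by
  have h1 : (1 - C c * X : ℂ⟦X⟧) = 1 + C (-c) * X := by
    rw [map_neg, neg_mul, sub_eq_add_neg]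
  rw [h1, mulDir_add_left h, mulDir_one, mulDir_mul h, mulDir_C, mulDir_X, sub_smul, one_smul,
    sub_eq_add_neg]
  congr 1
  funext κ
  simp [mono_smul_apply]

theorem LocFinite.mulDir {a : Fin 3 → ℤ} {S : (Fin 3 → ℤ) → Pol} (h : LocFinite a S) (f : ℂ⟦X⟧) :
    LocFinite a (mulDir f a S) := by
  intro κ
  obtain ⟨N, hN⟩ := h κ
  refine ⟨N, fun n hn => finsum_eq_zero_of_forall_eq_zero fun m => ?_⟩
  rw [sub_sub, ← add_smul, hN _ (by omega), smul_zero]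

/-- The kernel `1 / (t_i - c t_j)`, expanded in powers of `t_j / t_i`. -/
def invLin (c : ℂ) (i j : Fin 3) (S : (Fin 3 → ℤ) → Pol) : (Fin 3 → ℤ) → Pol :=
  varInv i • mulDir (1 - C c * X)⁻¹ (ratio i j) S

theorem mulDir_geometric (c : ℂ) (i j : Fin 3) (S : (Fin 3 → ℤ) → Pol) :
    mulDir (1 - C c * X)⁻¹ (ratio i j) S = var i • invLin c i j S := by
  rw [invLin, smul_smul, var_mul_varInv, one_smul]

theorem var_sub_smul_invLin {i j : Fin 3} {S : (Fin 3 → ℤ) → Pol} (h : LocFinite (ratio i j) S)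
    (c : ℂ) : (var i - scal c * var j) • invLin c i j S = S := by
  have h1 := mulDir_one_sub (h.mulDir (1 - C c * X)⁻¹) c
  rw [mulDir_cancel h (PowerSeries.mul_inv_cancel _ (by simp))] at h1
  have h2 : mono (ratio i j) c = scal c * (var j * varInv i) := by
    rw [← mono_ratio, scal_mul_mono]
  rw [h2] at h1
  rw [invLin, smul_smul]
  conv_rhs => rw [h1]
  congr 1
  linear_combination var_mul_varInv i

theorem invLin_smul (c : ℂ) {i j : Fin 3} {S : (Fin 3 → ℤ) → Pol}
    (h : LocFinite (ratio i j) S) (t : Laurent) : invLin c i j (t • S) = t • invLin c i j S := by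
  rw [invLin, mulDir_laurent_smul h, invLin, smul_comm]

theorem BoundedAlong.laurent_smul {ℓ : (Fin 3 → ℤ) →+ ℤ} {S : (Fin 3 → ℤ) → Pol}
    (h : BoundedAlong ℓ S) (t : Laurent) : BoundedAlong ℓ (t • S) := by
  induction t using AddMonoidAlgebra.induction_linear with
  | zero => exact ⟨0, fun κ _ => by simp⟩
  | add x y hx hy =>
    obtain ⟨N, hN⟩ := hx
    obtain ⟨K, hK⟩ := hy
    refine ⟨min N K, fun κ hκ => ?_⟩
    rw [lt_min_iff] at hκ
    rw [add_smul, Pi.add_apply, hN κ hκ.1, hK κ hκ.2, add_zero]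
  | single a r =>
    obtain ⟨N, hN⟩ := h
    refine ⟨N + ℓ a, fun κ hκ => ?_⟩
    rw [single_smul_apply, hN, mul_zero]
    rw [map_sub]
    omega

theorem BoundedAlong.invLin {ℓ : (Fin 3 → ℤ) →+ ℤ} {S : (Fin 3 → ℤ) → Pol}
    (h : BoundedAlong ℓ S) {i j : Fin 3} (hij : 0 ≤ ℓ (ratio i j)) (c : ℂ) :
    BoundedAlong ℓ (invLin c i j S) :=
  (h.mulDir hij _).laurent_smul _

theorem invLin_comm {ℓ ℓ' : (Fin 3 → ℤ) →+ ℤ} {S : (Fin 3 → ℤ) → Pol} (h : BoundedAlong ℓ S)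
    (h' : BoundedAlong ℓ' S) {i j i' j' : Fin 3} (ha : 0 < ℓ (ratio i j))
    (hb : 0 ≤ ℓ (ratio i' j')) (ha' : 0 ≤ ℓ' (ratio i j)) (hb' : 0 < ℓ' (ratio i' j')) (c c' : ℂ) :
    invLin c i j (invLin c' i' j' S) = invLin c' i' j' (invLin c i j S) := by
  rw [VertexOp.invLin, VertexOp.invLin, VertexOp.invLin, VertexOp.invLin,
    mulDir_laurent_smul ((h.mulDir hb _).locFinite ha),
    mulDir_laurent_smul ((h'.mulDir ha' _).locFinite hb'), mulDir_comm h h' ha hb hb', smul_comm]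

/-- The functional `κ ↦ κ i`. -/
abbrev ev (i : Fin 3) : (Fin 3 → ℤ) →+ ℤ := Pi.evalAddMonoidHom (fun _ => ℤ) i

/-- The product of creation exponentials in three variables. -/
def creationProduct (c : Fin 3 → ℕ+ → ℂ) (κ : Fin 3 → ℤ) : Pol :=
  intCoeff (creation (c 0)) (κ 0) * intCoeff (creation (c 1)) (κ 1) *
    intCoeff (creation (c 2)) (κ 2)

theorem creationProduct_bounded (c : Fin 3 → ℕ+ → ℂ) {ℓ : (Fin 3 → ℤ) →+ ℤ}
    (hℓ : ∀ κ, (∀ i, 0 ≤ κ i) → 0 ≤ ℓ κ) : BoundedAlong ℓ (creationProduct c) := by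
  refine ⟨0, fun κ hκ => ?_⟩
  have h : ∃ i, κ i < 0 := by
    by_contra! hc
    exact absurd (hℓ κ hc) (not_le.mpr hκ)
  obtain ⟨i, hi⟩ := h
  rw [creationProduct]
  fin_cases i
  · rw [intCoeff_of_neg _ (k := κ 0) hi, zero_mul, zero_mul]
  · rw [intCoeff_of_neg _ (k := κ 1) hi, mul_zero, zero_mul]
  · rw [intCoeff_of_neg _ (k := κ 2) hi, mul_zero]

theorem creationProduct_ev (c : Fin 3 → ℕ+ → ℂ) (i : Fin 3) :
    BoundedAlong (ev i) (creationProduct c) :=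
  creationProduct_bounded c fun _ h => h i

theorem creationProduct_ev_add (c : Fin 3 → ℕ+ → ℂ) (i j : Fin 3) :
    BoundedAlong (ev i + ev j) (creationProduct c) :=
  creationProduct_bounded c fun _ h => add_nonneg (h i) (h j)

end Kernels

/-! ### Partial fraction identities -/

section PartialFractions

variable {R M : Type*} [CommRing R] [AddCommGroup M] [Module R M]

/-- The symmetrised kernel of the Serre relation vanishes. Here `u_i` and `y_i` stand for
`1 / (z - q⁻² t_i)` and `1 / (t_i - q⁴ z)`, and `U`, `W₁₂`, `W₂₁`, `Y` for `u₁ u₂`, `y₁ u₂`,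
`y₂ u₁`, `y₁ y₂`. -/
theorem serre_kernel {A B z t₁ t₂ : R} {u₁ u₂ y₁ y₂ U W₁₂ W₂₁ Y : M} (hAB : A * B = 1)
    (hU₁ : (z - B ^ 2 * t₁) • U = u₂) (hU₂ : (z - B ^ 2 * t₂) • U = u₁)
    (hY₁ : (t₁ - A ^ 4 * z) • Y = y₂) (hY₂ : (t₂ - A ^ 4 * z) • Y = y₁)
    (hW₁ : (t₁ - A ^ 4 * z) • W₁₂ = u₂) (hW₁' : (z - B ^ 2 * t₂) • W₁₂ = y₁)
    (hW₂ : (t₂ - A ^ 4 * z) • W₂₁ = u₁) (hW₂' : (z - B ^ 2 * t₁) • W₂₁ = y₂) :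
    ((t₁ - t₂) * (t₁ - A ^ 2 * t₂)) • (B ^ 6 • U + ((A + B) * B ^ 3) • W₁₂ + Y) +
      ((t₂ - t₁) * (t₂ - A ^ 2 * t₁)) • (B ^ 6 • U + ((A + B) * B ^ 3) • W₂₁ + Y) = 0 := by
  have hAB2 : A ^ 2 * B ^ 2 = 1 := by rw [← mul_pow, hAB, one_pow]
  have hAB4 : A ^ 4 * B ^ 2 = A ^ 2 := by linear_combination A ^ 2 * hAB2
  have hAB4' : A ^ 4 * B ^ 4 = 1 := by rw [← mul_pow, hAB, one_pow]
  have h1 : (B ^ 2 * (t₁ - t₂)) • U = u₁ - u₂ := by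
    linear_combination (norm := module) hU₂ - hU₁
  have h2 : (t₁ - t₂) • Y = y₂ - y₁ := by
    linear_combination (norm := module) hY₁ - hY₂
  have h3 : (t₁ - A ^ 2 * t₂) • W₁₂ = u₂ + A ^ 4 • y₁ := by
    linear_combination (norm := module) hW₁ + A ^ 4 • hW₁' + hAB4 • (t₂ • W₁₂)
  have h4 : (t₂ - A ^ 2 * t₁) • W₂₁ = u₁ + A ^ 4 • y₂ := by
    linear_combination (norm := module) hW₂ + A ^ 4 • hW₂' + hAB4 • (t₁ • W₂₁)
  have h5 : (A + B) * B ^ 3 = (1 + A ^ 2) * B ^ 4 := by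
    linear_combination B ^ 2 * hAB - B ^ 2 * hAB2
  have h6 : (A + B) * B ^ 3 * A ^ 4 = 1 + A ^ 2 := by
    rw [h5]
    linear_combination (1 + A ^ 2) * hAB4'
  linear_combination (norm := module) (t₁ - t₂) • (((1 + A ^ 2) * B ^ 4) • h1 +
    (1 + A ^ 2) • h2 + ((A + B) * B ^ 3) • h3 - ((A + B) * B ^ 3) • h4 +
    h5 • (u₂ - u₁) + h6 • (y₁ - y₂))

/-- The kernel identity behind the exchange relation of `Φ_-` and `Φ_+`, multiplied by
`q² w - z`. Here `U`, `M₁`, `M₂`, `Y` stand for `u_z u_w`, `u_z y_w`, `u_w y_z`, `y_z y_w`. -/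
theorem exchange_kernel {A B z w t : R} {uz uw yz yw U M₁ M₂ Y : M} (hAB : A * B = 1)
    (hU : (z - B ^ 2 * t) • U = uw) (hU' : (w - B ^ 2 * t) • U = uz)
    (hY : (t - A ^ 4 * z) • Y = yw) (hY' : (t - A ^ 4 * w) • Y = yz)
    (hM₁ : (z - B ^ 2 * t) • M₁ = yw) (hM₁' : (t - A ^ 4 * w) • M₁ = uz)
    (hM₂ : (w - B ^ 2 * t) • M₂ = yz) (hM₂' : (t - A ^ 4 * z) • M₂ = uw) :
    ((w - z) * B ^ 4) • U + ((w - z) * A ^ 2) • Y + ((A ^ 2 * w - z) * B ^ 2) • M₁ +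
      ((w - A ^ 2 * z) * B ^ 2) • M₂ = 0 := by
  have hAB2 : A ^ 2 * B ^ 2 = 1 := by rw [← mul_pow, hAB, one_pow]
  have hAB4 : A ^ 4 * B ^ 2 = A ^ 2 := by linear_combination A ^ 2 * hAB2
  have h1 : (w - z) • U = uz - uw := by
    linear_combination (norm := module) hU' - hU
  have h2 : ((w - z) * A ^ 4) • Y = yw - yz := by
    linear_combination (norm := module) hY - hY'
  have h3 : (A ^ 2 * w - z) • M₁ = -(B ^ 2 • uz) - yw := by
    linear_combination (norm := module) -(B ^ 2 • hM₁') - hM₁ -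
      hAB2 • ((A ^ 2 * w) • M₁)
  have h4 : (w - A ^ 2 * z) • M₂ = B ^ 2 • uw + yz := by
    linear_combination (norm := module) B ^ 2 • hM₂' + hM₂ + hAB2 • ((A ^ 2 * z) • M₂)
  linear_combination (norm := module) B ^ 4 • h1 + B ^ 2 • h2 + B ^ 2 • h3 + B ^ 2 • h4 -
    hAB4 • ((w - z) • Y)

end PartialFractions

/-! ### Products of three vertex operators on the vacuum -/

section Vacuum

theorem ratio_apply (x i j : Fin 3) :
    ratio i j x = (if x = j then 1 else 0) - if x = i then 1 else 0 := by
  simp [ratio, Pi.single_apply]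

theorem intCoeff_prod_eq_creationProduct (c : Fin 3 → ℕ+ → ℂ) {i j k : Fin 3} (hij : i ≠ j)
    (hik : i ≠ k) (hjk : j ≠ k) : (fun κ : Fin 3 → ℤ => intCoeff (creation (c i)) (κ i) *
        intCoeff (creation (c j)) (κ j) * intCoeff (creation (c k)) (κ k)) =
      creationProduct c := by
  funext κ
  have hu : (Finset.univ : Finset (Fin 3)) = {i, j, k} := by
    revert i j k
    decide
  have h := Fin.prod_univ_three fun x => intCoeff (creation (c x)) (κ x)
  rw [hu, Finset.prod_insert (by simp [hij, hik]), Finset.prod_pair hjk, ← mul_assoc] at h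
  exact h

/-- Creation or annihilation parts for one operator `Φ_-` in the variable `t₀` and two currents. -/
def onePhi (f g : ℕ+ → ℂ) (x : Fin 3) : ℕ+ → ℂ := if x = 0 then f else g

/-- Creation or annihilation parts for two operators `Φ_-` and a current in the variable `t₂`. -/
def twoPhi (f g : ℕ+ → ℂ) (x : Fin 3) : ℕ+ → ℂ := if x = 2 then g else f

variable {q r : ℂ}

theorem onePhi_zero (f g : ℕ+ → ℂ) : onePhi f g 0 = f := rfl

theorem onePhi_ne (f g : ℕ+ → ℂ) {i : Fin 3} (h : i ≠ 0) : onePhi f g i = g := if_neg h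

theorem twoPhi_two (f g : ℕ+ → ℂ) : twoPhi f g 2 = g := rfl

theorem twoPhi_ne (f g : ℕ+ → ℂ) {i : Fin 3} (h : i ≠ 2) : twoPhi f g i = f := if_neg h

theorem mulDir_curCur {a : Fin 3 → ℤ} {S : (Fin 3 → ℤ) → Pol} (h : LocFinite a S) (c : ℂ) :
    mulDir ((1 - C 1 * X) * (1 - C c * X)) a S = ((1 - mono a 1) * (1 - mono a c)) • S := by
  rw [mulDir_mul h, mulDir_one_sub h, mulDir_one_sub (h.laurent_smul _), smul_smul]

/-- The creation exponentials of one `Φ_-` and two currents. -/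
abbrev onePhiProduct (q r : ℂ) : (Fin 3 → ℤ) → Pol :=
  creationProduct (onePhi (phiCreate q r) (curCreate q r))

/-- The creation exponentials of two `Φ_-` and one current. -/
abbrev twoPhiProduct (q r : ℂ) : (Fin 3 → ℤ) → Pol :=
  creationProduct (twoPhi (phiCreate q r) (curCreate q r))

/-- Products of one `Φ_-` and two currents. -/
abbrev onePhiOp (q r : ℂ) : List (Fin 3) → Pol → (Fin 3 → ℤ) → Pol :=
  opProduct q (onePhi (phiCreate q r) (curCreate q r)) (onePhi (phiAnnih q r) (curAnnih q r))

/-- Products of two `Φ_-` and one current. -/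
abbrev twoPhiOp (q r : ℂ) : List (Fin 3) → Pol → (Fin 3 → ℤ) → Pol :=
  opProduct q (twoPhi (phiCreate q r) (curCreate q r)) (twoPhi (phiAnnih q r) (curAnnih q r))

theorem alphaPhi_mul_inv (hq1 : ‖q‖ < 1) : alphaPhi q * (alphaPhi q)⁻¹ = 1 :=
  PowerSeries.mul_inv_cancel _ (by simp [constantCoeff_alphaPhi hq1])

variable (hq0 : q ≠ 0) (hq1 : ‖q‖ < 1) (hr : r ^ 2 = q)

include hq0 hq1 hr

theorem phi_cur_cur_one {i j : Fin 3} (hi : i ≠ 0) (hj : j ≠ 0) (hij : i ≠ j) :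
    onePhiOp q r [0, i, j] 1 =
      ((1 - mono (ratio i j) 1) * (1 - mono (ratio i j) (q ^ 2)) * (var 0 * var 0)) •
        invLin (q ^ 2)⁻¹ 0 i (invLin (q ^ 2)⁻¹ 0 j (onePhiProduct q r)) := by
  have hE := creationProduct_ev (onePhi (phiCreate q r) (curCreate q r))
  rw [onePhiOp, opProduct_triple q _ _ hi.symm hj.symm hij
    (γij := (1 - C ((q ^ 2)⁻¹) * X)⁻¹) (γik := (1 - C ((q ^ 2)⁻¹) * X)⁻¹)
    (γjk := (1 - C 1 * X) * (1 - C (q ^ 2) * X))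
    (by rw [onePhi_ne _ _ hi]; exact isContraction_phi_cur hq0 hq1 hr)
    (by rw [onePhi_ne _ _ hj]; exact isContraction_phi_cur hq0 hq1 hr)
    (by rw [onePhi_ne _ _ hi, onePhi_ne _ _ hj]; exact isContraction_cur_cur hq0 hq1 hr),
    intCoeff_prod_eq_creationProduct _ hi.symm hj.symm hij, mulDir_geometric, mulDir_geometric,
    invLin_smul, mulDir_curCur]
  · simp only [smul_smul, mul_assoc]
  · refine ((((hE j).invLin ?_ _).invLin ?_ _).laurent_smul _).laurent_smul _ |>.locFinite ?_ <;>
      simp [ratio_apply, hj, hij.symm]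
  · refine ((hE i).invLin ?_ _).locFinite ?_ <;> simp [ratio_apply, hi, hij]

theorem cur_phi_cur_one {i j : Fin 3} (hi : i ≠ 0) (hj : j ≠ 0) (hij : i ≠ j) :
    onePhiOp q r [i, 0, j] 1 =
      ((1 - mono (ratio i j) 1) * (1 - mono (ratio i j) (q ^ 2)) * (var 0 * var i)) •
        invLin (q ^ 2)⁻¹ 0 j (invLin (q ^ 4) i 0 (onePhiProduct q r)) := by
  have hE := creationProduct_ev (onePhi (phiCreate q r) (curCreate q r))
  rw [onePhiOp, opProduct_triple q _ _ hi hij hj.symm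
    (γij := (1 - C (q ^ 4) * X)⁻¹) (γik := (1 - C 1 * X) * (1 - C (q ^ 2) * X))
    (γjk := (1 - C ((q ^ 2)⁻¹) * X)⁻¹)
    (by rw [onePhi_ne _ _ hi]; exact isContraction_cur_phi hq0 hq1 hr)
    (by rw [onePhi_ne _ _ hi, onePhi_ne _ _ hj]; exact isContraction_cur_cur hq0 hq1 hr)
    (by rw [onePhi_ne _ _ hj]; exact isContraction_phi_cur hq0 hq1 hr),
    intCoeff_prod_eq_creationProduct _ hi hij hj.symm, mulDir_curCur, mulDir_geometric,
    mulDir_geometric, invLin_smul, invLin_smul, invLin_smul]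
  · simp only [smul_smul]
    refine congrArg (· • _) ?_
    ring
  · refine ((hE j).invLin ?_ _).locFinite ?_ <;> simp [ratio_apply, hj, hij.symm]
  · refine (hE 0).locFinite ?_
    simp [ratio_apply, hi.symm]
  · refine (((hE j).laurent_smul _).invLin ?_ _).locFinite ?_ <;>
      simp [ratio_apply, hj, hij.symm]
  · refine (hE j).locFinite ?_
    simp [ratio_apply, hij.symm]

theorem cur_cur_phi_one {i j : Fin 3} (hi : i ≠ 0) (hj : j ≠ 0) (hij : i ≠ j) :
    onePhiOp q r [i, j, 0] 1 =
      ((1 - mono (ratio i j) 1) * (1 - mono (ratio i j) (q ^ 2)) * (var i * var j)) •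
        invLin (q ^ 4) j 0 (invLin (q ^ 4) i 0 (onePhiProduct q r)) := by
  have hE := creationProduct_ev (onePhi (phiCreate q r) (curCreate q r))
  rw [onePhiOp, opProduct_triple q _ _ hij hi hj
    (γij := (1 - C 1 * X) * (1 - C (q ^ 2) * X)) (γik := (1 - C (q ^ 4) * X)⁻¹)
    (γjk := (1 - C (q ^ 4) * X)⁻¹)
    (by rw [onePhi_ne _ _ hi, onePhi_ne _ _ hj]; exact isContraction_cur_cur hq0 hq1 hr)
    (by rw [onePhi_ne _ _ hi]; exact isContraction_cur_phi hq0 hq1 hr)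
    (by rw [onePhi_ne _ _ hj]; exact isContraction_cur_phi hq0 hq1 hr),
    intCoeff_prod_eq_creationProduct _ hij hi hj, mulDir_geometric, mulDir_curCur,
    mulDir_geometric, invLin_smul, invLin_smul]
  · simp only [smul_smul]
    refine congrArg (· • _) ?_
    ring
  · refine ((hE 0).invLin ?_ _).locFinite ?_ <;> simp [ratio_apply, hi.symm, hj.symm]
  · refine (((hE 0).invLin ?_ _).laurent_smul _).locFinite ?_ <;> simp [ratio_apply, hi.symm, hj.symm]
  · refine ((hE j).mulDir ?_ _).locFinite ?_ <;> simp [ratio_apply, hj, hij.symm]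

theorem phi_phi_cur_one {i j : Fin 3} (hi : i ≠ 2) (hj : j ≠ 2) (hij : i ≠ j) :
    mulDir (alphaPhi q) (ratio i j) (twoPhiOp q r [i, j, 2] 1) =
      (var i * var j) •
        invLin (q ^ 2)⁻¹ j 2 (invLin (q ^ 2)⁻¹ i 2 (twoPhiProduct q r)) := by
  have hE := creationProduct_ev (twoPhi (phiCreate q r) (curCreate q r))
  have hE' := creationProduct_ev_add (twoPhi (phiCreate q r) (curCreate q r))
  rw [twoPhiOp, opProduct_triple q _ _ hij hi hj
    (γij := (alphaPhi q)⁻¹) (γik := (1 - C ((q ^ 2)⁻¹) * X)⁻¹) (γjk := (1 - C ((q ^ 2)⁻¹) * X)⁻¹)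
    (by rw [twoPhi_ne _ _ hi, twoPhi_ne _ _ hj]; exact isContraction_phi_phi hq0 hq1 hr)
    (by rw [twoPhi_ne _ _ hi]; exact isContraction_phi_cur hq0 hq1 hr)
    (by rw [twoPhi_ne _ _ hj]; exact isContraction_phi_cur hq0 hq1 hr),
    intCoeff_prod_eq_creationProduct _ hij hi hj,
    mulDir_comm (ℓ := ev j + ev 2) (ℓ' := ev 2), mulDir_cancel, mulDir_geometric, mulDir_geometric,
    invLin_smul, smul_smul, mul_comm]
  · refine ((hE 2).invLin ?_ _).locFinite ?_ <;> simp [ratio_apply, hi.symm, hj.symm]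
  · refine ((hE j).mulDir ?_ _).locFinite ?_ <;> simp [ratio_apply, hj, hij.symm]
  · exact alphaPhi_mul_inv hq1
  · refine ((hE' j 2).mulDir ?_ _).mulDir ?_ _ <;>
      simp [ratio_apply, hi.symm, hj.symm, hj, hij.symm]
  · refine ((hE 2).mulDir ?_ _).mulDir ?_ _ <;> simp [ratio_apply, hi.symm, hj.symm]
  all_goals simp [ratio_apply, hi.symm, hj.symm, hj, hij.symm]

theorem phi_cur_phi_one {i j : Fin 3} (hi : i ≠ 2) (hj : j ≠ 2) (hij : i ≠ j) :
    mulDir (alphaPhi q) (ratio i j) (twoPhiOp q r [i, 2, j] 1) =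
      mulDir (1 - C (q ^ 4) * X)⁻¹ (ratio 2 j) (mulDir (1 - C ((q ^ 2)⁻¹) * X)⁻¹ (ratio i 2)
        (twoPhiProduct q r)) := by
  have hE := creationProduct_ev (twoPhi (phiCreate q r) (curCreate q r))
  rw [twoPhiOp, opProduct_triple q _ _ hi hij hj.symm
    (γij := (1 - C ((q ^ 2)⁻¹) * X)⁻¹) (γik := (alphaPhi q)⁻¹) (γjk := (1 - C (q ^ 4) * X)⁻¹)
    (by rw [twoPhi_ne _ _ hi]; exact isContraction_phi_cur hq0 hq1 hr)
    (by rw [twoPhi_ne _ _ hi, twoPhi_ne _ _ hj]; exact isContraction_phi_phi hq0 hq1 hr)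
    (by rw [twoPhi_ne _ _ hj]; exact isContraction_cur_phi hq0 hq1 hr),
    intCoeff_prod_eq_creationProduct _ hi hij hj.symm,
    mulDir_comm (a := ratio i j) (b := ratio 2 j) (ℓ := ev j) (ℓ' := ev j),
    mulDir_comm (a := ratio i j) (b := ratio i 2) (ℓ := ev j) (ℓ' := ev 2), mulDir_cancel]
  · refine (hE j).locFinite ?_
    simp [ratio_apply, hij.symm]
  · exact alphaPhi_mul_inv hq1
  · refine (hE j).mulDir ?_ _
    simp [ratio_apply, hij.symm]
  · refine (hE 2).mulDir ?_ _
    simp [ratio_apply, hi.symm, hj.symm]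
  · simp [ratio_apply, hij.symm]
  · simp [ratio_apply, hj, hij.symm]
  · simp [ratio_apply, hi.symm]
  · refine ((hE j).mulDir ?_ _).mulDir ?_ _ <;> simp [ratio_apply, hj, hij.symm]
  · refine ((hE j).mulDir ?_ _).mulDir ?_ _ <;> simp [ratio_apply, hj, hij.symm]
  all_goals simp [ratio_apply, hj, hij.symm]

theorem phi_cur_phi_one' {i j : Fin 3} (hi : i ≠ 2) (hj : j ≠ 2) (hij : i ≠ j) :
    mulDir (alphaPhi q) (ratio i j) (twoPhiOp q r [i, 2, j] 1) =
      (var i * var 2) • invLin (q ^ 4) 2 j (invLin (q ^ 2)⁻¹ i 2 (twoPhiProduct q r)) := by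
  have hE := creationProduct_ev (twoPhi (phiCreate q r) (curCreate q r))
  rw [phi_cur_phi_one hq0 hq1 hr hi hj hij, mulDir_geometric, mulDir_geometric, invLin_smul,
    smul_smul, mul_comm]
  refine ((hE j).invLin ?_ _).locFinite ?_ <;> simp [ratio_apply, hj, hij.symm]

theorem cur_phi_phi_one {i j : Fin 3} (hi : i ≠ 2) (hj : j ≠ 2) (hij : i ≠ j) :
    mulDir (alphaPhi q) (ratio i j) (twoPhiOp q r [2, i, j] 1) =
      (var 2 * var 2) • invLin (q ^ 4) 2 i (invLin (q ^ 4) 2 j (twoPhiProduct q r)) := by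
  have hE := creationProduct_ev (twoPhi (phiCreate q r) (curCreate q r))
  rw [twoPhiOp, opProduct_triple q _ _ hi.symm hj.symm hij
    (γij := (1 - C (q ^ 4) * X)⁻¹) (γik := (1 - C (q ^ 4) * X)⁻¹) (γjk := (alphaPhi q)⁻¹)
    (by rw [twoPhi_ne _ _ hi]; exact isContraction_cur_phi hq0 hq1 hr)
    (by rw [twoPhi_ne _ _ hj]; exact isContraction_cur_phi hq0 hq1 hr)
    (by rw [twoPhi_ne _ _ hi, twoPhi_ne _ _ hj]; exact isContraction_phi_phi hq0 hq1 hr),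
    intCoeff_prod_eq_creationProduct _ hi.symm hj.symm hij, mulDir_cancel, mulDir_geometric,
    mulDir_geometric, invLin_smul, smul_smul]
  · refine ((hE i).invLin ?_ _).locFinite ?_ <;> simp [ratio_apply, hi, hij]
  · refine (((hE j).mulDir ?_ _).mulDir ?_ _).locFinite ?_ <;> simp [ratio_apply, hj, hij.symm]
  · exact alphaPhi_mul_inv hq1

end Vacuum

/-! ### The Serre relation on polynomials -/

section Serre

variable {q r : ℂ}

theorem scal_inv_sq (q : ℂ) : scal (q ^ 2)⁻¹ = scal q⁻¹ ^ 2 := by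
  rw [← inv_pow, scal_pow]

/-- The Serre combination of the products of one `Φ_-(t₀)` and two currents, in which the current
in the variable `t_i` stands to the left of that in `t_j`. -/
def serreSum (q r : ℂ) (i j : Fin 3) (v : Pol) : (Fin 3 → ℤ) → Pol :=
  (scal q⁻¹ ^ 6 * varInv 0 ^ 2 * var i ^ 2) • onePhiOp q r [0, i, j] v +
    ((scal q + scal q⁻¹) * scal q⁻¹ ^ 3 * varInv 0 * var i) • onePhiOp q r [i, 0, j] v +
    (var i * varInv j) • onePhiOp q r [i, j, 0] v

theorem serreSum_one (hq0 : q ≠ 0) (hq1 : ‖q‖ < 1) (hr : r ^ 2 = q) {i j : Fin 3} (hi : i ≠ 0)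
    (hj : j ≠ 0) (hij : i ≠ j) : serreSum q r i j 1 =
      ((var i - var j) * (var i - scal q ^ 2 * var j)) • (scal q⁻¹ ^ 6 •
          invLin (q ^ 2)⁻¹ 0 i (invLin (q ^ 2)⁻¹ 0 j (onePhiProduct q r)) +
        ((scal q + scal q⁻¹) * scal q⁻¹ ^ 3) •
          invLin (q ^ 2)⁻¹ 0 j (invLin (q ^ 4) i 0 (onePhiProduct q r)) +
        invLin (q ^ 4) j 0 (invLin (q ^ 4) i 0 (onePhiProduct q r))) := by
  have hF : (1 - mono (ratio i j) 1) * (1 - mono (ratio i j) (q ^ 2)) * var i ^ 2 =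
      (var i - var j) * (var i - scal q ^ 2 * var j) := by
    have h1 : mono (ratio i j) (q ^ 2) = scal q ^ 2 * (var j * varInv i) := by
      rw [← mono_ratio, ← scal_pow, scal_mul_mono]
    rw [h1, mono_ratio]
    have h := var_mul_varInv i
    linear_combination (var i * (-var j - scal q ^ 2 * var j) +
      (var i * varInv i + 1) * scal q ^ 2 * var j ^ 2) * h
  have h0 := var_mul_varInv 0
  have h0' : var 0 ^ 2 * varInv 0 ^ 2 = 1 := by rw [← mul_pow, h0, one_pow]
  have h2 := var_mul_varInv j
  rw [serreSum, phi_cur_cur_one hq0 hq1 hr hi hj hij, cur_phi_cur_one hq0 hq1 hr hi hj hij,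
    cur_cur_phi_one hq0 hq1 hr hi hj hij, ← hF]
  simp only [smul_add, smul_smul]
  refine congrArg₂ (· + ·) (congrArg₂ (· + ·) (congrArg (· • _) ?_) (congrArg (· • _) ?_))
    (congrArg (· • _) ?_)
  · linear_combination (scal q⁻¹ ^ 6 * var i ^ 2 * (1 - mono (ratio i j) 1) *
      (1 - mono (ratio i j) (q ^ 2))) * h0'
  · linear_combination ((scal q + scal q⁻¹) * scal q⁻¹ ^ 3 * var i ^ 2 *
      (1 - mono (ratio i j) 1) * (1 - mono (ratio i j) (q ^ 2))) * h0
  · linear_combination (var i ^ 2 *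
      (1 - mono (ratio i j) 1) * (1 - mono (ratio i j) (q ^ 2))) * h2

theorem serreSum_symm_one (hq0 : q ≠ 0) (hq1 : ‖q‖ < 1) (hr : r ^ 2 = q) :
    serreSum q r 1 2 1 + serreSum q r 2 1 1 = 0 := by
  rw [serreSum_one hq0 hq1 hr (by decide) (by decide) (by decide),
    serreSum_one hq0 hq1 hr (by decide) (by decide) (by decide)]
  have hE : ∀ i, BoundedAlong (ev i) (onePhiProduct q r) := creationProduct_ev _
  have hU : invLin (q ^ 2)⁻¹ 0 2 (invLin (q ^ 2)⁻¹ 0 1 (onePhiProduct q r)) =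
      invLin (q ^ 2)⁻¹ 0 1 (invLin (q ^ 2)⁻¹ 0 2 (onePhiProduct q r)) := by
    apply invLin_comm (hE 2) (hE 1) <;> simp [ratio_apply]
  have hY : invLin (q ^ 4) 1 0 (invLin (q ^ 4) 2 0 (onePhiProduct q r)) =
      invLin (q ^ 4) 2 0 (invLin (q ^ 4) 1 0 (onePhiProduct q r)) := by
    apply invLin_comm (hE 0) (hE 0) <;> simp [ratio_apply]
  have hW₁ : invLin (q ^ 2)⁻¹ 0 2 (invLin (q ^ 4) 1 0 (onePhiProduct q r)) =
      invLin (q ^ 4) 1 0 (invLin (q ^ 2)⁻¹ 0 2 (onePhiProduct q r)) := by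
    apply invLin_comm (hE 2) ((creationProduct_ev_add _ 0 2)) <;> simp [ratio_apply]
  have hW₂ : invLin (q ^ 2)⁻¹ 0 1 (invLin (q ^ 4) 2 0 (onePhiProduct q r)) =
      invLin (q ^ 4) 2 0 (invLin (q ^ 2)⁻¹ 0 1 (onePhiProduct q r)) := by
    apply invLin_comm (hE 1) ((creationProduct_ev_add _ 0 1)) <;> simp [ratio_apply]
  rw [hU, hY]
  have hrel := fun (c : ℂ) (i j : Fin 3) (S : (Fin 3 → ℤ) → Pol)
    (h : LocFinite (ratio i j) S) => var_sub_smul_invLin h c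
  apply serre_kernel (u₁ := invLin (q ^ 2)⁻¹ 0 1 (onePhiProduct q r))
    (u₂ := invLin (q ^ 2)⁻¹ 0 2 (onePhiProduct q r))
    (y₁ := invLin (q ^ 4) 1 0 (onePhiProduct q r))
    (y₂ := invLin (q ^ 4) 2 0 (onePhiProduct q r)) (scal_mul_inv hq0)
  · rw [← scal_inv_sq]
    refine hrel _ _ _ _ (((hE 1).invLin ?_ _).locFinite ?_) <;> simp [ratio_apply]
  · rw [← scal_inv_sq, ← hU]
    refine hrel _ _ _ _ (((hE 2).invLin ?_ _).locFinite ?_) <;> simp [ratio_apply]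
  · rw [← scal_pow, ← hY]
    refine hrel _ _ _ _ (((hE 0).invLin ?_ _).locFinite ?_) <;> simp [ratio_apply]
  · rw [← scal_pow]
    refine hrel _ _ _ _ (((hE 0).invLin ?_ _).locFinite ?_) <;> simp [ratio_apply]
  · rw [← scal_pow, hW₁]
    refine hrel _ _ _ _ ((((creationProduct_ev_add _ 0 2)).invLin ?_ _).locFinite ?_) <;>
      simp [ratio_apply]
  · rw [← scal_inv_sq]
    refine hrel _ _ _ _ (((hE 2).invLin ?_ _).locFinite ?_) <;> simp [ratio_apply]
  · rw [← scal_pow, hW₂]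
    refine hrel _ _ _ _ ((((creationProduct_ev_add _ 0 1)).invLin ?_ _).locFinite ?_) <;>
      simp [ratio_apply]
  · rw [← scal_inv_sq]
    refine hrel _ _ _ _ (((hE 1).invLin ?_ _).locFinite ?_) <;> simp [ratio_apply]

theorem serreSum_eq_smul {i j : Fin 3} (h0 : ([0, i, j] : List (Fin 3)).Perm [0, 1, 2]) (v : Pol) :
    serreSum q r i j v = dressing q (onePhi (phiAnnih q r) (curAnnih q r)) [0, 1, 2] v •
      serreSum q r i j 1 := by
  have h1 : ([i, 0, j] : List (Fin 3)).Perm [0, 1, 2] := (List.Perm.swap _ _ _).trans h0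
  have h2 : ([i, j, 0] : List (Fin 3)).Perm [0, 1, 2] :=
    ((List.Perm.swap 0 j []).cons i).trans h1
  have hn : ([0, 1, 2] : List (Fin 3)).Nodup := by decide
  have key : ∀ {L : List (Fin 3)}, L.Perm [0, 1, 2] → onePhiOp q r L v =
      dressing q (onePhi (phiAnnih q r) (curAnnih q r)) [0, 1, 2] v • onePhiOp q r L 1 := by
    intro L hL
    rw [← dressing_perm _ _ hL]
    exact opProduct_eq_dressing_smul _ _ _ _ (hL.nodup_iff.mpr hn) v
  rw [serreSum, serreSum, key h0, key h1, key h2]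
  module

theorem serreSum_symm (hq0 : q ≠ 0) (hq1 : ‖q‖ < 1) (hr : r ^ 2 = q) (v : Pol) :
    serreSum q r 1 2 v + serreSum q r 2 1 v = 0 := by
  rw [serreSum_eq_smul (i := 1) (j := 2) (List.Perm.refl _) v,
    serreSum_eq_smul (i := 2) (j := 1) (by decide) v, ← smul_add,
    serreSum_symm_one hq0 hq1 hr, smul_zero]

/-- `V^Φ_k`: the modes of `Φ_-` on polynomials. -/
abbrev phiMode (q r : ℂ) (k : ℤ) : Module.End ℂ Pol := normalExp q (phiCreate q r) (phiAnnih q r) k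

/-- `V^X_k`: the modes of `X^-` on polynomials. -/
abbrev curMode (q r : ℂ) (k : ℤ) : Module.End ℂ Pol := normalExp q (curCreate q r) (curAnnih q r) k

theorem mono_pow (a : Fin 3 → ℤ) (c : ℂ) (n : ℕ) : mono a c ^ n = mono (n • a) (c ^ n) := by
  rw [mono, mono, AddMonoidAlgebra.single_pow, map_pow]

/-- On the diagonal `t₁ = t₂` of exponents both halves of the symmetrised relation agree. -/
theorem serre_modes (hq0 : q ≠ 0) (hq1 : ‖q‖ < 1) (hr : r ^ 2 = q) (p a : ℤ) (v : Pol) :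
    q⁻¹ ^ 6 • phiMode q r (p + 2) (curMode q r (a - 3) (curMode q r (a - 1) v)) +
      ((q + q⁻¹) * q⁻¹ ^ 3) • curMode q r (a - 2) (phiMode q r (p + 1) (curMode q r (a - 1) v)) +
      curMode q r (a - 2) (curMode q r a (phiMode q r p v)) = 0 := by
  have key : ∀ i j : Fin 3, i ≠ 0 → j ≠ 0 → i ≠ j →
      serreSum q r i j v (fun x => if x = 0 then p else a - 1) =
      q⁻¹ ^ 6 • phiMode q r (p + 2) (curMode q r (a - 3) (curMode q r (a - 1) v)) +
      ((q + q⁻¹) * q⁻¹ ^ 3) • curMode q r (a - 2) (phiMode q r (p + 1) (curMode q r (a - 1) v)) +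
      curMode q r (a - 2) (curMode q r a (phiMode q r p v)) := by
    intro i j hi hj hij
    have e1 : scal q⁻¹ ^ 6 * varInv 0 ^ 2 * var i ^ 2 =
        mono (Pi.single i 2 - Pi.single 0 2) (q⁻¹ ^ 6) := by
      rw [scal, varInv, var, mono_pow, mono_pow, mono_pow, mono_mul, mono_mul]
      congr 1
      · simp [← Pi.single_smul, ← Pi.single_neg, sub_eq_neg_add]
      · ring
    have e2 : (scal q + scal q⁻¹) * scal q⁻¹ ^ 3 * varInv 0 * var i =
        mono (Pi.single i 1 - Pi.single 0 1) ((q + q⁻¹) * q⁻¹ ^ 3) := by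
      have : scal q + scal q⁻¹ = scal (q + q⁻¹) := by
        rw [scal, scal, scal, mono, mono, mono, map_add, AddMonoidAlgebra.single_add]
      rw [this, scal, scal, varInv, var, mono_pow, mono_mul, mono_mul, mono_mul]
      congr 1
      · simp [sub_eq_neg_add]
      · ring
    have e3 : var i * varInv j = mono (Pi.single i 1 - Pi.single j 1) 1 := by
      rw [var, varInv, mono_mul, sub_eq_add_neg, mul_one]
    rw [serreSum, e1, e2, e3, Pi.add_apply, Pi.add_apply, mono_smul_apply, mono_smul_apply,
      mono_smul_apply, one_smul]
    simp only [opProduct, onePhi_ne _ _ hi, onePhi_ne _ _ hj, onePhi_zero, Pi.sub_apply,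
      Pi.single_apply, hi, hj, hij, hi.symm, hj.symm, hij.symm, if_true, if_false]
    ring_nf
  have h := congrFun (serreSum_symm hq0 hq1 hr v) fun x => if x = 0 then p else a - 1
  rw [Pi.add_apply, key 1 2 (by decide) (by decide) (by decide),
    key 2 1 (by decide) (by decide) (by decide), ← two_nsmul, Pi.zero_apply] at h
  exact (smul_eq_zero.mp h).resolve_left two_ne_zero

end Serre

/-! ### Local finiteness of products of vertex operators -/

section OpProductLocFinite

variable {ι : Type*} (q : ℂ) (c d : ι → ℕ+ → ℂ)

/-- Vertex operators applied to a fixed vector have exponents bounded below, so a product may be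
multiplied by series in `t_j / t_i` as soon as `t_i` occurs at most to the left of `t_j`. -/
theorem opProduct_cons_locFinite_self [DecidableEq ι] {i j : ι} {L : List ι} (hij : i ≠ j)
    (hi : i ∉ L) (hj : j ∉ L) (v : Pol) : LocFinite (ratio i j) (opProduct q c d (j :: L) v) := by
  intro κ
  obtain ⟨N, hN⟩ := normalExp_bounded_below q (c j) (d j) (opProduct q c d L v κ)
  refine ⟨(κ j - N).toNat + 1, fun n hn => ?_⟩
  have h : opProduct q c d L v (κ - n • ratio i j) = opProduct q c d L v κ := by
    refine opProduct_congr q c d L v fun x hx => ?_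
    have h1 : x ≠ i := fun h => hi (h ▸ hx)
    have h2 : x ≠ j := fun h => hj (h ▸ hx)
    simp [ratio, h1, h2]
  rw [opProduct, h]
  refine hN _ ?_
  simp [ratio, hij.symm]
  omega

theorem LocFinite.opProduct_cons {a : ι → ℤ} {L : List ι} {v : Pol}
    (h : LocFinite a (opProduct q c d L v)) (i : ι) :
    LocFinite a (opProduct q c d (i :: L) v) := by
  intro κ
  obtain ⟨N, hN⟩ := h κ
  exact ⟨N, fun n hn => by rw [opProduct, hN n hn, map_zero]⟩

end OpProductLocFinite

/-! ### The support of the mixed product -/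

section Fusion

/-- When the exponent `i` of `f` is at most `0`, the sum over `n ≥ 0` runs over all nonzero
coefficients of `f`, hence is a full convolution. -/
theorem finsum_pow_smul_intCoeff (f g : Pol⟦X⟧) {c : ℂ} {i : ℤ} (hi : i ≤ 0) (k : ℤ) :
    ∑ᶠ n : ℕ, c ^ n • (intCoeff f (i + n) * intCoeff g (k - n)) =
      c ^ (-i) • intCoeff (rescale (MvPolynomial.C c) f * g) (i + k) := by
  obtain ⟨N, rfl⟩ : ∃ N : ℕ, i = -(N : ℤ) := ⟨(-i).toNat, by omega⟩
  rcases lt_or_ge (-(N : ℤ) + k) 0 with h | h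
  · rw [intCoeff_of_neg _ h, smul_zero]
    refine finsum_eq_zero_of_forall_eq_zero fun n => ?_
    rcases lt_or_ge n N with h' | h'
    · rw [intCoeff_of_neg f (by omega), zero_mul, smul_zero]
    · rw [intCoeff_of_neg g (by omega), mul_zero, smul_zero]
  · obtain ⟨K, rfl⟩ : ∃ K : ℕ, k = N + K := ⟨(k - N).toNat, by omega⟩
    rw [finsum_eq_sum_of_support_subset (s := Finset.range (N + (K + 1))), Finset.sum_range_add,
      Finset.sum_eq_zero, zero_add, neg_neg, zpow_natCast, neg_add_cancel_left, intCoeff_natCast,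
      coeff_mul, Finset.Nat.sum_antidiagonal_eq_sum_range_succ
        (f := fun a b => coeff a (rescale (MvPolynomial.C c) f) * coeff b g), Finset.smul_sum]
    · refine Finset.sum_congr rfl fun a ha => ?_
      rw [Finset.mem_range] at ha
      have e1 : -(N : ℤ) + ((N + a : ℕ) : ℤ) = (a : ℕ) := by push_cast; ring
      have e2 : (N : ℤ) + K - ((N + a : ℕ) : ℤ) = ((K - a : ℕ) : ℤ) := by omega
      rw [e1, e2, intCoeff_natCast, intCoeff_natCast, coeff_rescale, pow_add, mul_smul, ← map_pow,
        mul_assoc, ← MvPolynomial.smul_eq_C_mul]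
    · intro n hn
      rw [Finset.mem_range] at hn
      rw [intCoeff_of_neg f (by omega), zero_mul, smul_zero]
    · intro n hn
      rw [Finset.coe_range, Set.mem_Iio]
      by_contra h'
      exact hn (by simp only; rw [intCoeff_of_neg g (by omega), mul_zero, smul_zero])

theorem coeff_inv_one_sub (c : ℂ) (n : ℕ) : coeff n (1 - C c * X : ℂ⟦X⟧)⁻¹ = c ^ n := by
  have h : (1 - C c * X : ℂ⟦X⟧)⁻¹ = mk fun n => c ^ n := by
    rw [PowerSeries.inv_eq_iff_mul_eq_one (by simp)]
    have h := congrArg (rescale c) (mk_one_mul_one_sub_eq_one ℂ)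
    rw [map_mul, map_sub, map_one, rescale_X] at h
    refine Eq.trans (congrArg (· * _) ?_) h
    ext n
    simp [coeff_rescale]
  rw [h, coeff_mk]

variable {q r : ℂ} (hq0 : q ≠ 0) (hq1 : ‖q‖ < 1) (hr : r ^ 2 = q)

include hq0 hq1 hr

/-- Far out in the direction `w / z` the product `Φ_-(z) X^-(ζ) Φ_-(w)` on the vacuum is a
delta function, since the creation parts cancel on `z = q² w`, `ζ = q⁴ w`. -/
theorem phi_cur_phi_one_apply {κ : Fin 3 → ℤ} (h0 : κ 0 ≤ 0) (h02 : κ 0 + κ 2 ≤ 0) :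
    mulDir (alphaPhi q) (ratio 0 1) (twoPhiOp q r [0, 2, 1] 1) κ =
      if κ 0 + κ 1 + κ 2 = 0 then MvPolynomial.C (q ^ (-2 * κ 0 - 4 * κ 2)) else 0 := by
  rw [phi_cur_phi_one hq0 hq1 hr (by decide) (by decide) (by decide)]
  set E := creation (phiCreate q r) with hE
  set E' := creation (curCreate q r) with hE'
  have hq2 : q ^ 2 ≠ 0 := pow_ne_zero _ hq0
  have hq4 : q ^ 4 ≠ 0 := pow_ne_zero _ hq0
  -- The inner multiplication performs the sum over the exponents of `z`, at `z = q² w` up to scale.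
  have h1 : ∀ μ : Fin 3 → ℤ, μ 0 ≤ 0 →
      mulDir (1 - C ((q ^ 2)⁻¹) * X)⁻¹ (ratio 0 2) (twoPhiProduct q r) μ =
        ((q ^ 2)⁻¹ ^ (-μ 0)) • (intCoeff (rescale (MvPolynomial.C (q ^ 2)⁻¹) E * E')
          (μ 0 + μ 2) * intCoeff E (μ 1)) := by
    intro μ hμ
    rw [← smul_mul_assoc, ← finsum_pow_smul_intCoeff E E' hμ, mulDir, finsum_mul']
    · refine finsum_congr fun n => ?_
      rw [coeff_inv_one_sub, smul_mul_assoc]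
      refine congrArg (_ • ·) ?_
      rw [twoPhiProduct, creationProduct, twoPhi_two, twoPhi_ne _ _ (by decide),
        twoPhi_ne _ _ (by decide)]
      have e0 : (μ - n • ratio (0 : Fin 3) 2) 0 = μ 0 + n := by simp [ratio_apply]
      have e1 : (μ - n • ratio (0 : Fin 3) 2) 1 = μ 1 := by simp [ratio_apply]
      have e2 : (μ - n • ratio (0 : Fin 3) 2) 2 = μ 2 - n := by simp [ratio_apply]
      rw [e0, e1, e2]
      ring
    · refine (Set.finite_Iio ((μ 2).toNat + 1)).subset fun n hn => ?_
      rw [Set.mem_Iio]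
      by_contra hc
      exact hn (by simp only; rw [intCoeff_of_neg E' (by omega), mul_zero, smul_zero])
  -- The outer one sums over the exponents of `w`, so that the fused product of creation parts
  -- appears.
  have h2 : rescale (MvPolynomial.C (q ^ 4)) (rescale (MvPolynomial.C (q ^ 2)⁻¹) E * E') * E =
      1 := by
    have h := congrArg (rescale (MvPolynomial.C (q ^ 4) : Pol)) (creation_fusion hq0 hq1 hr)
    rw [map_mul, map_mul, map_one, rescale_rescale _ (MvPolynomial.C (q ^ 4)⁻¹),
      ← MvPolynomial.C_mul, inv_mul_cancel₀ hq4, MvPolynomial.C_1, rescale_one, RingHom.id_apply] at h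
    rw [map_mul, ← h]
    ring
  rw [mulDir]
  have h3 := finsum_pow_smul_intCoeff (c := q ^ 4)
    (rescale (MvPolynomial.C (q ^ 2)⁻¹) E * E') E h02 (κ 1)
  rw [h2] at h3
  have h4 : ∀ n : ℕ, coeff n (1 - C (q ^ 4) * X)⁻¹ •
      mulDir (1 - C ((q ^ 2)⁻¹) * X)⁻¹ (ratio 0 2) (twoPhiProduct q r)
        (κ - n • ratio (2 : Fin 3) 1) = ((q ^ 2)⁻¹ ^ (-κ 0)) • ((q ^ 4) ^ n •
      (intCoeff (rescale (MvPolynomial.C (q ^ 2)⁻¹) E * E') (κ 0 + κ 2 + n) *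
        intCoeff E (κ 1 - n))) := by
    intro n
    have e0 : (κ - n • ratio (2 : Fin 3) 1) 0 = κ 0 := by simp [ratio_apply]
    have e1 : (κ - n • ratio (2 : Fin 3) 1) 1 = κ 1 - n := by simp [ratio_apply]
    have e2 : (κ - n • ratio (2 : Fin 3) 1) 2 = κ 2 + n := by simp [ratio_apply]
    rw [coeff_inv_one_sub, h1 _ (by rw [e0]; exact h0), e0, e1, e2, smul_comm, add_assoc]
  rw [finsum_congr h4, ← smul_finsum, h3, smul_smul]
  have hsum : κ 0 + κ 2 + κ 1 = κ 0 + κ 1 + κ 2 := by ring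
  rw [hsum]
  split_ifs with h
  · rw [h, show (0 : ℤ) = ((0 : ℕ) : ℤ) from rfl, intCoeff_natCast, coeff_zero_one,
      MvPolynomial.smul_eq_C_mul, mul_one]
    congr 1
    rw [inv_zpow, ← zpow_neg, neg_neg, ← zpow_natCast, ← zpow_natCast, ← zpow_mul, ← zpow_mul,
      ← zpow_add₀ hq0]
    congr 1
    push_cast
    ring
  · rcases lt_or_ge (κ 0 + κ 1 + κ 2) 0 with h' | h'
    · rw [intCoeff_of_neg _ h', smul_zero]
    · obtain ⟨K, hK⟩ : ∃ K : ℕ, κ 0 + κ 1 + κ 2 = K := ⟨_, (Int.toNat_of_nonneg h').symm⟩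
      rw [hK, intCoeff_natCast, coeff_one, if_neg (by omega), smul_zero]

end Fusion

/-! ### The exchange relation on polynomials -/

section Exchange

/-- The coefficient of `z^κ₀ w^κ₁ ζ^κ₂` in `ζ δ(z, q² w) δ(ζ, q⁴ w)`. -/
def doubleDelta (q : ℂ) (κ : Fin 3 → ℤ) : ℂ :=
  if κ 0 + κ 1 + κ 2 = -1 then q ^ (-2 - 2 * κ 0 - 4 * κ 2) else 0

/-- A product of operators `Φ_-(z)`, `Φ_-(w)`, `X^-(ζ)`, where `z = t₀`, `w = t₁` and `ζ = t₂`,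
multiplied by `α_φ(w/z)`. -/
def prodZW (q r : ℂ) (L : List (Fin 3)) (v : Pol) : (Fin 3 → ℤ) → Pol :=
  mulDir (alphaPhi q) (ratio 0 1) (twoPhiOp q r L v)

/-- A product of operators `Φ_-(z)`, `Φ_-(w)`, `X^-(ζ)` as in `prodZW`, multiplied by `α_φ(z/w)`. -/
def prodWZ (q r : ℂ) (L : List (Fin 3)) (v : Pol) : (Fin 3 → ℤ) → Pol :=
  mulDir (alphaPhi q) (ratio 1 0) (twoPhiOp q r L v)

/-- The distribution whose coefficients at `ζ^m` give `z^{-1/2} α_φ(w/z) Φ_-(z) Φ_+(w)` on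
`v ⊗ e_m`, up to the factor `(q s)^(2 m - 1)`. -/
def minusPlusZW (q r : ℂ) (v : Pol) : (Fin 3 → ℤ) → Pol :=
  -((scal q⁻¹ ^ 3 * var 2 * varInv 0 * varInv 1) • prodZW q r [0, 1, 2] v) -
    (scal q * varInv 0) • prodZW q r [0, 2, 1] v

/-- The analogue of `minusPlusZW` for `z^{-1/2} α_φ(w/z) Φ_+(z) Φ_-(w)`. -/
def plusMinusZW (q r : ℂ) (v : Pol) : (Fin 3 → ℤ) → Pol :=
  varInv 0 • prodZW q r [0, 2, 1] v + (scal q ^ 4 * varInv 2) • prodZW q r [2, 0, 1] v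

/-- The analogue of `minusPlusZW` for `w^{-1/2} α_φ(z/w) Φ_-(w) Φ_+(z)`. -/
def plusMinusWZ (q r : ℂ) (v : Pol) : (Fin 3 → ℤ) → Pol :=
  -((scal q⁻¹ ^ 3 * var 2 * varInv 0 * varInv 1) • prodWZ q r [1, 0, 2] v) -
    (scal q * varInv 1) • prodWZ q r [1, 2, 0] v

/-- The analogue of `minusPlusZW` for `w^{-1/2} α_φ(z/w) Φ_+(w) Φ_-(z)`. -/
def minusPlusWZ (q r : ℂ) (v : Pol) : (Fin 3 → ℤ) → Pol :=
  varInv 1 • prodWZ q r [1, 2, 0] v + (scal q ^ 4 * varInv 2) • prodWZ q r [2, 1, 0] v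

section LocallyFinite

variable (q r : ℂ) (v : Pol)

theorem locFinite_zwx : LocFinite (ratio 0 1) (twoPhiOp q r [0, 1, 2] v) :=
  (opProduct_cons_locFinite_self q _ _ (by decide) (by decide) (by decide) v).opProduct_cons _ _ _ _

theorem locFinite_zxw : LocFinite (ratio 0 1) (twoPhiOp q r [0, 2, 1] v) :=
  ((opProduct_cons_locFinite_self q _ _ (by decide) (by decide) (by decide) v).opProduct_cons
    _ _ _ _).opProduct_cons _ _ _ _

theorem locFinite_xzw : LocFinite (ratio 0 1) (twoPhiOp q r [2, 0, 1] v) :=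
  ((opProduct_cons_locFinite_self q _ _ (by decide) (by decide) (by decide) v).opProduct_cons
    _ _ _ _).opProduct_cons _ _ _ _

theorem locFinite_wzx : LocFinite (ratio 1 0) (twoPhiOp q r [1, 0, 2] v) :=
  (opProduct_cons_locFinite_self q _ _ (by decide) (by decide) (by decide) v).opProduct_cons _ _ _ _

theorem locFinite_wxz : LocFinite (ratio 1 0) (twoPhiOp q r [1, 2, 0] v) :=
  ((opProduct_cons_locFinite_self q _ _ (by decide) (by decide) (by decide) v).opProduct_cons
    _ _ _ _).opProduct_cons _ _ _ _

theorem locFinite_xwz : LocFinite (ratio 1 0) (twoPhiOp q r [2, 1, 0] v) :=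
  ((opProduct_cons_locFinite_self q _ _ (by decide) (by decide) (by decide) v).opProduct_cons
    _ _ _ _).opProduct_cons _ _ _ _

theorem LocFinite.neg {Λ M : Type*} [AddCommGroup Λ] [AddCommGroup M] {a : Λ}
    {S : Λ → M} (h : LocFinite a S) : LocFinite a (-S) := fun κ => by
  obtain ⟨N, hN⟩ := h κ
  exact ⟨N, fun n hn => by rw [Pi.neg_apply, hN n hn, neg_zero]⟩

theorem locFinite_plusMinusWZ : LocFinite (ratio 1 0) (plusMinusWZ q r v) := by
  rw [plusMinusWZ, sub_eq_add_neg]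
  exact (((locFinite_wzx q r v).mulDir _).laurent_smul _).neg.add
    (((locFinite_wxz q r v).mulDir _).laurent_smul _).neg

theorem locFinite_minusPlusWZ : LocFinite (ratio 1 0) (minusPlusWZ q r v) :=
  (((locFinite_wxz q r v).mulDir _).laurent_smul _).add
    (((locFinite_xwz q r v).mulDir _).laurent_smul _)

end LocallyFinite

/-- The dressing of a product of two `Φ_-` and one current. -/
abbrev twoPhiDressing (q r : ℂ) : Pol →ₐ[ℂ] Laurent :=
  dressing q (twoPhi (phiAnnih q r) (curAnnih q r)) [0, 1, 2]

theorem twoPhiOp_eq_dressing_smul (q r : ℂ) {L : List (Fin 3)} (hL : L.Perm [0, 1, 2]) (v : Pol) :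
    twoPhiOp q r L v = twoPhiDressing q r v • twoPhiOp q r L 1 := by
  rw [twoPhiDressing, ← dressing_perm _ _ hL]
  exact opProduct_eq_dressing_smul _ _ _ _ (hL.nodup_iff.mpr (by decide)) v

theorem prodZW_eq_dressing_smul (q r : ℂ) {L : List (Fin 3)} (hL : L.Perm [0, 1, 2])
    (h : LocFinite (ratio 0 1) (twoPhiOp q r L 1)) (v : Pol) :
    prodZW q r L v = twoPhiDressing q r v • prodZW q r L 1 := by
  rw [prodZW, twoPhiOp_eq_dressing_smul q r hL v, mulDir_laurent_smul h, prodZW]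

theorem prodWZ_eq_dressing_smul (q r : ℂ) {L : List (Fin 3)} (hL : L.Perm [0, 1, 2])
    (h : LocFinite (ratio 1 0) (twoPhiOp q r L 1)) (v : Pol) :
    prodWZ q r L v = twoPhiDressing q r v • prodWZ q r L 1 := by
  rw [prodWZ, twoPhiOp_eq_dressing_smul q r hL v, mulDir_laurent_smul h, prodWZ]

theorem minusPlusZW_eq_dressing_smul (q r : ℂ) (v : Pol) :
    minusPlusZW q r v = twoPhiDressing q r v • minusPlusZW q r 1 := by
  rw [minusPlusZW, minusPlusZW, prodZW_eq_dressing_smul q r (List.Perm.refl _) (locFinite_zwx q r 1)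
    v, prodZW_eq_dressing_smul q r (by decide) (locFinite_zxw q r 1) v]
  module

theorem plusMinusZW_eq_dressing_smul (q r : ℂ) (v : Pol) :
    plusMinusZW q r v = twoPhiDressing q r v • plusMinusZW q r 1 := by
  rw [plusMinusZW, plusMinusZW, prodZW_eq_dressing_smul q r (by decide) (locFinite_xzw q r 1)
    v, prodZW_eq_dressing_smul q r (by decide) (locFinite_zxw q r 1) v]
  module

theorem plusMinusWZ_eq_dressing_smul (q r : ℂ) (v : Pol) :
    plusMinusWZ q r v = twoPhiDressing q r v • plusMinusWZ q r 1 := by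
  rw [plusMinusWZ, plusMinusWZ, prodWZ_eq_dressing_smul q r (by decide) (locFinite_wzx q r 1)
    v, prodWZ_eq_dressing_smul q r (by decide) (locFinite_wxz q r 1) v]
  module

theorem minusPlusWZ_eq_dressing_smul (q r : ℂ) (v : Pol) :
    minusPlusWZ q r v = twoPhiDressing q r v • minusPlusWZ q r 1 := by
  rw [minusPlusWZ, minusPlusWZ, prodWZ_eq_dressing_smul q r (by decide) (locFinite_xwz q r 1)
    v, prodWZ_eq_dressing_smul q r (by decide) (locFinite_wxz q r 1) v]
  module

section Delta

variable {q r : ℂ} (hq0 : q ≠ 0)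

include hq0

/-- `ζ δ(z, q² w) δ(ζ, q⁴ w)` is annihilated by `q² w - z`. -/
theorem smul_doubleDelta : (scal q ^ 2 * var 1 - var 0) •
    (fun κ => doubleDelta q κ • (1 : Pol)) = 0 := by
  funext κ
  have h : scal q ^ 2 * var 1 - var 0 = mono (Pi.single 1 1) (q ^ 2) - mono (Pi.single 0 1) 1 := by
    rw [← scal_pow, var, scal_mul_mono, var]
  rw [h, sub_smul, Pi.sub_apply, mono_smul_apply, mono_smul_apply, smul_smul, one_smul,
    ← sub_smul, Pi.zero_apply]
  convert zero_smul ℂ (1 : Pol)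
  rw [doubleDelta, doubleDelta]
  simp only [Pi.sub_apply, Pi.single_apply, Fin.reduceEq, if_true, if_false, sub_zero]
  by_cases hκ : κ 0 + κ 1 + κ 2 = 0
  · rw [if_pos (by omega), if_pos (by omega), ← zpow_natCast, ← zpow_add₀ hq0, sub_eq_zero]
    congr 1
    push_cast
    ring
  · rw [if_neg (by omega), if_neg (by omega), mul_zero, sub_zero]

/-- The dressing acts trivially on the delta function, since the annihilation parts of `Φ_-(q² w)`,
`Φ_-(w)` and `X^-(q⁴ w)` cancel. -/
theorem dressing_smul_doubleDelta (hq1 : ‖q‖ < 1) (hr : r ^ 2 = q) (v : Pol) :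
    twoPhiDressing q r v • (fun κ => doubleDelta q κ • (1 : Pol)) =
      fun κ => doubleDelta q κ • v := by
  induction v using MvPolynomial.induction_on with
  | C t =>
    funext κ
    have h : twoPhiDressing q r (MvPolynomial.C t) =
        AddMonoidAlgebra.single 0 (MvPolynomial.C t) := by
      rw [twoPhiDressing, dressing, MvPolynomial.aeval_C]
      rfl
    rw [h, single_smul_apply, sub_zero, mul_smul_comm, mul_one]
  | add f g hf hg =>
    rw [map_add, add_smul, hf, hg]
    funext κ
    rw [Pi.add_apply, smul_add]
  | mul_X f n hf =>
    rw [mul_comm, map_mul, mul_smul, hf]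
    funext κ
    rw [twoPhiDressing, dressing, MvPolynomial.aeval_X, add_smul, Pi.add_apply, single_smul_apply,
      list_sum_single_smul_apply, sub_zero, mul_smul_comm]
    simp only [List.map_cons, List.map_nil, List.sum_cons, List.sum_nil, add_zero, twoPhi_two]
    rw [twoPhi_ne _ _ (by decide), twoPhi_ne _ _ (by decide)]
    convert add_zero _
    simp only [← MvPolynomial.smul_eq_C_mul, smul_smul, ← add_smul]
    convert zero_smul ℂ f
    have h := annihWeight_fusion hq0 hq1 hr n
    simp only [doubleDelta, Pi.add_apply, Pi.single_apply, Fin.reduceEq, if_true, if_false,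
      add_zero]
    by_cases hκ : κ 0 + κ 1 + κ 2 + n = -1
    · rw [if_pos (by omega), if_pos (by omega), if_pos (by omega)]
      have e1 : q ^ (-2 - 2 * (κ 0 + (n : ℤ)) - 4 * κ 2) =
          q ^ (-2 - 2 * κ 0 - 4 * κ 2) * ((q ^ 2)⁻¹) ^ (n : ℕ) := by
        rw [← zpow_natCast, ← zpow_natCast, ← zpow_neg, ← zpow_mul, ← zpow_add₀ hq0]
        congr 1
        push_cast
        ring
      have e2 : q ^ (-2 - 2 * κ 0 - 4 * (κ 2 + (n : ℤ))) =
          q ^ (-2 - 2 * κ 0 - 4 * κ 2) * ((q ^ 4)⁻¹) ^ (n : ℕ) := by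
        rw [← zpow_natCast, ← zpow_natCast, ← zpow_neg, ← zpow_mul, ← zpow_add₀ hq0]
        congr 1
        push_cast
        ring
      rw [e1, e2]
      linear_combination (q ^ (-2 - 2 * κ 0 - 4 * κ 2)) * h
    · rw [if_neg (by omega), if_neg (by omega), if_neg (by omega)]
      ring

end Delta

end Exchange

/-! ### Exchange relations for distributions -/

section ExchangeRelations

variable {q r : ℂ}

/-- `Φ_-(z) Φ_-(w)` and `Φ_-(w) Φ_-(z)` agree up to the scalar factors. -/
theorem phi_phi_exchange (hq0 : q ≠ 0) (hq1 : ‖q‖ < 1) (hr : r ^ 2 = q) (v : Pol) :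
    prodZW q r [0, 1] v = prodWZ q r [1, 0] v := by
  have hZ := opProduct_cons_locFinite_self q (twoPhi (phiCreate q r) (curCreate q r))
    (twoPhi (phiAnnih q r) (curAnnih q r)) (i := 0) (j := 1) (L := []) (by decide) (by simp)
    (by simp) 1
  have hW := opProduct_cons_locFinite_self q (twoPhi (phiCreate q r) (curCreate q r))
    (twoPhi (phiAnnih q r) (curAnnih q r)) (i := 1) (j := 0) (L := []) (by decide) (by simp)
    (by simp) 1
  have hb : ∀ i : Fin 3, BoundedAlong (ev i) fun κ : Fin 3 → ℤ =>
      if i = 2 then (0 : Pol) else intCoeff (creation (phiCreate q r)) (κ 0) *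
        intCoeff (creation (phiCreate q r)) (κ 1) := by
    intro i
    refine ⟨0, fun κ hκ => ?_⟩
    fin_cases i
    · simp [intCoeff_of_neg _ (show κ 0 < 0 from hκ)]
    · simp [intCoeff_of_neg _ (show κ 1 < 0 from hκ)]
    · simp
  have h1 : prodZW q r [0, 1] 1 = prodWZ q r [1, 0] 1 := by
    rw [prodZW, prodWZ, twoPhiOp, opProduct_pair q _ _ (by decide) (γ := (alphaPhi q)⁻¹)
      (by rw [twoPhi_ne _ _ (by decide), twoPhi_ne _ _ (by decide)]
          exact isContraction_phi_phi hq0 hq1 hr),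
      opProduct_pair q _ _ (by decide) (γ := (alphaPhi q)⁻¹)
      (by rw [twoPhi_ne _ _ (by decide), twoPhi_ne _ _ (by decide)]
          exact isContraction_phi_phi hq0 hq1 hr), twoPhi_ne _ _ (by decide),
      twoPhi_ne _ _ (by decide), mulDir_cancel _ (alphaPhi_mul_inv hq1),
      mulDir_cancel _ (alphaPhi_mul_inv hq1)]
    · funext κ
      rw [mul_comm]
    · refine (show BoundedAlong (ev 0) _ from ?_).locFinite (by simp [ratio_apply])
      simpa [mul_comm] using hb 0
    · refine (show BoundedAlong (ev 1) _ from ?_).locFinite (by simp [ratio_apply])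
      simpa using hb 1
  rw [prodZW, prodWZ] at h1 ⊢
  rw [twoPhiOp, opProduct_eq_dressing_smul _ _ _ _ (by decide) v,
    opProduct_eq_dressing_smul _ _ _ [1, 0] (by decide) v,
    mulDir_laurent_smul (hZ.opProduct_cons _ _ _ _), mulDir_laurent_smul (hW.opProduct_cons _ _ _ _),
    dressing_perm _ _ (List.Perm.swap 0 1 []), h1]

variable (hq0 : q ≠ 0) (hq1 : ‖q‖ < 1) (hr : r ^ 2 = q)

include hq0 hq1 hr

theorem prod_phi_phi_cur_comm : prodZW q r [0, 1, 2] 1 = prodWZ q r [1, 0, 2] 1 := by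
  have hE := creationProduct_ev (twoPhi (phiCreate q r) (curCreate q r))
  rw [prodZW, prodWZ, phi_phi_cur_one hq0 hq1 hr (by decide) (by decide) (by decide),
    phi_phi_cur_one hq0 hq1 hr (by decide) (by decide) (by decide), mul_comm (var 0),
    invLin_comm (hE 2) (hE 2)] <;> simp [ratio_apply]

theorem prod_cur_phi_phi_comm : prodZW q r [2, 0, 1] 1 = prodWZ q r [2, 1, 0] 1 := by
  have hE := creationProduct_ev (twoPhi (phiCreate q r) (curCreate q r))
  rw [prodZW, prodWZ, cur_phi_phi_one hq0 hq1 hr (by decide) (by decide) (by decide),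
    cur_phi_phi_one hq0 hq1 hr (by decide) (by decide) (by decide),
    invLin_comm (hE 0) (hE 1)] <;> simp [ratio_apply]

/-- The relation obtained from `Φ_-(z) Φ_-(w) ~ Φ_-(w) Φ_-(z)` by applying `x_0^-`. -/
theorem exchange_sum (v : Pol) : minusPlusZW q r v + scal q • plusMinusZW q r v =
    plusMinusWZ q r v + scal q • minusPlusWZ q r v := by
  rw [minusPlusZW_eq_dressing_smul, plusMinusZW_eq_dressing_smul, plusMinusWZ_eq_dressing_smul,
    minusPlusWZ_eq_dressing_smul, minusPlusZW, plusMinusZW, plusMinusWZ, minusPlusWZ,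
    prod_phi_phi_cur_comm hq0 hq1 hr, prod_cur_phi_phi_comm hq0 hq1 hr]
  module

/-- After subtraction of the delta function, `Φ_-(z) Φ_+(w)` on the vacuum has only finitely many
terms in each direction `w / z`, so that it may be multiplied by series in `z / w`. -/
theorem locFinite_minusPlusZW_add_delta : LocFinite (ratio 1 0)
    (minusPlusZW q r 1 + scal q • fun κ => doubleDelta q κ • (1 : Pol)) := by
  have h : minusPlusZW q r 1 + scal q • (fun κ => doubleDelta q κ • (1 : Pol)) =
      -((scal q⁻¹ ^ 3 * var 2 * varInv 0 * varInv 1) • prodWZ q r [1, 0, 2] 1) +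
        scal q • ((fun κ => doubleDelta q κ • (1 : Pol)) +
          -(varInv 0 • prodZW q r [0, 2, 1] 1)) := by
    rw [minusPlusZW, prod_phi_phi_cur_comm hq0 hq1 hr]
    module
  rw [h]
  refine (((locFinite_wzx q r 1).mulDir _).laurent_smul _).neg.add (LocFinite.laurent_smul ?_ _)
  intro κ
  refine ⟨(κ 0 + 1).toNat + (κ 0 + 1 + κ 2).toNat, fun n hn => ?_⟩
  rw [Pi.add_apply, Pi.neg_apply, varInv, mono_smul_apply, one_smul, sub_neg_eq_add]
  have e0 : (κ - n • ratio 1 0 + Pi.single 0 1 : Fin 3 → ℤ) 0 = κ 0 - n + 1 := by simp [ratio_apply]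
  have e1 : (κ - n • ratio 1 0 + Pi.single 0 1 : Fin 3 → ℤ) 1 = κ 1 + n := by simp [ratio_apply]
  have e2 : (κ - n • ratio 1 0 + Pi.single 0 1 : Fin 3 → ℤ) 2 = κ 2 := by simp [ratio_apply]
  have e0' : (κ - n • ratio 1 0 : Fin 3 → ℤ) 0 = κ 0 - n := by simp [ratio_apply]
  have e1' : (κ - n • ratio 1 0 : Fin 3 → ℤ) 1 = κ 1 + n := by simp [ratio_apply]
  have e2' : (κ - n • ratio 1 0 : Fin 3 → ℤ) 2 = κ 2 := by simp [ratio_apply]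
  rw [prodZW, phi_cur_phi_one_apply hq0 hq1 hr (by rw [e0]; omega) (by rw [e0, e2]; omega),
    doubleDelta, e0, e1, e2, e0', e1', e2']
  by_cases hκ : κ 0 + κ 1 + κ 2 = -1
  · rw [if_pos (by omega), if_pos (by omega), MvPolynomial.smul_eq_C_mul, mul_one,
      show -2 - 2 * (κ 0 - n) - 4 * κ 2 = -2 * (κ 0 - (n : ℤ) + 1) - 4 * κ 2 by ring,
      add_neg_cancel]
  · rw [if_neg (by omega), if_neg (by omega), zero_smul, neg_zero, add_zero]

/-- The kernel identity behind `exchange_delta`, multiplied by `q² w - z`. -/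
theorem exchange_cleared :
    (scal q ^ 2 * var 1 - var 0) • minusPlusZW q r 1 =
      -(((1 - scal q ^ 2) * var 0) • plusMinusWZ q r 1) +
        (scal q * (var 1 - var 0)) • minusPlusWZ q r 1 := by
  have hE := creationProduct_ev (twoPhi (phiCreate q r) (curCreate q r))
  have hE' := creationProduct_ev_add (twoPhi (phiCreate q r) (curCreate q r))
  set E := twoPhiProduct q r
  set U := invLin (q ^ 2)⁻¹ 1 2 (invLin (q ^ 2)⁻¹ 0 2 E) with hUdef
  set Y := invLin (q ^ 4) 2 1 (invLin (q ^ 4) 2 0 E) with hYdef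
  set M₁ := invLin (q ^ 4) 2 1 (invLin (q ^ 2)⁻¹ 0 2 E) with hM₁def
  set M₂ := invLin (q ^ 4) 2 0 (invLin (q ^ 2)⁻¹ 1 2 E) with hM₂def
  have hrel := fun (c : ℂ) (i j : Fin 3) (S : (Fin 3 → ℤ) → Pol)
    (h : LocFinite (ratio i j) S) => var_sub_smul_invLin h c
  have hU' : U = invLin (q ^ 2)⁻¹ 0 2 (invLin (q ^ 2)⁻¹ 1 2 E) := by
    apply invLin_comm (hE 2) (hE 2) <;> simp [ratio_apply]
  have hY' : Y = invLin (q ^ 4) 2 0 (invLin (q ^ 4) 2 1 E) := by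
    apply invLin_comm (hE 1) (hE 0) <;> simp [ratio_apply]
  have hM₁' : M₁ = invLin (q ^ 2)⁻¹ 0 2 (invLin (q ^ 4) 2 1 E) := by
    apply invLin_comm (hE 1) (hE' 1 2) <;> simp [ratio_apply]
  have hM₂' : M₂ = invLin (q ^ 2)⁻¹ 1 2 (invLin (q ^ 4) 2 0 E) := by
    apply invLin_comm (hE 0) (hE' 0 2) <;> simp [ratio_apply]
  have hker : ((var 1 - var 0) * scal q⁻¹ ^ 4) • U + ((var 1 - var 0) * scal q ^ 2) • Y +
      ((scal q ^ 2 * var 1 - var 0) * scal q⁻¹ ^ 2) • M₁ +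
      ((var 1 - scal q ^ 2 * var 0) * scal q⁻¹ ^ 2) • M₂ = 0 := by
    apply exchange_kernel (t := var 2) (uz := invLin (q ^ 2)⁻¹ 0 2 E)
      (uw := invLin (q ^ 2)⁻¹ 1 2 E) (yz := invLin (q ^ 4) 2 0 E) (yw := invLin (q ^ 4) 2 1 E)
      (scal_mul_inv hq0)
    · rw [hU', ← scal_inv_sq]
      refine hrel _ _ _ _ (((hE 2).invLin ?_ _).locFinite ?_) <;> simp [ratio_apply]
    · rw [← scal_inv_sq]
      refine hrel _ _ _ _ (((hE 2).invLin ?_ _).locFinite ?_) <;> simp [ratio_apply]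
    · rw [hY', ← scal_pow]
      refine hrel _ _ _ _ (((hE 0).invLin ?_ _).locFinite ?_) <;> simp [ratio_apply]
    · rw [← scal_pow]
      refine hrel _ _ _ _ (((hE 1).invLin ?_ _).locFinite ?_) <;> simp [ratio_apply]
    · rw [hM₁', ← scal_inv_sq]
      refine hrel _ _ _ _ (((hE' 1 2).invLin ?_ _).locFinite ?_) <;> simp [ratio_apply]
    · rw [← scal_pow]
      refine hrel _ _ _ _ (((hE 1).invLin ?_ _).locFinite ?_) <;> simp [ratio_apply]
    · rw [hM₂', ← scal_inv_sq]
      refine hrel _ _ _ _ (((hE' 0 2).invLin ?_ _).locFinite ?_) <;> simp [ratio_apply]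
    · rw [← scal_pow]
      refine hrel _ _ _ _ (((hE 0).invLin ?_ _).locFinite ?_) <;> simp [ratio_apply]
  have hN₁ : (scal q⁻¹ ^ 3 * var 2 * varInv 0 * varInv 1) • prodWZ q r [1, 0, 2] 1 =
      (scal q⁻¹ ^ 3 * var 2) • U := by
    rw [← prod_phi_phi_cur_comm hq0 hq1 hr, prodZW,
      phi_phi_cur_one hq0 hq1 hr (by decide) (by decide) (by decide), smul_smul]
    refine congrArg (· • _) ?_
    linear_combination (scal q⁻¹ ^ 3 * var 2 * (var 1 * varInv 1)) * var_mul_varInv 0 +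
      (scal q⁻¹ ^ 3 * var 2) * var_mul_varInv 1
  have hP₁ : varInv 0 • prodZW q r [0, 2, 1] 1 = var 2 • M₁ := by
    rw [prodZW, phi_cur_phi_one' hq0 hq1 hr (by decide) (by decide) (by decide), smul_smul]
    refine congrArg (· • _) ?_
    linear_combination var 2 * var_mul_varInv 0
  have hP₂ : varInv 1 • prodWZ q r [1, 2, 0] 1 = var 2 • M₂ := by
    rw [prodWZ, phi_cur_phi_one' hq0 hq1 hr (by decide) (by decide) (by decide), smul_smul]
    refine congrArg (· • _) ?_
    linear_combination var 2 * var_mul_varInv 1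
  have hN₃ : varInv 2 • prodWZ q r [2, 1, 0] 1 = var 2 • Y := by
    rw [prodWZ, cur_phi_phi_one hq0 hq1 hr (by decide) (by decide) (by decide), smul_smul]
    refine congrArg (· • _) ?_
    linear_combination var 2 * var_mul_varInv 2
  rw [minusPlusZW, plusMinusWZ, minusPlusWZ, prod_phi_phi_cur_comm hq0 hq1 hr, hN₁,
    mul_smul _ (varInv 0), mul_smul _ (varInv 1), mul_smul _ (varInv 2), hP₁, hP₂, hN₃]
  have hAB := scal_mul_inv hq0
  have hAB2 : scal q ^ 2 * scal q⁻¹ ^ 2 = 1 := by rw [← mul_pow, hAB, one_pow]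
  have hAB3 : scal q ^ 3 * scal q⁻¹ ^ 4 = scal q ^ 2 * scal q⁻¹ ^ 3 := by
    linear_combination (scal q ^ 2 * scal q⁻¹ ^ 3) * hAB
  linear_combination (norm := module) (-(scal q ^ 3 * var 2)) • hker +
    hAB3 • (((var 1 - var 0) * var 2) • U) +
    hAB2 • ((scal q * var 2 * (scal q ^ 2 * var 1 - var 0)) • M₁) +
    hAB2 • ((scal q * var 2 * (var 1 - scal q ^ 2 * var 0)) • M₂)

/-- `exchange_delta` on the vacuum: as both sides have finitely many terms in the direction `w / z`,
the factor `q² w - z` in `exchange_cleared` can be cancelled. -/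
theorem exchange_delta_one :
    minusPlusZW q r 1 + scal q • (fun κ => doubleDelta q κ • (1 : Pol)) =
      mulDir ((C (q ^ 2) - X)⁻¹ * -(C (1 - q ^ 2) * X)) (ratio 1 0) (plusMinusWZ q r 1) +
        mulDir ((C (q ^ 2) - X)⁻¹ * ((1 - X) * C q)) (ratio 1 0) (minusPlusWZ q r 1) := by
  set g : ℂ⟦X⟧ := (C (q ^ 2) - X)⁻¹
  have hg : g * (C (q ^ 2) - X) = 1 :=
    PowerSeries.inv_mul_cancel _ (by simpa using pow_ne_zero 2 hq0)
  have hP := locFinite_plusMinusWZ q r 1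
  have hQ := locFinite_minusPlusWZ q r 1
  have hL := locFinite_minusPlusZW_add_delta hq0 hq1 hr
  have hX : ∀ {S : (Fin 3 → ℤ) → Pol}, LocFinite (ratio 1 0) S → ∀ a b : ℂ,
      mulDir (C a + C b * X) (ratio 1 0) S = (scal a + mono (ratio 1 0) b) • S := by
    intro S hS a b
    rw [mulDir_add_left hS, mulDir_C, mulDir_mul hS, mulDir_C, mulDir_X, add_smul]
    funext κ
    rw [Pi.add_apply, Pi.add_apply, scal, mono_smul_apply, mono_smul_apply, sub_zero]
    rfl
  -- Both sides are determined by their products with `q² - z/w`.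
  rw [mulDir_mul hP, mulDir_mul hQ, ← mulDir_add (hP.mulDir _) (hQ.mulDir _), ← mulDir_cancel hL hg]
  refine congrArg (mulDir g _) ?_
  have e1 : (C (q ^ 2) - X : ℂ⟦X⟧) = C (q ^ 2) + C (-1) * X := by
    rw [map_neg, map_one]; ring
  have e2 : (-(C (1 - q ^ 2) * X) : ℂ⟦X⟧) = C 0 + C (-(1 - q ^ 2)) * X := by
    rw [map_neg, map_zero]; ring
  have e3 : ((1 - X) * C q : ℂ⟦X⟧) = C q + C (-q) * X := by
    rw [map_neg]; ring
  rw [e1, e2, e3, hX hL, hX hP, hX hQ]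
  have hm : ∀ c : ℂ, mono (ratio 1 0) c = scal c * (var 0 * varInv 1) := fun c => by
    rw [← mono_ratio, scal_mul_mono]
  have hs : ∀ a b : ℂ, scal (a - b) = scal a - scal b := fun a b => by
    rw [scal, scal, scal, mono, mono, mono, map_sub, AddMonoidAlgebra.single_sub]
  have h0 : scal 0 = 0 := by rw [← sub_self (0 : ℂ), hs, sub_self]
  have hn : ∀ a : ℂ, scal (-a) = -scal a := fun a => by rw [← zero_sub, hs, h0, zero_sub]
  have h1 : scal 1 = 1 := mono_zero_one
  rw [hm, hm, hm, hn, hn, hn, hs, h0, h1, scal_pow]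
  have hv := var_mul_varInv 1
  linear_combination (norm := module) varInv 1 • exchange_cleared hq0 hq1 hr +
    (scal q * varInv 1) • smul_doubleDelta hq0 +
    hv • (-(scal q ^ 2) • (minusPlusZW q r 1 + scal q • (fun κ => doubleDelta q κ • (1 : Pol))) +
      scal q • minusPlusWZ q r 1)

/-- The exchange relation of `Φ_-(z)` and `Φ_+(w)`, with the delta function term. -/
theorem exchange_delta (v : Pol) :
    minusPlusZW q r v + scal q • (fun κ => doubleDelta q κ • v) =
      mulDir ((C (q ^ 2) - X)⁻¹ * -(C (1 - q ^ 2) * X)) (ratio 1 0) (plusMinusWZ q r v) +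
        mulDir ((C (q ^ 2) - X)⁻¹ * ((1 - X) * C q)) (ratio 1 0) (minusPlusWZ q r v) := by
  have h := congrArg (twoPhiDressing q r v • ·) (exchange_delta_one hq0 hq1 hr)
  simp only [smul_add] at h
  rw [← minusPlusZW_eq_dressing_smul, smul_comm, dressing_smul_doubleDelta hq0 hq1 hr,
    ← mulDir_laurent_smul (locFinite_plusMinusWZ q r 1),
    ← mulDir_laurent_smul (locFinite_minusPlusWZ q r 1), ← plusMinusWZ_eq_dressing_smul,
    ← minusPlusWZ_eq_dressing_smul] at h
  exact h

end ExchangeRelations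

/-! ### Multiplication of Fock space series by power series in `z / w` and `w / z` -/

section FockSeries

/-- A series in `z^{1/2}`, `w^{1/2}` as a function on its exponent lattice. -/
def uncurried (S : Series) (κ : ℤ × ℤ) : Fock := S κ.1 κ.2

/-- Multiplication by power series in `z / w` is meaningful. -/
abbrev FiniteZW (S : Series) : Prop := LocFinite ((2, -2) : ℤ × ℤ) (uncurried S)

/-- Multiplication by power series in `w / z` is meaningful. -/
abbrev FiniteWZ (S : Series) : Prop := LocFinite ((-2, 2) : ℤ × ℤ) (uncurried S)

theorem mulZW_apply (f : ℂ⟦X⟧) (S : Series) (k l : ℤ) :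
    mulZW f S k l = mulDir f ((2, -2) : ℤ × ℤ) (uncurried S) (k, l) := by
  rw [mulZW, mulDir]
  refine finsum_congr fun n => ?_
  simp [uncurried, mul_comm]

theorem mulWZ_apply (f : ℂ⟦X⟧) (S : Series) (k l : ℤ) :
    mulWZ f S k l = mulDir f ((-2, 2) : ℤ × ℤ) (uncurried S) (k, l) := by
  rw [mulWZ, mulDir]
  refine finsum_congr fun n => ?_
  simp [uncurried, mul_comm]

theorem mulZW_add {S T : Series} (hS : FiniteZW S) (hT : FiniteZW T) (f : ℂ⟦X⟧) :
    mulZW f (S + T) = mulZW f S + mulZW f T := by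
  funext k l
  rw [mulZW_apply, Pi.add_apply, Pi.add_apply, mulZW_apply, mulZW_apply, ← Pi.add_apply,
    ← mulDir_add hS hT]
  rfl

theorem mulWZ_add {S T : Series} (hS : FiniteWZ S) (hT : FiniteWZ T) (f : ℂ⟦X⟧) :
    mulWZ f (S + T) = mulWZ f S + mulWZ f T := by
  funext k l
  rw [mulWZ_apply, Pi.add_apply, Pi.add_apply, mulWZ_apply, mulWZ_apply, ← Pi.add_apply,
    ← mulDir_add hS hT]
  rfl

theorem mulZW_smul (c : ℂ) (f : ℂ⟦X⟧) (S : Series) : mulZW f (c • S) = c • mulZW f S := by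
  funext k l
  rw [mulZW_apply, Pi.smul_apply, Pi.smul_apply, mulZW_apply, ← Pi.smul_apply, ← mulDir_smul]
  rfl

theorem mulWZ_smul (c : ℂ) (f : ℂ⟦X⟧) (S : Series) : mulWZ f (c • S) = c • mulWZ f S := by
  funext k l
  rw [mulWZ_apply, Pi.smul_apply, Pi.smul_apply, mulWZ_apply, ← Pi.smul_apply, ← mulDir_smul]
  rfl

theorem mulZW_add_left {S : Series} (hS : FiniteZW S) (f g : ℂ⟦X⟧) :
    mulZW (f + g) S = mulZW f S + mulZW g S := by
  funext k l
  rw [mulZW_apply, Pi.add_apply, Pi.add_apply, mulZW_apply, mulZW_apply, ← Pi.add_apply,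
    ← mulDir_add_left hS]

theorem mulZW_mul {S : Series} (hS : FiniteZW S) (f g : ℂ⟦X⟧) :
    mulZW (f * g) S = mulZW f (mulZW g S) := by
  funext k l
  rw [mulZW_apply, mulDir_mul hS, mulZW_apply]
  refine congrFun (congrArg (mulDir f _) ?_) _
  funext κ
  exact (mulZW_apply g S κ.1 κ.2).symm

theorem mulZW_one (S : Series) : mulZW 1 S = S := by
  funext k l
  rw [mulZW_apply, mulDir_one]
  rfl

theorem mulZW_zero_left (S : Series) : mulZW 0 S = 0 := by
  funext k l
  simp [mulZW]

theorem mulZW_C (c : ℂ) (S : Series) : mulZW (C c) S = c • S := by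
  funext k l
  rw [mulZW_apply, mulDir_C]
  rfl

theorem map_mulZW (T : Module.End ℂ Fock) {S : Series} (hS : FiniteZW S) (f : ℂ⟦X⟧) :
    (fun k l => T (mulZW f S k l)) = mulZW f fun k l => T (S k l) := by
  funext k l
  rw [mulZW_apply, map_mulDir T hS, mulZW_apply]
  rfl

theorem map_mulWZ (T : Module.End ℂ Fock) {S : Series} (hS : FiniteWZ S) (f : ℂ⟦X⟧) :
    (fun k l => T (mulWZ f S k l)) = mulWZ f fun k l => T (S k l) := by
  funext k l
  rw [mulWZ_apply, map_mulDir T hS, mulWZ_apply]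
  rfl

theorem mulMonomial_mulZW (a b : ℤ) (f : ℂ⟦X⟧) (S : Series) :
    mulMonomial a b (mulZW f S) = mulZW f (mulMonomial a b S) := by
  funext k l
  refine finsum_congr fun n => ?_
  rw [mulMonomial, sub_right_comm, sub_add_eq_add_sub]

theorem mulMonomial_mulWZ (a b : ℤ) (f : ℂ⟦X⟧) (S : Series) :
    mulMonomial a b (mulWZ f S) = mulWZ f (mulMonomial a b S) := by
  funext k l
  refine finsum_congr fun n => ?_
  rw [mulMonomial, sub_right_comm, sub_add_eq_add_sub]

theorem FiniteZW.mulMonomial {S : Series} (h : FiniteZW S) (a b : ℤ) :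
    FiniteZW (mulMonomial a b S) := by
  intro κ
  obtain ⟨N, hN⟩ := h (κ - (a, b))
  refine ⟨N, fun n hn => ?_⟩
  have := hN n hn
  rwa [sub_right_comm] at this

theorem FiniteWZ.mulMonomial {S : Series} (h : FiniteWZ S) (a b : ℤ) :
    FiniteWZ (mulMonomial a b S) := by
  intro κ
  obtain ⟨N, hN⟩ := h (κ - (a, b))
  refine ⟨N, fun n hn => ?_⟩
  have := hN n hn
  rwa [sub_right_comm] at this

theorem FiniteZW.mulZW {S : Series} (h : FiniteZW S) (f : ℂ⟦X⟧) : FiniteZW (mulZW f S) := by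
  intro κ
  obtain ⟨N, hN⟩ := h κ
  refine ⟨N, fun n hn => ?_⟩
  rw [uncurried, mulZW_apply]
  refine finsum_eq_zero_of_forall_eq_zero fun m => ?_
  rw [Prod.mk.eta, sub_sub, ← add_smul, hN _ (by omega), smul_zero]

/-- The Fock space series `∑ S(a, b, m) ⊗ e_{m'} z^{m/2 + a} w^{m/2 + b}` cut out of a distribution
by fixing the third exponent. -/
def slice (m m' : ℤ) (S : (Fin 3 → ℤ) → Pol) : Series := fun k l =>
  if Even (k - m) ∧ Even (l - m) then Finsupp.single m' (S ![(k - m) / 2, (l - m) / 2, m]) else 0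

theorem slice_apply (m m' : ℤ) (S : (Fin 3 → ℤ) → Pol) (a b : ℤ) :
    slice m m' S (m + 2 * a) (m + 2 * b) = Finsupp.single m' (S ![a, b, m]) := by
  rw [slice, add_sub_cancel_left, add_sub_cancel_left, if_pos (by simp),
    Int.mul_ediv_cancel_left _ two_ne_zero, Int.mul_ediv_cancel_left _ two_ne_zero]

theorem slice_of_not {m : ℤ} (m' : ℤ) (S : (Fin 3 → ℤ) → Pol) {k l : ℤ}
    (h : ¬(Even (k - m) ∧ Even (l - m))) : slice m m' S k l = 0 := if_neg h

theorem eq_smul_slice {m m' : ℤ} {F : Series} {S : (Fin 3 → ℤ) → Pol} {c : ℂ}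
    (h : ∀ a b, F (m + 2 * a) (m + 2 * b) = c • Finsupp.single m' (S ![a, b, m]))
    (h' : ∀ k l, ¬(Even (k - m) ∧ Even (l - m)) → F k l = 0) : F = c • slice m m' S := by
  funext k l
  by_cases hkl : Even (k - m) ∧ Even (l - m)
  · obtain ⟨⟨a, ha⟩, ⟨b, hb⟩⟩ := hkl
    obtain rfl : k = m + 2 * a := by omega
    obtain rfl : l = m + 2 * b := by omega
    rw [h, Pi.smul_apply, Pi.smul_apply, slice_apply]
  · rw [h' k l hkl, Pi.smul_apply, Pi.smul_apply, slice_of_not _ _ hkl, smul_zero]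

theorem mulZW_slice {S : (Fin 3 → ℤ) → Pol} (hS : LocFinite (ratio 1 0) S) (f : ℂ⟦X⟧)
    (m m' : ℤ) : mulZW f (slice m m' S) = slice m m' (mulDir f (ratio 1 0) S) := by
  rw [← one_smul ℂ (slice m m' (mulDir f (ratio 1 0) S))]
  refine eq_smul_slice (fun a b => ?_) fun k l hkl => ?_
  · rw [one_smul, ← Finsupp.lsingle_apply (R := ℂ), map_mulDir _ hS]
    refine finsum_congr fun n => ?_
    have e1 : m + 2 * a - 2 * (n : ℤ) = m + 2 * (a - n) := by ring
    have e2 : m + 2 * b + 2 * (n : ℤ) = m + 2 * (b + n) := by ring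
    rw [e1, e2, slice_apply]
    simp only [Finsupp.lsingle_apply]
    congr 3
    funext x
    fin_cases x <;> simp [ratio_apply]
  · refine finsum_eq_zero_of_forall_eq_zero fun n => ?_
    rw [slice_of_not, smul_zero]
    rintro ⟨⟨a, ha⟩, ⟨b, hb⟩⟩
    exact hkl ⟨⟨a + n, by omega⟩, ⟨b - n, by omega⟩⟩

theorem mulWZ_slice {S : (Fin 3 → ℤ) → Pol} (hS : LocFinite (ratio 0 1) S) (f : ℂ⟦X⟧)
    (m m' : ℤ) : mulWZ f (slice m m' S) = slice m m' (mulDir f (ratio 0 1) S) := by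
  rw [← one_smul ℂ (slice m m' (mulDir f (ratio 0 1) S))]
  refine eq_smul_slice (fun a b => ?_) fun k l hkl => ?_
  · rw [one_smul, ← Finsupp.lsingle_apply (R := ℂ), map_mulDir _ hS]
    refine finsum_congr fun n => ?_
    have e1 : m + 2 * a + 2 * (n : ℤ) = m + 2 * (a + n) := by ring
    have e2 : m + 2 * b - 2 * (n : ℤ) = m + 2 * (b - n) := by ring
    rw [e1, e2, slice_apply]
    simp only [Finsupp.lsingle_apply]
    congr 3
    funext x
    fin_cases x <;> simp [ratio_apply]
  · refine finsum_eq_zero_of_forall_eq_zero fun n => ?_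
    rw [slice_of_not, smul_zero]
    rintro ⟨⟨a, ha⟩, ⟨b, hb⟩⟩
    exact hkl ⟨⟨a - n, by omega⟩, ⟨b + n, by omega⟩⟩

theorem slice_add (m m' : ℤ) (S T : (Fin 3 → ℤ) → Pol) :
    slice m m' (S + T) = slice m m' S + slice m m' T := by
  funext k l
  rw [Pi.add_apply, Pi.add_apply, slice, slice, slice]
  split_ifs
  · rw [Pi.add_apply, Finsupp.single_add]
  · rw [add_zero]

theorem slice_scal_smul (m m' : ℤ) (c : ℂ) (S : (Fin 3 → ℤ) → Pol) :
    slice m m' (scal c • S) = c • slice m m' S := by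
  funext k l
  rw [Pi.smul_apply, Pi.smul_apply, slice, slice]
  split_ifs
  · rw [scal, mono_smul_apply, sub_zero, Finsupp.smul_single]
  · rw [smul_zero]

end FockSeries

/-! ### The modes on the Fock space -/

section Modes

variable (q r s : ℂ)

theorem xMinus_single (m : ℤ) (f : Pol) :
    xMinus q r 0 (Finsupp.single m f) = Finsupp.single (m - 2) (curMode q r (m - 1) f) := by
  rw [xMinus, Finsupp.lsum_single, LinearMap.comp_apply, Finsupp.lsingle_apply,
    show (-0 - 1 + m : ℤ) = m - 1 by ring]
  rfl

theorem phiMinus_single (m p : ℤ) (f : Pol) :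
    phiMinus q r s (m + 2 * p) (Finsupp.single m f) =
      (q * s) ^ m • Finsupp.single (m + 1) (phiMode q r p f) := by
  rw [phiMinus, Finsupp.lsum_single, add_sub_cancel_left, if_pos (by simp), LinearMap.smul_apply,
    LinearMap.comp_apply, Finsupp.lsingle_apply, Int.mul_ediv_cancel_left _ two_ne_zero]
  rfl

theorem phiMinus_single_of_odd {k m : ℤ} (h : ¬Even (k - m)) (f : Pol) :
    phiMinus q r s k (Finsupp.single m f) = 0 := by
  rw [phiMinus, Finsupp.lsum_single, if_neg h, LinearMap.zero_apply]

theorem phiPlus_single_of_odd {k m : ℤ} (h : ¬Even (k - m)) (f : Pol) :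
    phiPlus q r s k (Finsupp.single m f) = 0 := by
  rw [phiPlus, LinearMap.sub_apply, LinearMap.smul_apply, Module.End.mul_apply,
    Module.End.mul_apply, phiMinus_single_of_odd q r s h, xMinus_single,
    phiMinus_single_of_odd, map_zero, smul_zero, sub_zero]
  rwa [show k - (m - 2) = k - m + 2 by ring, Int.even_add, iff_true_right even_two]

theorem phiPlus_single (hs0 : q * s ≠ 0) (hs : (q * s) ^ 2 = -q ^ 3) (m p : ℤ) (f : Pol) :
    phiPlus q r s (m + 2 * p) (Finsupp.single m f) = (q * s) ^ m • Finsupp.single (m - 1)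
      (-(q⁻¹ ^ 3) • phiMode q r (p + 1) (curMode q r (m - 1) f) -
        q • curMode q r m (phiMode q r p f)) := by
  have h2 : (q * s) ^ (m - 2) = -(q * s) ^ m * q⁻¹ ^ 3 := by
    rw [zpow_sub₀ hs0, zpow_ofNat, hs, inv_pow]
    ring
  rw [phiPlus, LinearMap.sub_apply, LinearMap.smul_apply, Module.End.mul_apply,
    Module.End.mul_apply, phiMinus_single, xMinus_single, map_smul, xMinus_single,
    show m + 2 * p = m - 2 + 2 * (p + 1) by ring, phiMinus_single, h2, Finsupp.single_sub,
    ← Finsupp.smul_single, ← Finsupp.smul_single, show m - 2 + 1 = m - 1 by ring,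
    show m + 1 - 2 = m - 1 by ring, show m + 1 - 1 = m by ring]
  module

theorem phi_single_of_odd (ε : Sgn) {k m : ℤ} (h : ¬Even (k - m)) (f : Pol) :
    phi q r s ε k (Finsupp.single m f) = 0 := by
  cases ε
  · exact phiPlus_single_of_odd q r s h f
  · exact phiMinus_single_of_odd q r s h f

end Modes

/-! ### Products of two vertex operators on the Fock space -/

section TwoPoint

/-- `t_i^{-1/2} Φ_-(t_i) Φ_+(t_j)` as a combination of products of two `Φ_-` and one current, where
`{i, j} = {0, 1}`, with the normalisation of `minusPlusZW`. -/
def mixedRight (q r : ℂ) (i j : Fin 3) (v : Pol) : (Fin 3 → ℤ) → Pol :=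
  -((scal q⁻¹ ^ 3 * var 2 * varInv 0 * varInv 1) • twoPhiOp q r [i, j, 2] v) -
    (scal q * varInv i) • twoPhiOp q r [i, 2, j] v

/-- `t_i^{-1/2} Φ_+(t_i) Φ_-(t_j)` as a combination of products of two `Φ_-` and one current, where
`{i, j} = {0, 1}`, with the normalisation of `minusPlusZW`. -/
def mixedLeft (q r : ℂ) (i j : Fin 3) (v : Pol) : (Fin 3 → ℤ) → Pol :=
  varInv i • twoPhiOp q r [i, 2, j] v + (scal q ^ 4 * varInv 2) • twoPhiOp q r [2, i, j] v

theorem mixedRight_eq_add (q r : ℂ) (i j : Fin 3) (v : Pol) : mixedRight q r i j v =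
    (-(scal q⁻¹ ^ 3 * var 2 * varInv 0 * varInv 1)) • twoPhiOp q r [i, j, 2] v +
      (-(scal q * varInv i)) • twoPhiOp q r [i, 2, j] v := by
  rw [mixedRight]
  module

theorem locFinite_mixedRight_zw (q r : ℂ) (v : Pol) :
    LocFinite (ratio 0 1) (mixedRight q r 0 1 v) := by
  rw [mixedRight_eq_add]
  exact ((locFinite_zwx q r v).laurent_smul _).add ((locFinite_zxw q r v).laurent_smul _)

theorem locFinite_mixedRight_wz (q r : ℂ) (v : Pol) :
    LocFinite (ratio 1 0) (mixedRight q r 1 0 v) := by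
  rw [mixedRight_eq_add]
  exact ((locFinite_wzx q r v).laurent_smul _).add ((locFinite_wxz q r v).laurent_smul _)

theorem locFinite_mixedLeft_zw (q r : ℂ) (v : Pol) :
    LocFinite (ratio 0 1) (mixedLeft q r 0 1 v) :=
  ((locFinite_zxw q r v).laurent_smul _).add ((locFinite_xzw q r v).laurent_smul _)

theorem locFinite_mixedLeft_wz (q r : ℂ) (v : Pol) :
    LocFinite (ratio 1 0) (mixedLeft q r 1 0 v) :=
  ((locFinite_wxz q r v).laurent_smul _).add ((locFinite_xwz q r v).laurent_smul _)

theorem mulDir_mixedRight_zw (q r : ℂ) (v : Pol) :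
    mulDir (alphaPhi q) (ratio 0 1) (mixedRight q r 0 1 v) = minusPlusZW q r v := by
  rw [mixedRight_eq_add, mulDir_add ((locFinite_zwx q r v).laurent_smul _)
    ((locFinite_zxw q r v).laurent_smul _), mulDir_laurent_smul (locFinite_zwx q r v),
    mulDir_laurent_smul (locFinite_zxw q r v), minusPlusZW, prodZW, prodZW]
  module

theorem mulDir_mixedRight_wz (q r : ℂ) (v : Pol) :
    mulDir (alphaPhi q) (ratio 1 0) (mixedRight q r 1 0 v) = plusMinusWZ q r v := by
  rw [mixedRight_eq_add, mulDir_add ((locFinite_wzx q r v).laurent_smul _)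
    ((locFinite_wxz q r v).laurent_smul _), mulDir_laurent_smul (locFinite_wzx q r v),
    mulDir_laurent_smul (locFinite_wxz q r v), plusMinusWZ, prodWZ, prodWZ]
  module

theorem mulDir_mixedLeft_zw (q r : ℂ) (v : Pol) :
    mulDir (alphaPhi q) (ratio 0 1) (mixedLeft q r 0 1 v) = plusMinusZW q r v := by
  rw [mixedLeft, mulDir_add ((locFinite_zxw q r v).laurent_smul _)
    ((locFinite_xzw q r v).laurent_smul _), mulDir_laurent_smul (locFinite_zxw q r v),
    mulDir_laurent_smul (locFinite_xzw q r v), plusMinusZW, prodZW, prodZW]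

theorem mulDir_mixedLeft_wz (q r : ℂ) (v : Pol) :
    mulDir (alphaPhi q) (ratio 1 0) (mixedLeft q r 1 0 v) = minusPlusWZ q r v := by
  rw [mixedLeft, mulDir_add ((locFinite_wxz q r v).laurent_smul _)
    ((locFinite_xwz q r v).laurent_smul _), mulDir_laurent_smul (locFinite_wxz q r v),
    mulDir_laurent_smul (locFinite_xwz q r v), minusPlusWZ, prodWZ, prodWZ]

theorem mixedRight_apply (q r : ℂ) {i j : Fin 3} (hi : i ≠ 2) (hj : j ≠ 2) (hij : i ≠ j) (v : Pol)
    (κ : Fin 3 → ℤ) : mixedRight q r i j v κ =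
      -(q⁻¹ ^ 3) • phiMode q r (κ i + 1) (phiMode q r (κ j + 1) (curMode q r (κ 2 - 1) v)) -
        q • phiMode q r (κ i + 1) (curMode q r (κ 2) (phiMode q r (κ j) v)) := by
  have h01 : (i = 0 ∧ j = 1) ∨ (i = 1 ∧ j = 0) := by
    revert i j
    decide
  have e1 : scal q⁻¹ ^ 3 * var 2 * varInv 0 * varInv 1 =
      mono (Pi.single 2 1 - Pi.single 0 1 - Pi.single 1 1) (q⁻¹ ^ 3) := by
    rw [← scal_pow, scal, var, varInv, varInv, mono_mul, mono_mul, mono_mul, zero_add, mul_one,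
      mul_one, mul_one, sub_eq_add_neg, sub_eq_add_neg]
  have e2 : scal q * varInv i = mono (-Pi.single i 1) q := by
    rw [varInv, scal_mul_mono]
  rw [mixedRight, e1, e2, Pi.sub_apply, Pi.neg_apply, mono_smul_apply, mono_smul_apply, neg_smul]
  simp only [twoPhiOp, opProduct, twoPhi_two, twoPhi_ne _ _ hi, twoPhi_ne _ _ hj]
  rcases h01 with ⟨rfl, rfl⟩ | ⟨rfl, rfl⟩ <;> simp

theorem mixedLeft_apply (q r : ℂ) {i j : Fin 3} (hi : i ≠ 2) (hj : j ≠ 2) (hij : i ≠ j) (v : Pol)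
    (κ : Fin 3 → ℤ) : mixedLeft q r i j v κ =
      phiMode q r (κ i + 1) (curMode q r (κ 2) (phiMode q r (κ j) v)) +
        q ^ 4 • curMode q r (κ 2 + 1) (phiMode q r (κ i) (phiMode q r (κ j) v)) := by
  have e1 : scal q ^ 4 * varInv 2 = mono (-Pi.single 2 1) (q ^ 4) := by
    rw [← scal_pow, varInv, scal_mul_mono]
  rw [mixedLeft, e1, varInv, Pi.add_apply, mono_smul_apply, mono_smul_apply, one_smul]
  simp only [twoPhiOp, opProduct, twoPhi_two, twoPhi_ne _ _ hi, twoPhi_ne _ _ hj]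
  simp [hi, hj, hij.symm, hi.symm]

variable {q r s : ℂ}

theorem phiMinus_phiMinus_single (hs0 : q * s ≠ 0) (m a b : ℤ) (f : Pol) :
    phiMinus q r s (m + 2 * a + 1) (phiMinus q r s (m + 2 * b) (Finsupp.single m f)) =
      (q * s) ^ (2 * m + 1) • Finsupp.single (m + 2) (phiMode q r a (phiMode q r b f)) := by
  rw [phiMinus_single, map_smul, show m + 2 * a + 1 = m + 1 + 2 * a by ring, phiMinus_single,
    smul_smul, ← zpow_add₀ hs0, show m + (m + 1) = 2 * m + 1 by ring, add_assoc]
  rfl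

section Single

variable (hs0 : q * s ≠ 0) (hs : (q * s) ^ 2 = -q ^ 3)

include hs0 hs

theorem phiMinus_phiPlus_single (m a b : ℤ) (f : Pol) :
    phiMinus q r s (m + 2 * a + 1) (phiPlus q r s (m + 2 * b) (Finsupp.single m f)) =
      (q * s) ^ (2 * m - 1) • Finsupp.single m
        (-(q⁻¹ ^ 3) • phiMode q r (a + 1) (phiMode q r (b + 1) (curMode q r (m - 1) f)) -
          q • phiMode q r (a + 1) (curMode q r m (phiMode q r b f))) := by
  rw [phiPlus_single _ _ _ hs0 hs, map_smul, show m + 2 * a + 1 = m - 1 + 2 * (a + 1) by ring,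
    phiMinus_single, smul_smul, ← zpow_add₀ hs0, sub_add_cancel, map_sub, map_smul, map_smul,
    show m + (m - 1) = 2 * m - 1 by ring]

theorem phiPlus_phiMinus_single (hq0 : q ≠ 0) (m a b : ℤ) (f : Pol) :
    phiPlus q r s (m + 2 * a + 1) (phiMinus q r s (m + 2 * b) (Finsupp.single m f)) =
      (q * s) ^ (2 * m - 1) • Finsupp.single m
        (phiMode q r (a + 1) (curMode q r m (phiMode q r b f)) +
          q ^ 4 • curMode q r (m + 1) (phiMode q r a (phiMode q r b f))) := by
  have h : (q * s) ^ (2 * m + 1) = (q * s) ^ (2 * m - 1) * -q ^ 3 := by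
    rw [← hs, ← zpow_natCast, ← zpow_add₀ hs0]
    congr 1
    push_cast
    ring
  rw [phiMinus_single, map_smul, show m + 2 * a + 1 = m + 1 + 2 * a by ring,
    phiPlus_single _ _ _ hs0 hs, smul_smul, ← zpow_add₀ hs0, show m + (m + 1) = 2 * m + 1 by ring,
    h, add_sub_cancel_right, mul_smul, Finsupp.smul_single]
  refine congrArg (_ • ·) (congrArg _ ?_)
  have h3 : q ^ 3 * q⁻¹ ^ 3 = 1 := by rw [← mul_pow, mul_inv_cancel₀ hq0, one_pow]
  linear_combination (norm := module) h3 • phiMode q r (a + 1) (curMode q r m (phiMode q r b f))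

theorem phi_phi_single_of_odd (ε ε' : Sgn) {m k l : ℤ} (h : ¬(Even (k - m) ∧ Even (l - m)))
    (f : Pol) : phi q r s ε (k + 1) (phi q r s ε' l (Finsupp.single m f)) = 0 := by
  by_cases hl : Even (l - m)
  · have hk : ¬Even (k - m) := fun hk => h ⟨hk, hl⟩
    obtain ⟨b, hb⟩ := hl
    obtain rfl : l = m + 2 * b := by omega
    cases ε'
    · rw [phi, phiPlus_single _ _ _ hs0 hs, map_smul, phi_single_of_odd, smul_zero]
      rwa [show k + 1 - (m - 1) = k - m + 2 by ring, Int.even_add, iff_true_right even_two]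
    · rw [phi, phiMinus_single, map_smul, phi_single_of_odd, smul_zero]
      rwa [add_sub_add_right_eq_sub]
  · rw [phi_single_of_odd _ _ _ _ hl, map_zero]

end Single

theorem finiteWZ_phiZphiW (q r s : ℂ) (v : Fock) (ε : Sgn × Sgn) :
    FiniteWZ (phiZphiW q r s v ε) := by
  rintro ⟨k, l⟩
  obtain ⟨N, hN⟩ := phi_bounded_below q r s ε.2 v
  refine ⟨(l - N).toNat + 1, fun n hn => ?_⟩
  simp only [uncurried, phiZphiW]
  rw [hN, map_zero]
  simp
  omega

theorem finiteZW_phiWphiZ (q r s : ℂ) (v : Fock) (ε : Sgn × Sgn) :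
    FiniteZW (phiWphiZ q r s v ε) := by
  rintro ⟨k, l⟩
  obtain ⟨N, hN⟩ := phi_bounded_below q r s ε.1 v
  refine ⟨(k - N).toNat + 1, fun n hn => ?_⟩
  simp only [uncurried, phiWphiZ]
  rw [hN, map_zero]
  simp
  omega

/-- `z^{-1/2} α_φ(w/z) Φ_{ε₁}(z) Φ_{ε₂}(w) v`. -/
def fockZW (q r s : ℂ) (ε : Sgn × Sgn) (v : Fock) : Series :=
  mulWZ (alphaPhi q) (mulMonomial (-1) 0 (phiZphiW q r s v ε))

/-- `w^{-1/2} α_φ(z/w) Φ_{ε₂}(w) Φ_{ε₁}(z) v`. -/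
def fockWZ (q r s : ℂ) (ε : Sgn × Sgn) (v : Fock) : Series :=
  mulZW (alphaPhi q) (mulMonomial 0 (-1) (phiWphiZ q r s v ε))

theorem finiteZW_fockWZ (q r s : ℂ) (ε : Sgn × Sgn) (v : Fock) : FiniteZW (fockWZ q r s ε v) :=
  ((finiteZW_phiWphiZ q r s v ε).mulMonomial _ _).mulZW _

theorem fockZW_add (q r s : ℂ) (ε : Sgn × Sgn) (u v : Fock) :
    fockZW q r s ε (u + v) = fockZW q r s ε u + fockZW q r s ε v := by
  rw [fockZW, fockZW, fockZW, ← mulWZ_add ((finiteWZ_phiZphiW q r s u ε).mulMonomial _ _)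
    ((finiteWZ_phiZphiW q r s v ε).mulMonomial _ _)]
  refine congrArg (mulWZ _) ?_
  funext k l
  simp [mulMonomial, phiZphiW]

theorem fockWZ_add (q r s : ℂ) (ε : Sgn × Sgn) (u v : Fock) :
    fockWZ q r s ε (u + v) = fockWZ q r s ε u + fockWZ q r s ε v := by
  rw [fockWZ, fockWZ, fockWZ, ← mulZW_add ((finiteZW_phiWphiZ q r s u ε).mulMonomial _ _)
    ((finiteZW_phiWphiZ q r s v ε).mulMonomial _ _)]
  refine congrArg (mulZW _) ?_
  funext k l
  simp [mulMonomial, phiWphiZ]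

theorem fockZW_zero (q r s : ℂ) (ε : Sgn × Sgn) : fockZW q r s ε 0 = 0 := by
  have h := fockZW_add q r s ε 0 0
  rwa [add_zero, left_eq_add] at h

theorem fockWZ_zero (q r s : ℂ) (ε : Sgn × Sgn) : fockWZ q r s ε 0 = 0 := by
  have h := fockWZ_add q r s ε 0 0
  rwa [add_zero, left_eq_add] at h

section SingleSeries

variable (hq0 : q ≠ 0) (hs0 : q * s ≠ 0) (hs : (q * s) ^ 2 = -q ^ 3)

include hs0 hs

theorem fockZW_minus_minus (m : ℤ) (f : Pol) :
    fockZW q r s (.minus, .minus) (Finsupp.single m f) =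
      (q * s) ^ (2 * m + 1) • slice m (m + 2) (prodZW q r [0, 1] f) := by
  rw [prodZW, ← mulWZ_slice ((opProduct_cons_locFinite_self q _ _ (by decide) (by simp) (by simp)
    f).opProduct_cons _ _ _ _), ← mulWZ_smul, fockZW]
  refine congrArg (mulWZ _) (eq_smul_slice (fun a b => ?_) fun k l hkl => ?_) <;>
    rw [mulMonomial, sub_neg_eq_add, sub_zero, phiZphiW]
  · exact phiMinus_phiMinus_single hs0 m a b f
  · exact phi_phi_single_of_odd hs0 hs _ _ hkl f

theorem fockWZ_minus_minus (m : ℤ) (f : Pol) :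
    fockWZ q r s (.minus, .minus) (Finsupp.single m f) =
      (q * s) ^ (2 * m + 1) • slice m (m + 2) (prodWZ q r [1, 0] f) := by
  rw [prodWZ, ← mulZW_slice ((opProduct_cons_locFinite_self q _ _ (by decide) (by simp) (by simp)
    f).opProduct_cons _ _ _ _), ← mulZW_smul, fockWZ]
  refine congrArg (mulZW _) (eq_smul_slice (fun a b => ?_) fun k l hkl => ?_) <;>
    rw [mulMonomial, sub_neg_eq_add, sub_zero, phiWphiZ]
  · exact phiMinus_phiMinus_single hs0 m b a f
  · exact phi_phi_single_of_odd hs0 hs _ _ (fun h => hkl h.symm) f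

theorem fockZW_minus_plus (m : ℤ) (f : Pol) :
    fockZW q r s (.minus, .plus) (Finsupp.single m f) =
      (q * s) ^ (2 * m - 1) • slice m m (minusPlusZW q r f) := by
  rw [← mulDir_mixedRight_zw, ← mulWZ_slice (locFinite_mixedRight_zw q r f), ← mulWZ_smul, fockZW]
  refine congrArg (mulWZ _) (eq_smul_slice (fun a b => ?_) fun k l hkl => ?_) <;>
    rw [mulMonomial, sub_neg_eq_add, sub_zero, phiZphiW]
  · rw [mixedRight_apply _ _ (by decide) (by decide) (by decide)]
    exact phiMinus_phiPlus_single hs0 hs m a b f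
  · exact phi_phi_single_of_odd hs0 hs _ _ hkl f

theorem fockWZ_plus_minus (m : ℤ) (f : Pol) :
    fockWZ q r s (.plus, .minus) (Finsupp.single m f) =
      (q * s) ^ (2 * m - 1) • slice m m (plusMinusWZ q r f) := by
  rw [← mulDir_mixedRight_wz, ← mulZW_slice (locFinite_mixedRight_wz q r f), ← mulZW_smul, fockWZ]
  refine congrArg (mulZW _) (eq_smul_slice (fun a b => ?_) fun k l hkl => ?_) <;>
    rw [mulMonomial, sub_neg_eq_add, sub_zero, phiWphiZ]
  · rw [mixedRight_apply _ _ (by decide) (by decide) (by decide)]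
    exact phiMinus_phiPlus_single hs0 hs m b a f
  · exact phi_phi_single_of_odd hs0 hs _ _ (fun h => hkl h.symm) f

include hq0

theorem fockZW_plus_minus (m : ℤ) (f : Pol) :
    fockZW q r s (.plus, .minus) (Finsupp.single m f) =
      (q * s) ^ (2 * m - 1) • slice m m (plusMinusZW q r f) := by
  rw [← mulDir_mixedLeft_zw, ← mulWZ_slice (locFinite_mixedLeft_zw q r f), ← mulWZ_smul, fockZW]
  refine congrArg (mulWZ _) (eq_smul_slice (fun a b => ?_) fun k l hkl => ?_) <;>
    rw [mulMonomial, sub_neg_eq_add, sub_zero, phiZphiW]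
  · rw [mixedLeft_apply _ _ (by decide) (by decide) (by decide)]
    exact phiPlus_phiMinus_single hs0 hs hq0 m a b f
  · exact phi_phi_single_of_odd hs0 hs _ _ hkl f

theorem fockWZ_minus_plus (m : ℤ) (f : Pol) :
    fockWZ q r s (.minus, .plus) (Finsupp.single m f) =
      (q * s) ^ (2 * m - 1) • slice m m (minusPlusWZ q r f) := by
  rw [← mulDir_mixedLeft_wz, ← mulZW_slice (locFinite_mixedLeft_wz q r f), ← mulZW_smul, fockWZ]
  refine congrArg (mulZW _) (eq_smul_slice (fun a b => ?_) fun k l hkl => ?_) <;>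
    rw [mulMonomial, sub_neg_eq_add, sub_zero, phiWphiZ]
  · rw [mixedLeft_apply _ _ (by decide) (by decide) (by decide)]
    exact phiPlus_phiMinus_single hs0 hs hq0 m b a f
  · exact phi_phi_single_of_odd hs0 hs _ _ (fun h => hkl h.symm) f

end SingleSeries

end TwoPoint

/-! ### The exchange relations on the Fock space -/

section FockExchange

/-- The coefficient of `z^{k/2} w^{l/2}` in `(-1)^∂ δ(z, q² w)`, where the exponents of the delta
function are half-integers on the vectors `f ⊗ e_m` with `m` odd. -/
def deltaOp (q : ℂ) (k l : ℤ) : Module.End ℂ Fock :=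
  Finsupp.lsum ℂ fun m : ℤ =>
    (if k + l = -2 ∧ (k : ZMod 2) = m then q ^ l * (-1) ^ m else 0) • Finsupp.lsingle m

theorem deltaOp_single (q : ℂ) (k l m : ℤ) (f : Pol) : deltaOp q k l (Finsupp.single m f) =
    (if k + l = -2 ∧ (k : ZMod 2) = m then q ^ l * (-1) ^ m else 0) • Finsupp.single m f := by
  rw [deltaOp, Finsupp.lsum_single, LinearMap.smul_apply, Finsupp.lsingle_apply]

theorem deltaOp_apply (q : ℂ) (i : ZMod 2) {v : Fock} (hv : v ∈ V i) (k l : ℤ) :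
    deltaOp q k l v = delta q i k l • negOnePowDel v := by
  rw [deltaOp, negOnePowDel, Finsupp.lsum_apply, Finsupp.lsum_apply, Finsupp.sum, Finsupp.sum,
    Finset.smul_sum]
  refine Finset.sum_congr rfl fun m hm => ?_
  have hmi : (m : ZMod 2) = i := hv hm
  rw [LinearMap.smul_apply, LinearMap.smul_apply, smul_smul, delta, hmi]
  split_ifs <;> simp

theorem even_sub_iff (k m : ℤ) : Even (k - m) ↔ (k : ZMod 2) = m := by
  rw [eq_comm, ZMod.intCast_eq_intCast_iff_dvd_sub, even_iff_two_dvd]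
  rfl

theorem deltaOp_xMinus (q r : ℂ) (k l : ℤ) (v : Fock) :
    deltaOp q k l (xMinus q r 0 v) = xMinus q r 0 (deltaOp q k l v) := by
  induction v using Finsupp.induction_linear with
  | zero => simp
  | add u v hu hv => simp only [map_add, hu, hv]
  | single m f =>
    have h2 : ((m - 2 : ℤ) : ZMod 2) = m := by
      rw [← even_sub_iff]
      exact ⟨-1, by ring⟩
    have h3 : (-1 : ℂ) ^ (m - 2) = (-1) ^ m := by
      rw [zpow_sub₀ (by norm_num)]
      norm_num
    rw [xMinus_single, deltaOp_single, deltaOp_single, map_smul, xMinus_single, h2, h3]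

/-- The double delta function restricted to the exponent `m` of `ζ` is the delta function of the
theorem, with the half-integral exponents arising for odd `m` from the shift by `m / 2`. -/
theorem slice_doubleDelta {q s : ℂ} (hq0 : q ≠ 0) (hs0 : q * s ≠ 0) (hs : (q * s) ^ 2 = -q ^ 3)
    (m : ℤ) (f : Pol) :
    (fun k l => (s * q⁻¹) • deltaOp q k l (Finsupp.single m f)) =
      (-((q * s) ^ (2 * m - 1) * q)) • slice m m fun κ => doubleDelta q κ • f := by
  refine eq_smul_slice (fun a b => ?_) fun k l hkl => ?_
  · have hpar : ((m + 2 * a : ℤ) : ZMod 2) = m := by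
      rw [← even_sub_iff]
      exact ⟨a, by ring⟩
    have e0 : (![a, b, m] : Fin 3 → ℤ) 0 = a := rfl
    have e1 : (![a, b, m] : Fin 3 → ℤ) 1 = b := rfl
    have e2 : (![a, b, m] : Fin 3 → ℤ) 2 = m := rfl
    rw [deltaOp_single, doubleDelta, e0, e1, e2, ← Finsupp.smul_single, smul_smul, smul_smul]
    refine congrArg (· • _) ?_
    by_cases h : a + b + m = -1
    · obtain rfl : b = -1 - a - m := by omega
      rw [if_pos ⟨by ring, hpar⟩, if_pos h]
      have h1 : (q * s) ^ (2 * m - 1) = (-1) ^ m * q ^ (3 * m) * (q * s)⁻¹ := by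
        rw [zpow_sub₀ hs0, zpow_one, zpow_mul, zpow_ofNat, hs, neg_eq_neg_one_mul, mul_zpow,
          zpow_mul, zpow_ofNat, div_eq_mul_inv]
      have h2 : (q * s)⁻¹ = -(s * q⁻¹ ^ 2) := by
        refine inv_eq_of_mul_eq_one_right ?_
        have h3 : s ^ 2 = -q := by
          have hq2 : q ^ 2 ≠ 0 := pow_ne_zero _ hq0
          apply mul_left_cancel₀ hq2
          linear_combination hs
        field_simp
        linear_combination -h3
      have h4 : q ^ (m + 2 * (-1 - a - m)) = q ^ (3 * m) * q ^ (-2 - 2 * a - 4 * m) := by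
        rw [← zpow_add₀ hq0]
        congr 1
        ring
      rw [h1, h2, h4]
      field_simp
    · rw [if_neg (fun h' => h (by omega)), if_neg h, mul_zero, mul_zero]
  · rw [deltaOp_single, if_neg, zero_smul, smul_zero]
    rintro ⟨h1, h2⟩
    rw [← even_sub_iff] at h2
    obtain ⟨c, hc⟩ := h2
    exact hkl ⟨⟨c, hc⟩, ⟨-1 - c - m, by omega⟩⟩

variable {q r s : ℂ} (hq0 : q ≠ 0) (hq1 : ‖q‖ < 1) (hr : r ^ 2 = q) (hs0 : q * s ≠ 0)
  (hs : (q * s) ^ 2 = -q ^ 3)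

include hq0 hq1 hr hs0 hs

theorem fock_minus_minus (v : Fock) :
    fockZW q r s (.minus, .minus) v = fockWZ q r s (.minus, .minus) v := by
  induction v using Finsupp.induction_linear with
  | zero => rw [fockZW_zero, fockWZ_zero]
  | add u v hu hv => rw [fockZW_add, fockWZ_add, hu, hv]
  | single m f =>
    rw [fockZW_minus_minus hs0 hs, fockWZ_minus_minus hs0 hs, phi_phi_exchange hq0 hq1 hr]

theorem fock_exchange_sum (v : Fock) :
    fockZW q r s (.minus, .plus) v + q • fockZW q r s (.plus, .minus) v =
      fockWZ q r s (.plus, .minus) v + q • fockWZ q r s (.minus, .plus) v := by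
  induction v using Finsupp.induction_linear with
  | zero => simp only [fockZW_zero, fockWZ_zero]
  | add u v hu hv =>
    simp only [fockZW_add, fockWZ_add]
    linear_combination (norm := module) hu + hv
  | single m f =>
    have h := congrArg (slice m m) (exchange_sum hq0 hq1 hr f)
    rw [slice_add, slice_add, slice_scal_smul, slice_scal_smul] at h
    rw [fockZW_minus_plus hs0 hs, fockWZ_plus_minus hs0 hs, fockZW_plus_minus hq0 hs0 hs,
      fockWZ_minus_plus hq0 hs0 hs]
    linear_combination (norm := module) (q * s) ^ (2 * m - 1) • h

/-- The component of the exchange relation along `v_- ⊗ v_+`. -/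
theorem fock_exchange_minus_plus (v : Fock) :
    fockZW q r s (.minus, .plus) v =
      mulZW ((C (q ^ 2) - X)⁻¹ * -(C (1 - q ^ 2) * X)) (fockWZ q r s (.plus, .minus) v) +
        mulZW ((C (q ^ 2) - X)⁻¹ * ((1 - X) * C q)) (fockWZ q r s (.minus, .plus) v) +
        fun k l => (s * q⁻¹) • deltaOp q k l v := by
  induction v using Finsupp.induction_linear with
  | zero =>
    rw [fockZW_zero, fockWZ_zero, fockWZ_zero]
    funext k l
    simp [mulZW]
  | add u v hu hv =>
    rw [fockZW_add, fockWZ_add, fockWZ_add, mulZW_add (finiteZW_fockWZ _ _ _ _ _)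
      (finiteZW_fockWZ _ _ _ _ _), mulZW_add (finiteZW_fockWZ _ _ _ _ _)
      (finiteZW_fockWZ _ _ _ _ _), hu, hv]
    funext k l
    simp only [Pi.add_apply, map_add, smul_add]
    abel
  | single m f =>
    have h := congrArg (slice m m) (exchange_delta hq0 hq1 hr f)
    rw [slice_add, slice_add, slice_scal_smul, ← mulZW_slice (locFinite_plusMinusWZ q r f),
      ← mulZW_slice (locFinite_minusPlusWZ q r f)] at h
    rw [slice_doubleDelta hq0 hs0 hs, fockZW_minus_plus hs0 hs, fockWZ_plus_minus hs0 hs,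
      fockWZ_minus_plus hq0 hs0 hs, mulZW_smul, mulZW_smul]
    linear_combination (norm := module) (q * s) ^ (2 * m - 1) • h

/-- The component of the exchange relation along `v_+ ⊗ v_-`. -/
theorem fock_exchange_plus_minus (v : Fock) :
    fockZW q r s (.plus, .minus) v =
      mulZW ((C (q ^ 2) - X)⁻¹ * ((1 - X) * C q)) (fockWZ q r s (.plus, .minus) v) +
        mulZW ((C (q ^ 2) - X)⁻¹ * -C (1 - q ^ 2)) (fockWZ q r s (.minus, .plus) v) -
        fun k l => (s * (q ^ 2)⁻¹) • deltaOp q k l v := by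
  have h1 := fock_exchange_sum hq0 hq1 hr hs0 hs v
  have h2 := fock_exchange_minus_plus hq0 hq1 hr hs0 hs v
  have hB := finiteZW_fockWZ q r s (.plus, .minus) v
  have hB' := finiteZW_fockWZ q r s (.minus, .plus) v
  set g : ℂ⟦X⟧ := (C (q ^ 2) - X)⁻¹
  have hg : g * (C (q ^ 2) - X) = 1 :=
    PowerSeries.inv_mul_cancel _ (by simpa using pow_ne_zero 2 hq0)
  have hCq : (C q⁻¹ * C q : ℂ⟦X⟧) = 1 := by rw [← map_mul, inv_mul_cancel₀ hq0, map_one]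
  have e1 : g * ((1 - X) * C q) = C q⁻¹ + C (-q⁻¹) * (g * -(C (1 - q ^ 2) * X)) := by
    simp only [map_neg, map_sub, map_one, map_pow] at hg ⊢
    linear_combination C q⁻¹ * hg - (C q * g * (1 - X)) * hCq
  have e2 : g * -C (1 - q ^ 2) = 1 + C (-q⁻¹) * (g * ((1 - X) * C q)) := by
    simp only [map_neg, map_sub, map_one, map_pow] at hg ⊢
    linear_combination hg + (g * (1 - X)) * hCq
  have hs1 : (q ^ 2)⁻¹ = q⁻¹ * q⁻¹ := by rw [sq, mul_inv]
  rw [e2, e1, mulZW_add_left hB, mulZW_add_left hB', mulZW_C, mulZW_one, mulZW_mul hB, mulZW_C,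
    mulZW_mul hB', mulZW_C, ← e1, hs1]
  have hD : (fun k l => (s * (q⁻¹ * q⁻¹)) • deltaOp q k l v) =
      q⁻¹ • fun k l => (s * q⁻¹) • deltaOp q k l v := by
    funext k l
    rw [Pi.smul_apply, Pi.smul_apply, smul_smul]
    refine congrArg (· • _) ?_
    ring
  rw [hD]
  have hqq := inv_mul_cancel₀ hq0
  linear_combination (norm := module) q⁻¹ • h1 - q⁻¹ • h2 -
    hqq • (fockZW q r s (.plus, .minus) v - fockWZ q r s (.minus, .plus) v)

/-- `[Φ_+(z), x_0^-]_{q⁻¹} = 0`: the Serre relation. -/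
theorem phiPlus_xMinus (k : ℤ) (v : Fock) :
    phiPlus q r s k (xMinus q r 0 v) = q⁻¹ • xMinus q r 0 (phiPlus q r s k v) := by
  induction v using Finsupp.induction_linear with
  | zero => simp
  | add u v hu hv => simp only [map_add, hu, hv, smul_add]
  | single m f =>
    by_cases hk : Even (k - m)
    · obtain ⟨p, hp⟩ := hk
      obtain rfl : k = m + 2 * p := by omega
      have h2 : (q * s) ^ (m - 2) = -(q * s) ^ m * q⁻¹ ^ 3 := by
        rw [zpow_sub₀ hs0, zpow_ofNat, hs, inv_pow]
        ring
      have key := serre_modes hq0 hq1 hr p m f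
      rw [phiPlus_single _ _ _ hs0 hs, xMinus_single, map_smul, xMinus_single,
        show m + 2 * p = m - 2 + 2 * (p + 1) by ring, phiPlus_single _ _ _ hs0 hs, h2,
        show m - 2 - 1 = m - 3 by ring, show m - 1 - 2 = m - 3 by ring,
        show m - 1 - 1 = m - 2 by ring, show p + 1 + 1 = p + 2 by ring]
      have key' := congrArg (Finsupp.single (m - 3)) key
      simp only [Finsupp.single_add, Finsupp.single_sub, Finsupp.single_zero,
        ← Finsupp.smul_single, map_sub, map_smul] at key' ⊢
      linear_combination (norm := module) (q * s) ^ m • key' + (inv_mul_cancel₀ hq0) •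
        ((q * s) ^ m • Finsupp.single (m - 3) (curMode q r (m - 2) (curMode q r m
          (phiMode q r p f))))
    · rw [phiPlus_single_of_odd _ _ _ hk, map_zero, smul_zero, xMinus_single,
        phiPlus_single_of_odd]
      rwa [show k - (m - 2) = k - m + 2 by ring, Int.even_add, iff_true_right even_two]

end FockExchange

/-! ### The exchange relation of `Φ_+` and `Φ_+` -/

section PlusPlus

variable {q r s : ℂ}

theorem FiniteWZ.map {S : Series} (h : FiniteWZ S) (T : Module.End ℂ Fock) :
    FiniteWZ fun k l => T (S k l) := by
  intro κ
  obtain ⟨N, hN⟩ := h κ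
  exact ⟨N, fun n hn => (congrArg T (hN n hn)).trans (map_zero T)⟩

theorem FiniteZW.map {S : Series} (h : FiniteZW S) (T : Module.End ℂ Fock) :
    FiniteZW fun k l => T (S k l) := by
  intro κ
  obtain ⟨N, hN⟩ := h κ
  exact ⟨N, fun n hn => (congrArg T (hN n hn)).trans (map_zero T)⟩

theorem map_fockZW (T : Module.End ℂ Fock) (ε : Sgn × Sgn) (v : Fock) :
    (fun k l => T (fockZW q r s ε v k l)) =
      mulWZ (alphaPhi q) (mulMonomial (-1) 0 fun k l => T (phiZphiW q r s v ε k l)) :=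
  map_mulWZ T ((finiteWZ_phiZphiW q r s v ε).mulMonomial _ _) _

theorem map_fockWZ (T : Module.End ℂ Fock) (ε : Sgn × Sgn) (v : Fock) :
    (fun k l => T (fockWZ q r s ε v k l)) =
      mulZW (alphaPhi q) (mulMonomial 0 (-1) fun k l => T (phiWphiZ q r s v ε k l)) :=
  map_mulZW T ((finiteZW_phiWphiZ q r s v ε).mulMonomial _ _) _

variable (hq0 : q ≠ 0) (hq1 : ‖q‖ < 1) (hr : r ^ 2 = q) (hs0 : q * s ≠ 0)
  (hs : (q * s) ^ 2 = -q ^ 3)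

include hq0 hq1 hr hs0 hs

theorem fockZW_plus_minus_xMinus (v : Fock) :
    fockZW q r s (.plus, .minus) (xMinus q r 0 v) = fockZW q r s (.plus, .plus) v +
      fun k l => xMinus q r 0 (fockZW q r s (.plus, .minus) v k l) := by
  rw [map_fockZW, fockZW, fockZW, ← mulWZ_add ((finiteWZ_phiZphiW q r s v _).mulMonomial _ _)
    (((finiteWZ_phiZphiW q r s v _).map _).mulMonomial _ _)]
  refine congrArg (mulWZ _) ?_
  funext k l
  simp only [mulMonomial, phiZphiW, phi, Pi.add_apply]
  conv_rhs => rw [phiPlus.eq_def q r s (l - 0)]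
  rw [LinearMap.sub_apply, LinearMap.smul_apply, Module.End.mul_apply, Module.End.mul_apply,
    map_sub, map_smul, phiPlus_xMinus hq0 hq1 hr hs0 hs, smul_smul, mul_inv_cancel₀ hq0, one_smul,
    sub_add_cancel]

theorem fockWZ_minus_plus_xMinus (v : Fock) :
    fockWZ q r s (.minus, .plus) (xMinus q r 0 v) = fockWZ q r s (.plus, .plus) v +
      fun k l => xMinus q r 0 (fockWZ q r s (.minus, .plus) v k l) := by
  rw [map_fockWZ, fockWZ, fockWZ, ← mulZW_add ((finiteZW_phiWphiZ q r s v _).mulMonomial _ _)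
    (((finiteZW_phiWphiZ q r s v _).map _).mulMonomial _ _)]
  refine congrArg (mulZW _) ?_
  funext k l
  simp only [mulMonomial, phiWphiZ, phi, Pi.add_apply]
  conv_rhs => rw [phiPlus.eq_def q r s (k - 0)]
  rw [LinearMap.sub_apply, LinearMap.smul_apply, Module.End.mul_apply, Module.End.mul_apply,
    map_sub, map_smul, phiPlus_xMinus hq0 hq1 hr hs0 hs, smul_smul, mul_inv_cancel₀ hq0, one_smul,
    sub_add_cancel]

theorem fockWZ_plus_minus_xMinus (v : Fock) :
    fockWZ q r s (.plus, .minus) (xMinus q r 0 v) = q⁻¹ • fockWZ q r s (.plus, .plus) v +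
      fun k l => xMinus q r 0 (fockWZ q r s (.plus, .minus) v k l) := by
  rw [map_fockWZ, fockWZ, fockWZ, ← mulZW_smul]
  have hfin : FiniteZW (q⁻¹ • mulMonomial 0 (-1) (phiWphiZ q r s v (.plus, .plus))) :=
    LocFinite.smul ((finiteZW_phiWphiZ q r s v _).mulMonomial _ _) _
  rw [← mulZW_add hfin (((finiteZW_phiWphiZ q r s v _).map _).mulMonomial _ _)]
  refine congrArg (mulZW _) ?_
  funext k l
  simp only [mulMonomial, phiWphiZ, phi, Pi.add_apply, Pi.smul_apply]
  rw [phiPlus_xMinus hq0 hq1 hr hs0 hs, map_smul]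
  conv_rhs => rw [phiPlus.eq_def q r s (l - -1)]
  rw [LinearMap.sub_apply, LinearMap.smul_apply, Module.End.mul_apply, Module.End.mul_apply,
    smul_sub, smul_smul, inv_mul_cancel₀ hq0, one_smul, sub_add_cancel]

/-- The component of the exchange relation along `v_+ ⊗ v_+`, obtained from the one along
`v_+ ⊗ v_-` by taking the commutator with `x_0^-`, which removes the delta function. -/
theorem fock_plus_plus (v : Fock) :
    fockZW q r s (.plus, .plus) v = fockWZ q r s (.plus, .plus) v := by
  have h1 := fockZW_plus_minus_xMinus hq0 hq1 hr hs0 hs v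
  have h2 := fock_exchange_plus_minus hq0 hq1 hr hs0 hs v
  have hB := fun ε v => finiteZW_fockWZ q r s ε v
  have h3 : (fun k l => xMinus q r 0 (fockZW q r s (.plus, .minus) v k l)) =
      mulZW ((C (q ^ 2) - X)⁻¹ * ((1 - X) * C q))
        (fun k l => xMinus q r 0 (fockWZ q r s (.plus, .minus) v k l)) +
      mulZW ((C (q ^ 2) - X)⁻¹ * -C (1 - q ^ 2))
        (fun k l => xMinus q r 0 (fockWZ q r s (.minus, .plus) v k l)) -
      fun k l => (s * (q ^ 2)⁻¹) • deltaOp q k l (xMinus q r 0 v) := by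
    rw [← map_mulZW _ (hB _ _), ← map_mulZW _ (hB _ _), h2]
    funext k l
    simp only [Pi.sub_apply, Pi.add_apply, map_sub, map_add, map_smul, deltaOp_xMinus]
  rw [fock_exchange_plus_minus hq0 hq1 hr hs0 hs, h3,
    fockWZ_plus_minus_xMinus hq0 hq1 hr hs0 hs, fockWZ_minus_plus_xMinus hq0 hq1 hr hs0 hs,
    mulZW_add (LocFinite.smul (hB _ _) _) ((hB _ _).map _), mulZW_add (hB _ _) ((hB _ _).map _),
    ← mulZW_C, ← mulZW_mul (hB _ _)] at h1
  set g : ℂ⟦X⟧ := (C (q ^ 2) - X)⁻¹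
  have hg : g * (C (q ^ 2) - X) = 1 :=
    PowerSeries.inv_mul_cancel _ (by simpa using pow_ne_zero 2 hq0)
  have hCq : (C q⁻¹ * C q : ℂ⟦X⟧) = 1 := by rw [← map_mul, inv_mul_cancel₀ hq0, map_one]
  have e : g * ((1 - X) * C q) * C q⁻¹ + g * -C (1 - q ^ 2) = 1 := by
    simp only [map_sub, map_one, map_pow] at hg ⊢
    linear_combination hg + (g * (1 - X)) * hCq
  have h4 := mulZW_one (fockWZ q r s (.plus, .plus) v)
  rw [← e, mulZW_add_left (hB _ _)] at h4
  rw [← h4]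
  linear_combination (norm := module) -h1

end PlusPlus

/-! ### The inverse of the R-matrix -/

section RMatrix

/-- The inverse of `R(x)`. -/
def RmatInv (q : ℂ) : Matrix (Sgn × Sgn) (Sgn × Sgn) ℂ⟦X⟧
  | (.plus, .plus), (.plus, .plus) => 1
  | (.plus, .minus), (.plus, .minus) => (C (q ^ 2) - X)⁻¹ * ((1 - X) * C q)
  | (.plus, .minus), (.minus, .plus) => (C (q ^ 2) - X)⁻¹ * -C (1 - q ^ 2)
  | (.minus, .plus), (.plus, .minus) => (C (q ^ 2) - X)⁻¹ * -(C (1 - q ^ 2) * X)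
  | (.minus, .plus), (.minus, .plus) => (C (q ^ 2) - X)⁻¹ * ((1 - X) * C q)
  | (.minus, .minus), (.minus, .minus) => 1
  | _, _ => 0

theorem univ_sgn : (Finset.univ : Finset Sgn) = {Sgn.plus, Sgn.minus} := rfl

theorem Rmat_inv {q : ℂ} (hq0 : q ≠ 0) : (Rmat q)⁻¹ = RmatInv q := by
  refine Matrix.inv_eq_right_inv ?_
  have hg : (C (q ^ 2) - X : ℂ⟦X⟧)⁻¹ * (C (q ^ 2) - X) = 1 :=
    PowerSeries.inv_mul_cancel _ (by simpa using pow_ne_zero 2 hq0)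
  have hh : (1 - C (q ^ 2) * X : ℂ⟦X⟧)⁻¹ * (1 - C (q ^ 2) * X) = 1 :=
    PowerSeries.inv_mul_cancel _ (by simp)
  ext1 ⟨a, b⟩ ⟨c, d⟩
  rw [Matrix.mul_apply, Fintype.sum_prod_type]
  simp only [univ_sgn, Finset.sum_pair (show Sgn.plus ≠ Sgn.minus by decide)]
  cases a <;> cases b <;> cases c <;> cases d <;>
    simp only [Rmat, RmatInv, mul_zero, zero_mul, add_zero, zero_add, mul_one,
      Matrix.one_apply_eq, ne_eq, Prod.mk.injEq, reduceCtorEq, and_false, and_true, and_self,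
      not_false_eq_true, Matrix.one_apply_ne] <;>
    generalize (C (q ^ 2) - X : ℂ⟦X⟧)⁻¹ = g at * <;>
    generalize (1 - C (q ^ 2) * X : ℂ⟦X⟧)⁻¹ = h at * <;>
    simp only [map_sub, map_one, map_pow] at hg hh ⊢
  · linear_combination (h * (1 - C q ^ 2 * X)) * hg + hh
  · ring
  · ring
  · linear_combination (h * (1 - C q ^ 2 * X)) * hg + hh

theorem mulZW_matZW {q r s : ℂ} (M : Matrix (Sgn × Sgn) (Sgn × Sgn) ℂ⟦X⟧) (v : Fock)
    (ε : Sgn × Sgn) :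
    mulMonomial 0 (-1) (mulZW (alphaPhi q) (matZW M (phiWphiZ q r s v) ε)) =
      ∑ ε' : Sgn × Sgn, mulZW (M ε ε') (fockWZ q r s ε' v) := by
  have hF := fun ε => (finiteZW_phiWphiZ q r s v ε)
  have h1 : ∀ t : Finset (Sgn × Sgn),
      FiniteZW (∑ ε' ∈ t, mulZW (M ε ε') (phiWphiZ q r s v ε')) ∧
      mulZW (alphaPhi q) (∑ ε' ∈ t, mulZW (M ε ε') (phiWphiZ q r s v ε')) =
        ∑ ε' ∈ t, mulZW (M ε ε') (mulZW (alphaPhi q) (phiWphiZ q r s v ε')) := by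
    intro t
    induction t using Finset.induction_on with
    | empty =>
      refine ⟨fun κ => ⟨0, fun n _ => rfl⟩, ?_⟩
      funext k l
      simp [mulZW]
    | insert x t hx ih =>
      rw [Finset.sum_insert hx, Finset.sum_insert hx]
      refine ⟨((hF x).mulZW _).add ih.1, ?_⟩
      rw [mulZW_add ((hF x).mulZW _) ih.1, ih.2, ← mulZW_mul (hF x), mul_comm, mulZW_mul (hF x)]
  rw [matZW, (h1 _).2]
  funext k l
  simp only [mulMonomial, Finset.sum_apply]
  refine Finset.sum_congr rfl fun ε' _ => ?_
  rw [fockWZ, ← mulMonomial_mulZW, ← mulMonomial_mulZW, mulMonomial]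

theorem sum_RmatInv {q r s : ℂ} (v : Fock) (ε : Sgn × Sgn) :
    ∑ ε' : Sgn × Sgn, mulZW (RmatInv q ε ε') (fockWZ q r s ε' v) =
      mulZW (RmatInv q ε (.plus, .plus)) (fockWZ q r s (.plus, .plus) v) +
      mulZW (RmatInv q ε (.plus, .minus)) (fockWZ q r s (.plus, .minus) v) +
      (mulZW (RmatInv q ε (.minus, .plus)) (fockWZ q r s (.minus, .plus) v) +
      mulZW (RmatInv q ε (.minus, .minus)) (fockWZ q r s (.minus, .minus) v)) := by
  rw [Fintype.sum_prod_type]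
  simp only [univ_sgn, Finset.sum_pair (show Sgn.plus ≠ Sgn.minus by decide)]

end RMatrix

end VertexOp

end

theorem mainTheorem3 (q r s : ℂ) (hq0 : q ≠ 0) (hq1 : ‖q‖ < 1) (hr : r ^ 2 = q) (hs : s ^ 2 = -q)
    (i : ZMod 2) (v : VertexOp.Fock) (hv : v ∈ VertexOp.V i) :
    (fun ε : VertexOp.Sgn × VertexOp.Sgn =>
      VertexOp.mulMonomial (-1) 0
        (VertexOp.mulWZ (VertexOp.alphaPhi q) (VertexOp.phiZphiW q r s v ε))) =
    fun ε : VertexOp.Sgn × VertexOp.Sgn =>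
      VertexOp.mulMonomial 0 (-1)
        (VertexOp.mulZW (VertexOp.alphaPhi q)
          (VertexOp.matZW (VertexOp.Rmat q)⁻¹ (VertexOp.phiWphiZ q r s v) ε)) +
      fun k l : ℤ =>
        (s * (q⁻¹ • VertexOp.basisVec .minus .plus -
            (q ^ 2)⁻¹ • VertexOp.basisVec .plus .minus) ε * VertexOp.delta q i k l) •
          VertexOp.negOnePowDel v := by
  open VertexOp in
  have hs' : (q * s) ^ 2 = -q ^ 3 := by
    rw [mul_pow, hs]
    ring
  have hs0 : q * s ≠ 0 := by
    intro h
    rw [h] at hs'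
    exact pow_ne_zero 3 hq0 (by linear_combination hs')
  have hδ : ∀ (c : ℂ) (k l : ℤ), (c * delta q i k l) • negOnePowDel v =
      c • deltaOp q k l v := by
    intro c k l
    rw [deltaOp_apply q i hv, smul_smul]
  funext ε
  rw [mulMonomial_mulWZ, ← fockZW, Rmat_inv hq0, mulZW_matZW, sum_RmatInv]
  simp only [hδ]
  rcases ε with ⟨_ | _, _ | _⟩ <;>
    simp only [RmatInv, mulZW_zero_left, mulZW_one, add_zero, zero_add, basisVec, Pi.sub_apply,
      Pi.smul_apply, Pi.single_apply, Prod.mk.injEq, reduceCtorEq, and_false, and_true, and_self,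
      if_true, if_false, sub_zero, zero_sub, smul_eq_mul, mul_one, mul_zero, zero_smul]
  · rw [fock_plus_plus hq0 hq1 hr hs0 hs']
    exact (add_zero _).symm
  · rw [fock_exchange_plus_minus hq0 hq1 hr hs0 hs', sub_eq_add_neg]
    congr 1
    funext k l
    simp
  · rw [fock_exchange_minus_plus hq0 hq1 hr hs0 hs']
  · rw [fock_minus_minus hq0 hq1 hr hs0 hs']
    exact (add_zero _).symm
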